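/- Let $R$ be a commutative ring. A dg module is a $\mathbb Z$-graded $R$-module with a differential $\partial$ of degree $-1$, and the Koszul sign rule is used throughout. For dg modules $A,B$ let $\mathrm{Hom}(A,B)$ be the dg module whose degree $d$ part consists of the linear maps of degree $d$, with $[\partial,f]=\partial f-(-1)^{|f|}f\partial$. Put $\mathrm{Hom}^A_B(n)=\mathrm{Hom}(A^{\otimes n},B)$, $\mathrm{End}_A=\mathrm{Hom}^A_A$, $\mathrm{coHom}^C_D(n)=\mathrm{Hom}(C,D^{\otimes n})$, $\mathrm{coEnd}_C=\mathrm{coHom}^C_C$. $\mathrm{End}_A$ is a dg operad by $\gamma(f;g_1,\dots,g_k)=f\circ(g_1\otimes\cdots\otimes g_k)$ and $\mathrm{coEnd}_C$ is a dg operad by $\gamma(\varphi;\psi_1,\dots,\psi_k)=(-1)^{|\varphi|\sum_j|\psi_j|}(\psi_1\otimes\cdots\otimes\psi_k)\circ\varphi$. By the same formulas $\mathrm{Hom}^A_B$ is an $(\mathrm{End}_B,\mathrm{End}_A)$-operadic bimodule and $\mathrm{coHom}^C_D$ is a $(\mathrm{coEnd}_C,\mathrm{coEnd}_D)$-operadic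 bimodule (left action, right action). Let $\mathrm A_\infty$ be the quasi-free nonsymmetric dg operad over $R$ generated by operations $m_n$ of arity $n$ and degree $n-2$, $n\ge2$, with $$\partial m_n=-\sum_{p+q+r=n,\ 2\le q\le n-1}(-1)^{p+qr}\,m_{p+1+r}(\mathrm{id}^{\otimes p}\otimes m_q\otimes\mathrm{id}^{\otimes r}).$$ Let $\mathrm M_\infty$ be the quasi-free dg $(\mathrm A_\infty,\mathrm A_\infty)$-operadic bimodule generated by operations $f_n$ of arity $n$ and degree $n-1$, $n\ge1$, with $$\partial f_n=\sum_{p+q+r=n,\ q\ge2}(-1)^{p+qr}f_{p+1+r}(\mathrm{id}^{\otimes p}\otimes m_q\otimes\mathrm{id}^{\otimes r})-\sum_{i_1+\cdots+i_k=n,\ k\ge2}(-1)^{\varepsilon}m_k(f_{i_1}\otimes\cdots\otimes f_{i_k}),\qquad \varepsilon=\sum_{u=1}^k(k-u)(1-i_u).$$ An $\mathrm A_\infty$-algebra structure on a dg module $A$ is a morphism of dg operads $\mathrm A_\infty\to\mathrm{End}_A$, that is, operations $m_n:A^{\otimes n}\to A$, $n\ge 2$, of degree $n-2$ satisfying the equations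 above; an $\mathrm A_\infty$-coalgebra structure on $C$ is a morphism of dg operads $\mathrm A_\infty\to\mathrm{coEnd}_C$. An $\mathrm A_\infty$-morphism $A\rightsquigarrow B$ of $\mathrm A_\infty$-algebras is a morphism of dg operadic bimodules $\mathrm M_\infty\to\mathrm{Hom}^A_B$ (over the structure morphisms $\mathrm A_\infty\to\mathrm{End}_B$ and $\mathrm A_\infty\to\mathrm{End}_A$), that is, operations $f_n:A^{\otimes n}\to B$, $n\ge1$, of degree $n-1$ satisfying the equations above; an $\mathrm A_\infty$-morphism $C\rightsquigarrow D$ of $\mathrm A_\infty$-coalgebras is likewise a morphism of dg operadic bimodules $\mathrm M_\infty\to\mathrm{coHom}^C_D$. Tensor products of operads and of bimodules are taken arity by arity. A diagonal on $\mathrm A_\infty$ is a morphism of dg operads $\triangle:\mathrm A_\infty\to\mathrm A_\infty\otimes\mathrm A_\infty$ with $\triangle(m_2)=m_2\otimes m_2$. Given such a $\triangle$, a diagonal on $\mathrm M_\infty$ is a morphism of dg $(\mathrm A_\infty,\mathrm A_\infty)$-operadic bimodules $\triangle_{\mathrm M}:\mathrm M_\infty\to\mathrm M_\infty\otimes\mathrm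 M_\infty$ with $\triangle_{\mathrm M}(f_1)=f_1\otimes f_1$, where $\mathrm M_\infty\otimes\mathrm M_\infty$ is an $(\mathrm A_\infty,\mathrm A_\infty)$-bimodule through $\triangle$. For dg modules $C_1,C_2,A_1,A_2$ let $$\Theta:\ \mathrm{coHom}^{C_2}_{C_1}\otimes\mathrm{Hom}^{A_1}_{A_2}\to\mathrm{Hom}^{\mathrm{Hom}(C_1,A_1)}_{\mathrm{Hom}(C_2,A_2)},\qquad \Theta(\varphi\otimes g)(h_1\otimes\cdots\otimes h_n)=(-1)^{|\varphi|(|g|+\sum_i|h_i|)}\,g\circ(h_1\otimes\cdots\otimes h_n)\circ\varphi,$$ so that for $C_1=C_2=C$ and $A_1=A_2=A$ it is a map $\mathrm{coEnd}_C\otimes\mathrm{End}_A\to\mathrm{End}_{\mathrm{Hom}(C,A)}$. **Proposition.** Let $\triangle$ be a diagonal on the operad $\mathrm A_\infty$. 1. Let $C$ be an $\mathrm A_\infty$-coalgebra and $A$ an $\mathrm A_\infty$-algebra. Then $\triangle$ induces an $\mathrm A_\infty$-algebra structure on the dg module $(\mathrm{Hom}(C,A),[\partial,\cdot])$: there is a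 unique $\mathrm A_\infty$-algebra structure on this dg module whose structure morphism $\mathrm A_\infty\to\mathrm{End}_{\mathrm{Hom}(C,A)}$ is the composite $$\mathrm A_\infty\xrightarrow{\ \triangle\ }\mathrm A_\infty\otimes\mathrm A_\infty\to\mathrm{coEnd}_C\otimes\mathrm{End}_A\xrightarrow{\ \Theta\ }\mathrm{End}_{\mathrm{Hom}(C,A)}.$$ It is called the convolution $\mathrm A_\infty$-algebra of $C$ and $A$. 2. Let $F:A_1\rightsquigarrow A_2$ be an $\mathrm A_\infty$-morphism of $\mathrm A_\infty$-algebras, let $G:C_2\rightsquigarrow C_1$ be an $\mathrm A_\infty$-morphism of $\mathrm A_\infty$-coalgebras, and let $\triangle_{\mathrm M}$ be a diagonal on the operadic bimodule $\mathrm M_\infty$ (relative to $\triangle$). Then $\triangle_{\mathrm M}$ induces an $\mathrm A_\infty$-morphism between the convolution $\mathrm A_\infty$-algebras $\mathrm{Hom}(C_1,A_1)\rightsquigarrow\mathrm{Hom}(C_2,A_2)$: there is a unique such $\mathrm A_\infty$-morphism whose structure morphism is the composite $$\mathrm M_\infty\xrightarrow{\ \triangle_{\mathrm M}\ }\mathrm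 M_\infty\otimes\mathrm M_\infty\to\mathrm{coHom}^{C_2}_{C_1}\otimes\mathrm{Hom}^{A_1}_{A_2}\xrightarrow{\ \Theta\ }\mathrm{Hom}^{\mathrm{Hom}(C_1,A_1)}_{\mathrm{Hom}(C_2,A_2)}.$$ -/

import Mathlib

noncomputable section

open scoped DirectSum TensorProduct

namespace ConvAInf

universe u v v₁ v₂ v₃ v₄ w

/-! ### Signs -/

/-- The scalar `(-1) ^ d`, for `d : ℤ`. -/
def ksign (R : Type u) [CommRing R] (d : ℤ) : R := ((Int.negOnePow d : ℤ) : R)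

/-- The exponent of the Koszul sign of the shuffle
`(b₁ b₂ ⋯ b_k)(a₁ a₂ ⋯ a_k) ↦ b₁ a₁ b₂ a₂ ⋯ b_k a_k` of homogeneous symbols with degrees `b j`
and `a j`: each `a j` moves to the left past all `b i` with `j < i`. -/
def shuffleExp {k : ℕ} (b a : Fin k → ℤ) : ℤ :=
  ∑ j, ∑ i ∈ Finset.Ioi j, a j * b i

/-! ### Structure maps of dg operads and of dg operadic bimodules -/

/-- The underlying data of a (nonsymmetric) dg operad over `R`: the modules `X n d` of operations of
arity `n` and degree `d`, the identity operation, the total composition maps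
`comp x y = γ(x; y₁, …, y_k)`, and the differential, of degree `-1`. -/
structure OperadOps (R : Type u) [CommRing R] where
  X : ℕ → ℤ → Type v
  [acg : ∀ n d, AddCommGroup (X n d)]
  [mod : ∀ n d, Module R (X n d)]
  one : X 1 0
  comp : ∀ {k : ℕ} {a : ℤ} {n : Fin k → ℕ} {e : Fin k → ℤ},
    X k a → (∀ j, X (n j) (e j)) → X (∑ j, n j) (a + ∑ j, e j)
  d : ∀ {n : ℕ} {a : ℤ}, X n a →ₗ[R] X n (a - 1)

attribute [instance] OperadOps.acg OperadOps.mod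

/-- The underlying data of a dg `(P, Q)`-operadic bimodule: the modules `X n d`, the left action
`lact x y = λ(x; y₁, …, y_k)` of `P`, the right action `ract y x = ρ(y; x₁, …, x_k)` of `Q`, and the
differential. -/
structure BimoduleOps {R : Type u} [CommRing R] (P : OperadOps.{u, v₁} R) (Q : OperadOps.{u, v₂} R)
    where
  X : ℕ → ℤ → Type v
  [acg : ∀ n d, AddCommGroup (X n d)]
  [mod : ∀ n d, Module R (X n d)]
  lact : ∀ {k : ℕ} {a : ℤ} {n : Fin k → ℕ} {e : Fin k → ℤ},
    P.X k a → (∀ j, X (n j) (e j)) → X (∑ j, n j) (a + ∑ j, e j)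
  ract : ∀ {k : ℕ} {a : ℤ} {n : Fin k → ℕ} {e : Fin k → ℤ},
    X k a → (∀ j, Q.X (n j) (e j)) → X (∑ j, n j) (a + ∑ j, e j)
  d : ∀ {n : ℕ} {a : ℤ}, X n a →ₗ[R] X n (a - 1)

attribute [instance] BimoduleOps.acg BimoduleOps.mod

/-- A morphism of dg operads. -/
structure OperadHom {R : Type u} [CommRing R] (P : OperadOps.{u, v₁} R) (Q : OperadOps.{u, v₂} R)
    where
  map : ∀ {n : ℕ} {a : ℤ}, P.X n a →ₗ[R] Q.X n a
  map_one : map P.one = Q.one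
  map_comp : ∀ {k : ℕ} {a : ℤ} {n : Fin k → ℕ} {e : Fin k → ℤ} (x : P.X k a)
    (y : ∀ j, P.X (n j) (e j)), map (P.comp x y) = Q.comp (map x) (fun j => map (y j))
  map_d : ∀ {n : ℕ} {a : ℤ} (x : P.X n a), map (P.d x) = Q.d (map x)

/-- A morphism of dg operadic bimodules from the `(P, Q)`-bimodule `M` to the `(P', Q')`-bimodule
`N`, where `N` is regarded as a `(P, Q)`-bimodule along `φ : P → P'` and `ψ : Q → Q'`. -/
structure BimoduleHom {R : Type u} [CommRing R] {P Q : OperadOps.{u, v₁} R}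
    {P' Q' : OperadOps.{u, v₂} R} (φ : OperadHom P P') (ψ : OperadHom Q Q')
    (M : BimoduleOps.{u, v₃} P Q) (N : BimoduleOps.{u, v₄} P' Q') where
  map : ∀ {n : ℕ} {a : ℤ}, M.X n a →ₗ[R] N.X n a
  map_lact : ∀ {k : ℕ} {a : ℤ} {n : Fin k → ℕ} {e : Fin k → ℤ} (x : P.X k a)
    (y : ∀ j, M.X (n j) (e j)), map (M.lact x y) = N.lact (φ.map x) (fun j => map (y j))
  map_ract : ∀ {k : ℕ} {a : ℤ} {n : Fin k → ℕ} {e : Fin k → ℤ} (y : M.X k a)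
    (x : ∀ j, Q.X (n j) (e j)), map (M.ract y x) = N.ract (map y) (fun j => ψ.map (x j))
  map_d : ∀ {n : ℕ} {a : ℤ} (y : M.X n a), map (M.d y) = N.d (map y)

/-- Transport of operations along equalities of arities and degrees. -/
def OperadOps.cast {R : Type u} [CommRing R] (P : OperadOps.{u, v} R) {n n' : ℕ} {d d' : ℤ}
    (hn : n = n') (hd : d = d') (x : P.X n d) : P.X n' d' := hn ▸ hd ▸ x

/-- Transport of operations along equalities of arities and degrees. -/
def BimoduleOps.cast {R : Type u} [CommRing R] {P : OperadOps.{u, v₁} R} {Q : OperadOps.{u, v₂} R}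
    (M : BimoduleOps.{u, v} P Q) {n n' : ℕ} {d d' : ℤ}
    (hn : n = n') (hd : d = d') (x : M.X n d) : M.X n' d' := hn ▸ hd ▸ x

/-! ### Planar trees: the basis of the operad `A_∞` -/

/-- Planar rooted trees all of whose vertices have at least two inputs. The vertex with `n` inputs
stands for the generating operation `m_n`; the tree `node n h c` stands for the composite
`γ(m_n; c₁, …, c_n)`. -/
inductive Tree : Type
  | leaf : Tree
  | node (n : ℕ) (h : 2 ≤ n) (c : Fin n → Tree) : Tree

namespace Tree

/-- The number of leaves. -/
def leaves : Tree → ℕ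
  | leaf => 1
  | node _ _ c => ∑ j, (c j).leaves

/-- The degree: a vertex with `n` inputs has degree `n - 2`. -/
def deg : Tree → ℤ
  | leaf => 0
  | node n _ c => ((n : ℤ) - 2) + ∑ j, (c j).deg

/-- Grafting of the tree `s i` on the `i`-th leaf of `t`, for all `i`. -/
def graft : (t : Tree) → (Fin t.leaves → Tree) → Tree
  | leaf, s => s (0 : Fin 1)
  | node n h c, s => node n h fun j => (c j).graft fun i => s (finSigmaFinEquiv ⟨j, i⟩)

/-- The exponent of the Koszul sign in `γ(t; s₁, …, s_k) = ± graft t s`, where `e i` is the degree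
of `s i`. -/
def graftExp : (t : Tree) → (Fin t.leaves → ℤ) → ℤ
  | leaf, _ => 0
  | node _ _ c, e =>
    shuffleExp (fun j => (c j).deg) (fun j => ∑ i, e (finSigmaFinEquiv ⟨j, i⟩)) +
      ∑ j, (c j).graftExp fun i => e (finSigmaFinEquiv ⟨j, i⟩)

theorem leaves_graft : ∀ (t : Tree) (s : Fin t.leaves → Tree),
    (t.graft s).leaves = ∑ i, (s i).leaves
  | leaf, s => by
    change (s (0 : Fin 1)).leaves = ∑ i : Fin 1, (s i).leaves
    simp
  | node n h c, s => by
    have ih := fun j => leaves_graft (c j) (fun i => s (finSigmaFinEquiv ⟨j, i⟩))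
    change ∑ j, ((c j).graft fun i => s (finSigmaFinEquiv ⟨j, i⟩)).leaves = _
    simp only [ih]
    rw [← Finset.sum_sigma (s := Finset.univ) (t := fun _ => Finset.univ)
      (f := fun x : (j : Fin n) × Fin (c j).leaves => (s (finSigmaFinEquiv x)).leaves)]
    exact Fintype.sum_equiv finSigmaFinEquiv _ _ fun _ => rfl

theorem deg_graft : ∀ (t : Tree) (s : Fin t.leaves → Tree),
    (t.graft s).deg = t.deg + ∑ i, (s i).deg
  | leaf, s => by
    change (s (0 : Fin 1)).deg = 0 + ∑ i : Fin 1, (s i).deg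
    simp
  | node n h c, s => by
    have ih := fun j => deg_graft (c j) (fun i => s (finSigmaFinEquiv ⟨j, i⟩))
    change ((n : ℤ) - 2) + ∑ j, ((c j).graft fun i => s (finSigmaFinEquiv ⟨j, i⟩)).deg =
      (((n : ℤ) - 2) + ∑ j, (c j).deg) + _
    simp only [ih, Finset.sum_add_distrib, add_assoc]
    congr 2
    rw [← Finset.sum_sigma (s := Finset.univ) (t := fun _ => Finset.univ)
      (f := fun x : (j : Fin n) × Fin (c j).leaves => (s (finSigmaFinEquiv x)).deg)]
    exact Fintype.sum_equiv finSigmaFinEquiv _ _ fun _ => rfl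

end Tree

/-- Trees with `n` leaves and of degree `d`. -/
abbrev TreeN (n : ℕ) (d : ℤ) : Type := {t : Tree // t.leaves = n ∧ t.deg = d}

namespace TreeN

/-- The same tree, with another name for its arity and its degree. -/
def cast {n n' : ℕ} {d d' : ℤ} (hn : n = n') (hd : d = d') (t : TreeN n d) : TreeN n' d' :=
  ⟨t.1, t.2.1.trans hn, t.2.2.trans hd⟩

/-- The tree `|` with one leaf and no vertex: the identity operation. -/
def one : TreeN 1 0 := ⟨Tree.leaf, rfl, rfl⟩

/-- The corolla with `n` leaves. -/
def corolla (n : ℕ) (h : 2 ≤ n) : TreeN n ((n : ℤ) - 2) :=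
  ⟨Tree.node n h fun _ => Tree.leaf, by simp [Tree.leaves], by simp [Tree.deg]⟩

/-- Grafting, keeping track of arities and degrees. -/
def graft {k : ℕ} {a : ℤ} {n : Fin k → ℕ} {e : Fin k → ℤ} (t : TreeN k a)
    (s : ∀ j, TreeN (n j) (e j)) : TreeN (∑ j, n j) (a + ∑ j, e j) :=
  ⟨t.1.graft fun i => (s (Fin.cast t.2.1 i)).1, by
    rw [Tree.leaves_graft]
    simp only [fun j => (s j).2.1]
    exact Fintype.sum_equiv (finCongr t.2.1) _ _ fun _ => rfl, by
    rw [Tree.deg_graft]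
    simp only [fun j => (s j).2.2]
    exact congrArg₂ (· + ·) t.2.2 (Fintype.sum_equiv (finCongr t.2.1) _ _ fun _ => rfl)⟩

/-- The exponent of the Koszul sign in `γ(t; s₁, …, s_k) = ± graft t s` for `s j` of degree `e j`. -/
def graftExp {k : ℕ} {a : ℤ} (t : TreeN k a) (e : Fin k → ℤ) : ℤ :=
  t.1.graftExp fun i => e (Fin.cast t.2.1 i)

end TreeN

/-- The triples `(p, q, r)` with `p + q + r = n` and `2 ≤ q ≤ n`. -/
abbrev Split (n : ℕ) : Type :=
  {x : Fin (n + 1) × Fin (n + 1) × Fin (n + 1) //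
    (x.1 : ℕ) + (x.2.1 : ℕ) + (x.2.2 : ℕ) = n ∧ 2 ≤ (x.2.1 : ℕ)}

namespace Split

variable {n : ℕ}

def p (x : Split n) : ℕ := x.1.1
def q (x : Split n) : ℕ := x.1.2.1
def r (x : Split n) : ℕ := x.1.2.2

theorem sum_eq (x : Split n) : x.p + x.q + x.r = n := x.2.1
theorem two_le_q (x : Split n) : 2 ≤ x.q := x.2.2

/-- The exponent of the sign `(-1)^{p + qr}`. -/
def exp (x : Split n) : ℤ := (x.p : ℤ) + x.q * x.r

end Split

/-- The triples `(p, q, r)` with `p + q + r = n` and `2 ≤ q ≤ n - 1`. -/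
abbrev ProperSplit (n : ℕ) : Type := {x : Split n // x.q + 1 ≤ n}

theorem sum_ite_fin {M : Type*} [AddCommMonoid M] (p r : ℕ) (x y : M) :
    ∑ j : Fin (p + 1 + r), (if (j : ℕ) = p then x else y) = x + (p + r) • y := by
  rw [Finset.sum_ite, Finset.sum_const, Finset.sum_const]
  have h1 : (Finset.univ.filter fun j : Fin (p + 1 + r) => (j : ℕ) = p) = {⟨p, by omega⟩} := by
    ext j; simp [Fin.ext_iff]
  have h2 : (Finset.univ.filter fun j : Fin (p + 1 + r) => ¬ (j : ℕ) = p).card = p + r := by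
    have := Finset.card_filter_add_card_filter_not (s := (Finset.univ : Finset (Fin (p + 1 + r))))
      (fun j => (j : ℕ) = p)
    rw [h1, Finset.card_singleton, Finset.card_univ, Fintype.card_fin] at this
    omega
  rw [h1, h2]; simp

/-- The tree with two vertices representing the partial composite
`m_{p+1+r} (id^{⊗p} ⊗ m_q ⊗ id^{⊗r})`. -/
def Split.facet {n : ℕ} (x : Split n) (hx : x.q + 1 ≤ n) : TreeN n ((n : ℤ) - 2 - 1) :=
  ⟨Tree.node (x.p + 1 + x.r) (by have := x.sum_eq; omega) fun j =>
      if (j : ℕ) = x.p then (TreeN.corolla x.q x.two_le_q).1 else Tree.leaf, by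
    have h : ∀ j : Fin (x.p + 1 + x.r), (if (j : ℕ) = x.p then
        (TreeN.corolla x.q x.two_le_q).1 else Tree.leaf).leaves =
        if (j : ℕ) = x.p then x.q else 1 := fun j => by
      split_ifs
      · exact (TreeN.corolla x.q x.two_le_q).2.1
      · rfl
    simp only [Tree.leaves, h, sum_ite_fin]
    have := x.sum_eq
    simp; omega, by
    have h : ∀ j : Fin (x.p + 1 + x.r), (if (j : ℕ) = x.p then
        (TreeN.corolla x.q x.two_le_q).1 else Tree.leaf).deg =
        if (j : ℕ) = x.p then (x.q : ℤ) - 2 else 0 := fun j => by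
      split_ifs
      · exact (TreeN.corolla x.q x.two_le_q).2.2
      · rfl
    simp only [Tree.deg, h, sum_ite_fin]
    have := x.sum_eq
    simp; omega⟩

/-- The value on the basis element `t` of the differential of `A_∞`: the unique derivation with
`∂ m_n = - ∑_{p + q + r = n, 2 ≤ q ≤ n - 1} (-1)^{p + qr} m_{p+1+r} (id^{⊗p} ⊗ m_q ⊗ id^{⊗r})`,
i.e. `∂ γ(m_n; c₁, …, c_n)` is
`γ(∂ m_n; c₁, …, c_n) + ∑_j (-1)^{|m_n| + |c₁| + ⋯ + |c_{j-1}|} γ(m_n; c₁, …, ∂ c_j, …, c_n)`. -/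
def Tree.bd (R : Type u) [CommRing R] : (t : Tree) → (TreeN t.leaves (t.deg - 1) →₀ R)
  | leaf => 0
  | node n h c =>
    -(∑ x : ProperSplit n, Finsupp.single
        (TreeN.cast (n' := ∑ j, (c j).leaves) (d' := ((n : ℤ) - 2) + ∑ j, (c j).deg - 1) rfl
          (by ring)
          (TreeN.graft (x.1.facet x.2) fun j => (⟨c j, rfl, rfl⟩ : TreeN _ _)))
        (ksign R (x.1.exp + (x.1.facet x.2).graftExp fun j => (c j).deg))) +
    ∑ j, ksign R (((n : ℤ) - 2) + ∑ i ∈ Finset.Iio j, (c i).deg) •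
      (Tree.bd R (c j)).mapDomain fun s =>
        (⟨node n h (Function.update c j s.1), by
            simp only [leaves]
            refine Finset.sum_congr rfl fun i _ => ?_
            by_cases hij : i = j
            · subst hij; simp [s.2.1]
            · simp [hij], by
            simp only [deg]
            have : ∀ i, (Function.update c j s.1 i).deg =
                (c i).deg - if i = j then 1 else 0 := fun i => by
              by_cases hij : i = j
              · subst hij; simp [s.2.2]
              · simp [hij]
            simp only [this, Finset.sum_sub_distrib]
            simp; ring⟩ :
          TreeN (∑ j, (c j).leaves) (((n : ℤ) - 2) + ∑ j, (c j).deg - 1))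

/-- Multilinear extension of an operation `op b s` given on basis elements. -/
def multiExt {R : Type u} [CommRing R] {k : ℕ} {B : Type v} {B' : Fin k → Type w} {Y : Type v₁}
    [AddCommGroup Y] [Module R Y] (op : B → (∀ j, B' j) → Y) (x : B →₀ R) (y : ∀ j, B' j →₀ R) :
    Y :=
  x.sum fun b r => ∑ s ∈ Fintype.piFinset (fun j => (y j).support), (r * ∏ j, y j (s j)) • op b s

/-- The dg operad `A_∞`: the quasi-free dg operad generated by one operation `m_n` of arity `n` and
degree `n - 2` for each `n ≥ 2`. Its operations of arity `n` and degree `d` have the planar trees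
with `n` leaves and of degree `d` as a basis. -/
def AInf (R : Type u) [CommRing R] : OperadOps.{u, u} R where
  X n d := TreeN n d →₀ R
  one := Finsupp.single TreeN.one 1
  comp {k a n e} x y :=
    multiExt (fun (t : TreeN k a) (s : ∀ j, TreeN (n j) (e j)) =>
      ksign R (t.graftExp e) • Finsupp.single (t.graft s) (1 : R)) x y
  d {n a} := Finsupp.linearCombination R fun t : TreeN n a =>
    (t.1.bd R).mapDomain (TreeN.cast t.2.1 (by rw [t.2.2]))

/-- The generating operation `m_n` of `A_∞`. -/
def AInf.gen (R : Type u) [CommRing R] (n : ℕ) (h : 2 ≤ n) : (AInf R).X n ((n : ℤ) - 2) :=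
  Finsupp.single (TreeN.corolla n h) (1 : R)

/-! ### Two-coloured trees: the basis of the operadic bimodule `M_∞` -/

/-- Two-coloured planar trees. The tree `mor n h c` stands for `ρ(f_n; c₁, …, c_n)`, where the `c_j`
are trees of the upper colour, and `node k h c` stands for `λ(m_k; c₁, …, c_k)`, with `m_k` of the
lower colour. -/
inductive MTree : Type
  | mor (n : ℕ) (h : 1 ≤ n) (c : Fin n → Tree) : MTree
  | node (k : ℕ) (h : 2 ≤ k) (c : Fin k → MTree) : MTree

namespace MTree

/-- The number of leaves. -/
def leaves : MTree → ℕ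
  | mor _ _ c => ∑ j, (c j).leaves
  | node _ _ c => ∑ j, (c j).leaves

/-- The degree: `f_n` has degree `n - 1` and `m_k` has degree `k - 2`. -/
def deg : MTree → ℤ
  | mor n _ c => ((n : ℤ) - 1) + ∑ j, (c j).deg
  | node k _ c => ((k : ℤ) - 2) + ∑ j, (c j).deg

/-- Grafting of two-coloured trees on the leaves of a tree of the lower colour. -/
def lgraft : (t : Tree) → (Fin t.leaves → MTree) → MTree
  | Tree.leaf, s => s (0 : Fin 1)
  | Tree.node n h c, s => node n h fun j => lgraft (c j) fun i => s (finSigmaFinEquiv ⟨j, i⟩)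

/-- Grafting of trees of the upper colour on the leaves of a two-coloured tree. -/
def rgraft : (t : MTree) → (Fin t.leaves → Tree) → MTree
  | mor n h c, s => mor n h fun j => (c j).graft fun i => s (finSigmaFinEquiv ⟨j, i⟩)
  | node k h c, s => node k h fun j => (c j).rgraft fun i => s (finSigmaFinEquiv ⟨j, i⟩)

/-- The exponent of the Koszul sign in `ρ(t; s₁, …, s_k) = ± rgraft t s`, where `e i` is the degree
of `s i`. -/
def rgraftExp : (t : MTree) → (Fin t.leaves → ℤ) → ℤ
  | mor _ _ c, e =>
    shuffleExp (fun j => (c j).deg) (fun j => ∑ i, e (finSigmaFinEquiv ⟨j, i⟩)) +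
      ∑ j, (c j).graftExp fun i => e (finSigmaFinEquiv ⟨j, i⟩)
  | node _ _ c, e =>
    shuffleExp (fun j => (c j).deg) (fun j => ∑ i, e (finSigmaFinEquiv ⟨j, i⟩)) +
      ∑ j, (c j).rgraftExp fun i => e (finSigmaFinEquiv ⟨j, i⟩)

theorem leaves_lgraft : ∀ (t : Tree) (s : Fin t.leaves → MTree),
    (lgraft t s).leaves = ∑ i, (s i).leaves
  | Tree.leaf, s => by
    change (s (0 : Fin 1)).leaves = ∑ i : Fin 1, (s i).leaves
    simp
  | Tree.node n h c, s => by
    have ih := fun j => leaves_lgraft (c j) (fun i => s (finSigmaFinEquiv ⟨j, i⟩))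
    change ∑ j, (lgraft (c j) fun i => s (finSigmaFinEquiv ⟨j, i⟩)).leaves = _
    simp only [ih]
    rw [← Finset.sum_sigma (s := Finset.univ) (t := fun _ => Finset.univ)
      (f := fun x : (j : Fin n) × Fin (c j).leaves => (s (finSigmaFinEquiv x)).leaves)]
    exact Fintype.sum_equiv finSigmaFinEquiv _ _ fun _ => rfl

theorem deg_lgraft : ∀ (t : Tree) (s : Fin t.leaves → MTree),
    (lgraft t s).deg = t.deg + ∑ i, (s i).deg
  | Tree.leaf, s => by
    change (s (0 : Fin 1)).deg = 0 + ∑ i : Fin 1, (s i).deg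
    simp
  | Tree.node n h c, s => by
    have ih := fun j => deg_lgraft (c j) (fun i => s (finSigmaFinEquiv ⟨j, i⟩))
    change ((n : ℤ) - 2) + ∑ j, (lgraft (c j) fun i => s (finSigmaFinEquiv ⟨j, i⟩)).deg =
      (((n : ℤ) - 2) + ∑ j, (c j).deg) + _
    simp only [ih, Finset.sum_add_distrib, add_assoc]
    congr 2
    rw [← Finset.sum_sigma (s := Finset.univ) (t := fun _ => Finset.univ)
      (f := fun x : (j : Fin n) × Fin (c j).leaves => (s (finSigmaFinEquiv x)).deg)]
    exact Fintype.sum_equiv finSigmaFinEquiv _ _ fun _ => rfl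

theorem leaves_rgraft : ∀ (t : MTree) (s : Fin t.leaves → Tree),
    (t.rgraft s).leaves = ∑ i, (s i).leaves
  | mor n h c, s => by
    have ih := fun j => (c j).leaves_graft (fun i => s (finSigmaFinEquiv ⟨j, i⟩))
    change ∑ j, ((c j).graft fun i => s (finSigmaFinEquiv ⟨j, i⟩)).leaves = _
    simp only [ih]
    rw [← Finset.sum_sigma (s := Finset.univ) (t := fun _ => Finset.univ)
      (f := fun x : (j : Fin n) × Fin (c j).leaves => (s (finSigmaFinEquiv x)).leaves)]
    exact Fintype.sum_equiv finSigmaFinEquiv _ _ fun _ => rfl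
  | node n h c, s => by
    have ih := fun j => leaves_rgraft (c j) (fun i => s (finSigmaFinEquiv ⟨j, i⟩))
    change ∑ j, ((c j).rgraft fun i => s (finSigmaFinEquiv ⟨j, i⟩)).leaves = _
    simp only [ih]
    rw [← Finset.sum_sigma (s := Finset.univ) (t := fun _ => Finset.univ)
      (f := fun x : (j : Fin n) × Fin (c j).leaves => (s (finSigmaFinEquiv x)).leaves)]
    exact Fintype.sum_equiv finSigmaFinEquiv _ _ fun _ => rfl

theorem deg_rgraft : ∀ (t : MTree) (s : Fin t.leaves → Tree),
    (t.rgraft s).deg = t.deg + ∑ i, (s i).deg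
  | mor n h c, s => by
    have ih := fun j => (c j).deg_graft (fun i => s (finSigmaFinEquiv ⟨j, i⟩))
    change ((n : ℤ) - 1) + ∑ j, ((c j).graft fun i => s (finSigmaFinEquiv ⟨j, i⟩)).deg =
      (((n : ℤ) - 1) + ∑ j, (c j).deg) + _
    simp only [ih, Finset.sum_add_distrib, add_assoc]
    congr 2
    rw [← Finset.sum_sigma (s := Finset.univ) (t := fun _ => Finset.univ)
      (f := fun x : (j : Fin n) × Fin (c j).leaves => (s (finSigmaFinEquiv x)).deg)]
    exact Fintype.sum_equiv finSigmaFinEquiv _ _ fun _ => rfl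
  | node n h c, s => by
    have ih := fun j => deg_rgraft (c j) (fun i => s (finSigmaFinEquiv ⟨j, i⟩))
    change ((n : ℤ) - 2) + ∑ j, ((c j).rgraft fun i => s (finSigmaFinEquiv ⟨j, i⟩)).deg =
      (((n : ℤ) - 2) + ∑ j, (c j).deg) + _
    simp only [ih, Finset.sum_add_distrib, add_assoc]
    congr 2
    rw [← Finset.sum_sigma (s := Finset.univ) (t := fun _ => Finset.univ)
      (f := fun x : (j : Fin n) × Fin (c j).leaves => (s (finSigmaFinEquiv x)).deg)]
    exact Fintype.sum_equiv finSigmaFinEquiv _ _ fun _ => rfl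

end MTree

/-- Two-coloured trees with `n` leaves and of degree `d`. -/
abbrev MTreeN (n : ℕ) (d : ℤ) : Type := {t : MTree // t.leaves = n ∧ t.deg = d}

namespace MTreeN

/-- The same tree, with another name for its arity and its degree. -/
def cast {n n' : ℕ} {d d' : ℤ} (hn : n = n') (hd : d = d') (t : MTreeN n d) : MTreeN n' d' :=
  ⟨t.1, t.2.1.trans hn, t.2.2.trans hd⟩

/-- The corolla with `n` leaves representing `f_n`. -/
def corolla (n : ℕ) (h : 1 ≤ n) : MTreeN n ((n : ℤ) - 1) :=
  ⟨MTree.mor n h fun _ => Tree.leaf, by simp [MTree.leaves, Tree.leaves],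
    by simp [MTree.deg, Tree.deg]⟩

/-- Grafting below, keeping track of arities and degrees. -/
def lgraft {k : ℕ} {a : ℤ} {n : Fin k → ℕ} {e : Fin k → ℤ} (t : TreeN k a)
    (s : ∀ j, MTreeN (n j) (e j)) : MTreeN (∑ j, n j) (a + ∑ j, e j) :=
  ⟨MTree.lgraft t.1 fun i => (s (Fin.cast t.2.1 i)).1, by
    rw [MTree.leaves_lgraft]
    simp only [fun j => (s j).2.1]
    exact Fintype.sum_equiv (finCongr t.2.1) _ _ fun _ => rfl, by
    rw [MTree.deg_lgraft]
    simp only [fun j => (s j).2.2]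
    exact congrArg₂ (· + ·) t.2.2 (Fintype.sum_equiv (finCongr t.2.1) _ _ fun _ => rfl)⟩

/-- Grafting above, keeping track of arities and degrees. -/
def rgraft {k : ℕ} {a : ℤ} {n : Fin k → ℕ} {e : Fin k → ℤ} (t : MTreeN k a)
    (s : ∀ j, TreeN (n j) (e j)) : MTreeN (∑ j, n j) (a + ∑ j, e j) :=
  ⟨t.1.rgraft fun i => (s (Fin.cast t.2.1 i)).1, by
    rw [MTree.leaves_rgraft]
    simp only [fun j => (s j).2.1]
    exact Fintype.sum_equiv (finCongr t.2.1) _ _ fun _ => rfl, by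
    rw [MTree.deg_rgraft]
    simp only [fun j => (s j).2.2]
    exact congrArg₂ (· + ·) t.2.2 (Fintype.sum_equiv (finCongr t.2.1) _ _ fun _ => rfl)⟩

/-- The exponent of the Koszul sign in `ρ(t; s₁, …, s_k) = ± rgraft t s` for `s j` of degree
`e j`. -/
def rgraftExp {k : ℕ} {a : ℤ} (t : MTreeN k a) (e : Fin k → ℤ) : ℤ :=
  t.1.rgraftExp fun i => e (Fin.cast t.2.1 i)

end MTreeN

/-- The two-coloured tree representing `f_{p+1+r} (id^{⊗p} ⊗ m_q ⊗ id^{⊗r})`, with `m_q` of the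
upper colour. -/
def Split.upperFacet {n : ℕ} (x : Split n) : MTreeN n ((n : ℤ) - 1 - 1) :=
  ⟨MTree.mor (x.p + 1 + x.r) (by omega) fun j =>
      if (j : ℕ) = x.p then (TreeN.corolla x.q x.two_le_q).1 else Tree.leaf, by
    have h : ∀ j : Fin (x.p + 1 + x.r), (if (j : ℕ) = x.p then
        (TreeN.corolla x.q x.two_le_q).1 else Tree.leaf).leaves =
        if (j : ℕ) = x.p then x.q else 1 := fun j => by
      split_ifs
      · exact (TreeN.corolla x.q x.two_le_q).2.1
      · rfl
    simp only [MTree.leaves, h, sum_ite_fin]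
    have := x.sum_eq
    simp; omega, by
    have h : ∀ j : Fin (x.p + 1 + x.r), (if (j : ℕ) = x.p then
        (TreeN.corolla x.q x.two_le_q).1 else Tree.leaf).deg =
        if (j : ℕ) = x.p then (x.q : ℤ) - 2 else 0 := fun j => by
      split_ifs
      · exact (TreeN.corolla x.q x.two_le_q).2.2
      · rfl
    simp only [MTree.deg, h, sum_ite_fin]
    have := x.sum_eq
    simp; omega⟩

/-- The decompositions `n = i₁ + ⋯ + i_k` into `k ≥ 2` positive integers. -/
abbrev ProperComposition (n : ℕ) : Type := {x : Composition n // 2 ≤ x.length}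

/-- The two-coloured tree representing `m_k (f_{i₁} ⊗ ⋯ ⊗ f_{i_k})`, with `m_k` of the lower
colour. -/
def ProperComposition.lowerFacet {n : ℕ} (x : ProperComposition n) : MTreeN n ((n : ℤ) - 1 - 1) :=
  ⟨MTree.node x.1.length x.2 fun u =>
      (MTreeN.corolla (x.1.blocksFun u) (x.1.one_le_blocksFun u)).1, by
    simp only [MTree.leaves, fun u => (MTreeN.corolla (x.1.blocksFun u)
      (x.1.one_le_blocksFun u)).2.1]
    exact x.1.sum_blocksFun, by
    simp only [MTree.deg, fun u => (MTreeN.corolla (x.1.blocksFun u)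
      (x.1.one_le_blocksFun u)).2.2, Finset.sum_sub_distrib]
    rw [← Nat.cast_sum, x.1.sum_blocksFun]
    simp; ring⟩

/-- The exponent `ε = ∑_{u=1}^k (k - u)(1 - i_u)`; here the index `u` starts at `0`. -/
def ProperComposition.exp {n : ℕ} (x : ProperComposition n) : ℤ :=
  ∑ u : Fin x.1.length, ((x.1.length : ℤ) - (u + 1)) * (1 - (x.1.blocksFun u : ℤ))

/-- The value on the basis element `t` of the differential of `M_∞`, determined by the differential
of `A_∞`, by
`∂ f_n = ∑_{p+q+r=n, q≥2} (-1)^{p+qr} f_{p+1+r} (id^{⊗p} ⊗ m_q ⊗ id^{⊗r})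
  - ∑_{i₁+⋯+i_k=n, k≥2} (-1)^ε m_k (f_{i₁} ⊗ ⋯ ⊗ f_{i_k})` and by the Leibniz rule. -/
def MTree.bd (R : Type u) [CommRing R] : (t : MTree) → (MTreeN t.leaves (t.deg - 1) →₀ R)
  | mor n h c =>
    (∑ x : Split n, Finsupp.single
        (MTreeN.cast (n' := ∑ j, (c j).leaves) (d' := ((n : ℤ) - 1) + ∑ j, (c j).deg - 1) rfl
          (by ring)
          (MTreeN.rgraft x.upperFacet fun j => (⟨c j, rfl, rfl⟩ : TreeN _ _)))
        (ksign R (x.exp + x.upperFacet.rgraftExp fun j => (c j).deg))) -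
    (∑ x : ProperComposition n, Finsupp.single
        (MTreeN.cast (n' := ∑ j, (c j).leaves) (d' := ((n : ℤ) - 1) + ∑ j, (c j).deg - 1) rfl
          (by ring)
          (MTreeN.rgraft x.lowerFacet fun j => (⟨c j, rfl, rfl⟩ : TreeN _ _)))
        (ksign R (x.exp + x.lowerFacet.rgraftExp fun j => (c j).deg))) +
    ∑ j, ksign R (((n : ℤ) - 1) + ∑ i ∈ Finset.Iio j, (c i).deg) •
      (Tree.bd R (c j)).mapDomain fun s =>
        (⟨mor n h (Function.update c j s.1), by
            simp only [leaves]
            refine Finset.sum_congr rfl fun i _ => ?_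
            by_cases hij : i = j
            · subst hij; simp [s.2.1]
            · simp [hij], by
            simp only [deg]
            have : ∀ i, (Function.update c j s.1 i).deg =
                (c i).deg - if i = j then 1 else 0 := fun i => by
              by_cases hij : i = j
              · subst hij; simp [s.2.2]
              · simp [hij]
            simp only [this, Finset.sum_sub_distrib]
            simp; ring⟩ :
          MTreeN (∑ j, (c j).leaves) (((n : ℤ) - 1) + ∑ j, (c j).deg - 1))
  | node n h c =>
    -(∑ x : ProperSplit n, Finsupp.single
        (MTreeN.cast (n' := ∑ j, (c j).leaves) (d' := ((n : ℤ) - 2) + ∑ j, (c j).deg - 1) rfl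
          (by ring)
          (MTreeN.lgraft (x.1.facet x.2) fun j => (⟨c j, rfl, rfl⟩ : MTreeN _ _)))
        (ksign R (x.1.exp + (x.1.facet x.2).graftExp fun j => (c j).deg))) +
    ∑ j, ksign R (((n : ℤ) - 2) + ∑ i ∈ Finset.Iio j, (c i).deg) •
      (MTree.bd R (c j)).mapDomain fun s =>
        (⟨node n h (Function.update c j s.1), by
            simp only [leaves]
            refine Finset.sum_congr rfl fun i _ => ?_
            by_cases hij : i = j
            · subst hij; simp [s.2.1]
            · simp [hij], by
            simp only [deg]
            have : ∀ i, (Function.update c j s.1 i).deg =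
                (c i).deg - if i = j then 1 else 0 := fun i => by
              by_cases hij : i = j
              · subst hij; simp [s.2.2]
              · simp [hij]
            simp only [this, Finset.sum_sub_distrib]
            simp; ring⟩ :
          MTreeN (∑ j, (c j).leaves) (((n : ℤ) - 2) + ∑ j, (c j).deg - 1))

/-- The dg operadic bimodule `M_∞`: the quasi-free `(A_∞, A_∞)`-operadic bimodule generated by one
operation `f_n` of arity `n` and degree `n - 1` for each `n ≥ 1`. Its operations of arity `n` and
degree `d` have the two-coloured trees with `n` leaves and of degree `d` as a basis. -/
def MInf (R : Type u) [CommRing R] : BimoduleOps.{u, u, u, u} (AInf R) (AInf R) where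
  X n d := MTreeN n d →₀ R
  lact {k a n e} x y :=
    multiExt (fun (t : TreeN k a) (s : ∀ j, MTreeN (n j) (e j)) =>
      ksign R (t.graftExp e) • Finsupp.single (MTreeN.lgraft t s) (1 : R)) x y
  ract {k a n e} y x :=
    multiExt (fun (t : MTreeN k a) (s : ∀ j, TreeN (n j) (e j)) =>
      ksign R (t.rgraftExp e) • Finsupp.single (t.rgraft s) (1 : R)) y x
  d {n a} := Finsupp.linearCombination R fun t : MTreeN n a =>
    (t.1.bd R).mapDomain (MTreeN.cast t.2.1 (by rw [t.2.2]))

/-- The generating operation `f_n` of `M_∞`. -/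
def MInf.gen (R : Type u) [CommRing R] (n : ℕ) (h : 1 ≤ n) : (MInf R).X n ((n : ℤ) - 1) :=
  Finsupp.single (MTreeN.corolla n h) (1 : R)

/-! ### Tensor squares and diagonals -/

/-- Pairs `(t, t')` of trees with `n` leaves and of total degree `d`. They form a basis of
`(A_∞ ⊗ A_∞)(n)_d = ⨁_{a + b = d} A_∞(n)_a ⊗ A_∞(n)_b`, the pair `(t, t')` standing for `t ⊗ t'`. -/
abbrev TreePairN (n : ℕ) (d : ℤ) : Type :=
  {x : Tree × Tree // x.1.leaves = n ∧ x.2.leaves = n ∧ x.1.deg + x.2.deg = d}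

namespace TreePairN

variable {n : ℕ} {d : ℤ}

def fst (x : TreePairN n d) : TreeN n x.1.1.deg := ⟨x.1.1, x.2.1, rfl⟩
def snd (x : TreePairN n d) : TreeN n x.1.2.deg := ⟨x.1.2, x.2.2.1, rfl⟩

/-- The basis element `t ⊗ t'`. -/
def mk {a b : ℤ} (t : TreeN n a) (t' : TreeN n b) (h : a + b = d) : TreePairN n d :=
  ⟨(t.1, t'.1), t.2.1, t'.2.1, by rw [t.2.2, t'.2.2, h]⟩

end TreePairN

/-- The exponent of the Koszul sign of
`(x ⊗ x')(y₁ ⊗ y₁') ⋯ (y_k ⊗ y_k') ↦ (x y₁ ⋯ y_k) ⊗ (x' y₁' ⋯ y_k')`, where `b = |x'|`,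
`e j = |y_j|` and `e' j = |y_j'|`. -/
def tensorExp {k : ℕ} (b : ℤ) (e e' : Fin k → ℤ) : ℤ := b * ∑ j, e j + shuffleExp e e'

/-- The dg operad `A_∞ ⊗ A_∞` (arity-wise tensor product), with
`γ(x ⊗ x'; y₁ ⊗ y₁', …) = ± γ(x; y₁, …) ⊗ γ(x'; y₁', …)` and
`∂ (x ⊗ x') = ∂ x ⊗ x' + (-1)^{|x|} x ⊗ ∂ x'`. -/
def AInfTensor (R : Type u) [CommRing R] : OperadOps.{u, u} R where
  X n d := TreePairN n d →₀ R
  one := Finsupp.single (TreePairN.mk TreeN.one TreeN.one rfl) 1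
  comp {k a n e} x y :=
    multiExt (fun (t : TreePairN k a) (s : ∀ j, TreePairN (n j) (e j)) =>
      ksign R (tensorExp t.1.2.deg (fun j => (s j).1.1.deg) (fun j => (s j).1.2.deg) +
        t.fst.graftExp (fun j => (s j).1.1.deg) + t.snd.graftExp (fun j => (s j).1.2.deg)) •
      Finsupp.single (TreePairN.mk (t.fst.graft fun j => (s j).fst) (t.snd.graft fun j => (s j).snd)
        (by
          simp only [← t.2.2.2, ← (s _).2.2.2, Finset.sum_add_distrib]
          ring)) (1 : R)) x y
  d {n a} := Finsupp.linearCombination R fun t : TreePairN n a =>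
    (t.1.1.bd R).mapDomain (fun s => TreePairN.mk (TreeN.cast t.2.1 rfl s) t.snd
      (by have := t.2.2.2; omega)) +
    ksign R t.1.1.deg • (t.1.2.bd R).mapDomain (fun s => TreePairN.mk t.fst (TreeN.cast t.2.2.1 rfl s)
      (by have := t.2.2.2; omega))

/-- Pairs `(t, t')` of two-coloured trees with `n` leaves and of total degree `d`. They form a basis
of `(M_∞ ⊗ M_∞)(n)_d = ⨁_{a + b = d} M_∞(n)_a ⊗ M_∞(n)_b`, the pair `(t, t')` standing for
`t ⊗ t'`. -/
abbrev MTreePairN (n : ℕ) (d : ℤ) : Type :=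
  {x : MTree × MTree // x.1.leaves = n ∧ x.2.leaves = n ∧ x.1.deg + x.2.deg = d}

namespace MTreePairN

variable {n : ℕ} {d : ℤ}

def fst (x : MTreePairN n d) : MTreeN n x.1.1.deg := ⟨x.1.1, x.2.1, rfl⟩
def snd (x : MTreePairN n d) : MTreeN n x.1.2.deg := ⟨x.1.2, x.2.2.1, rfl⟩

/-- The basis element `t ⊗ t'`. -/
def mk {a b : ℤ} (t : MTreeN n a) (t' : MTreeN n b) (h : a + b = d) : MTreePairN n d :=
  ⟨(t.1, t'.1), t.2.1, t'.2.1, by rw [t.2.2, t'.2.2, h]⟩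

end MTreePairN

/-- The dg `(A_∞ ⊗ A_∞, A_∞ ⊗ A_∞)`-operadic bimodule `M_∞ ⊗ M_∞`. -/
def MInfTensor (R : Type u) [CommRing R] :
    BimoduleOps.{u, u, u, u} (AInfTensor R) (AInfTensor R) where
  X n d := MTreePairN n d →₀ R
  lact {k a n e} x y :=
    multiExt (fun (t : TreePairN k a) (s : ∀ j, MTreePairN (n j) (e j)) =>
      ksign R (tensorExp t.1.2.deg (fun j => (s j).1.1.deg) (fun j => (s j).1.2.deg) +
        t.fst.graftExp (fun j => (s j).1.1.deg) + t.snd.graftExp (fun j => (s j).1.2.deg)) •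
      Finsupp.single (MTreePairN.mk (MTreeN.lgraft t.fst fun j => (s j).fst)
        (MTreeN.lgraft t.snd fun j => (s j).snd)
        (by
          simp only [← t.2.2.2, ← (s _).2.2.2, Finset.sum_add_distrib]
          ring)) (1 : R)) x y
  ract {k a n e} y x :=
    multiExt (fun (t : MTreePairN k a) (s : ∀ j, TreePairN (n j) (e j)) =>
      ksign R (tensorExp t.1.2.deg (fun j => (s j).1.1.deg) (fun j => (s j).1.2.deg) +
        t.fst.rgraftExp (fun j => (s j).1.1.deg) + t.snd.rgraftExp (fun j => (s j).1.2.deg)) •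
      Finsupp.single (MTreePairN.mk (t.fst.rgraft fun j => (s j).fst)
        (t.snd.rgraft fun j => (s j).snd)
        (by
          simp only [← t.2.2.2, ← (s _).2.2.2, Finset.sum_add_distrib]
          ring)) (1 : R)) y x
  d {n a} := Finsupp.linearCombination R fun t : MTreePairN n a =>
    (t.1.1.bd R).mapDomain (fun s => MTreePairN.mk (MTreeN.cast t.2.1 rfl s) t.snd
      (by have := t.2.2.2; omega)) +
    ksign R t.1.1.deg • (t.1.2.bd R).mapDomain (fun s =>
      MTreePairN.mk t.fst (MTreeN.cast t.2.2.1 rfl s) (by have := t.2.2.2; omega))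

/-- A diagonal on the operad `A_∞`: a morphism of dg operads `A_∞ → A_∞ ⊗ A_∞` with
`m_2 ↦ m_2 ⊗ m_2`. -/
structure AInfDiagonal (R : Type u) [CommRing R] extends OperadHom (AInf R) (AInfTensor R) where
  map_gen_two : map (AInf.gen R 2 le_rfl) =
    Finsupp.single (TreePairN.mk (TreeN.corolla 2 le_rfl) (TreeN.corolla 2 le_rfl) (by simp)) (1 : R)

/-- Given a diagonal on `A_∞`, a diagonal on the operadic bimodule `M_∞`: a morphism of dg operadic
bimodules `M_∞ → M_∞ ⊗ M_∞` with `f_1 ↦ f_1 ⊗ f_1`, where `M_∞ ⊗ M_∞` is an `(A_∞, A_∞)`-bimodule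
through the diagonal on `A_∞`. -/
structure MInfDiagonal {R : Type u} [CommRing R] (Δ : AInfDiagonal R) extends
    BimoduleHom Δ.toOperadHom Δ.toOperadHom (MInf R) (MInfTensor R) where
  map_gen_one : map (MInf.gen R 1 le_rfl) =
    Finsupp.single (MTreePairN.mk (MTreeN.corolla 1 le_rfl) (MTreeN.corolla 1 le_rfl) (by simp))
      (1 : R)

/-! ### `A_∞`-structures -/

/-- Evaluation of a tree, where the vertices with `n` inputs are replaced by `op n`. -/
def OperadOps.evalTree {R : Type u} [CommRing R] (P : OperadOps.{u, v} R)
    (op : ∀ n : ℕ, 2 ≤ n → P.X n ((n : ℤ) - 2)) : (t : Tree) → P.X t.leaves t.deg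
  | Tree.leaf => P.one
  | Tree.node n h c => P.comp (op n h) fun j => P.evalTree op (c j)

/-- Evaluation of a tree with prescribed arity and degree. -/
def OperadOps.evalTreeN {R : Type u} [CommRing R] (P : OperadOps.{u, v} R)
    (op : ∀ n : ℕ, 2 ≤ n → P.X n ((n : ℤ) - 2)) {n : ℕ} {d : ℤ} (t : TreeN n d) : P.X n d :=
  P.cast t.2.1 t.2.2 (P.evalTree op t.1)

/-- Operations `m_n` of arity `n` and degree `n - 2` in the dg operad `P`, for `n ≥ 2`, with
`∂ m_n = - ∑_{p + q + r = n, 2 ≤ q ≤ n - 1} (-1)^{p + qr} m_{p+1+r} (id^{⊗p} ⊗ m_q ⊗ id^{⊗r})`. -/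
@[ext]
structure AInfStr {R : Type u} [CommRing R] (P : OperadOps.{u, v} R) where
  op : ∀ n : ℕ, 2 ≤ n → P.X n ((n : ℤ) - 2)
  rel : ∀ (n : ℕ) (h : 2 ≤ n), P.d (op n h) =
    -∑ x : ProperSplit n, ksign R x.1.exp • P.evalTreeN op (x.1.facet x.2)

/-- The map `A_∞ → P` determined by operations `m_n` in `P`. -/
def AInfStr.eval {R : Type u} [CommRing R] {P : OperadOps.{u, v} R} (μ : AInfStr P) {n : ℕ} {d : ℤ} :
    (AInf R).X n d →ₗ[R] P.X n d :=
  Finsupp.linearCombination R fun t : TreeN n d => P.evalTreeN μ.op t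

/-- Evaluation of a two-coloured tree, where the vertices of the upper colour, the vertices of the
lower colour and the two-coloured vertices with `n` inputs are replaced by `opQ n`, `opP n` and
`op n` respectively. -/
def BimoduleOps.evalTree {R : Type u} [CommRing R] {P : OperadOps.{u, v₁} R}
    {Q : OperadOps.{u, v₂} R} (M : BimoduleOps.{u, v} P Q)
    (opP : ∀ n : ℕ, 2 ≤ n → P.X n ((n : ℤ) - 2)) (opQ : ∀ n : ℕ, 2 ≤ n → Q.X n ((n : ℤ) - 2))
    (op : ∀ n : ℕ, 1 ≤ n → M.X n ((n : ℤ) - 1)) : (t : MTree) → M.X t.leaves t.deg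
  | MTree.mor n h c => M.ract (op n h) fun j => Q.evalTree opQ (c j)
  | MTree.node k h c => M.lact (opP k h) fun j => M.evalTree opP opQ op (c j)

/-- Evaluation of a two-coloured tree with prescribed arity and degree. -/
def BimoduleOps.evalTreeN {R : Type u} [CommRing R] {P : OperadOps.{u, v₁} R}
    {Q : OperadOps.{u, v₂} R} (M : BimoduleOps.{u, v} P Q)
    (opP : ∀ n : ℕ, 2 ≤ n → P.X n ((n : ℤ) - 2)) (opQ : ∀ n : ℕ, 2 ≤ n → Q.X n ((n : ℤ) - 2))
    (op : ∀ n : ℕ, 1 ≤ n → M.X n ((n : ℤ) - 1)) {n : ℕ} {d : ℤ} (t : MTreeN n d) : M.X n d :=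
  M.cast t.2.1 t.2.2 (M.evalTree opP opQ op t.1)

/-- For operations `m'_n` in `P` and `m_n` in `Q` as above, operations `f_n` of arity `n` and degree
`n - 1` in the `(P, Q)`-bimodule `M`, for `n ≥ 1`, with
`∂ f_n = ∑_{p + q + r = n, q ≥ 2} (-1)^{p + qr} f_{p+1+r} (id^{⊗p} ⊗ m_q ⊗ id^{⊗r})
  - ∑_{i₁ + ⋯ + i_k = n, k ≥ 2} (-1)^ε m'_k (f_{i₁} ⊗ ⋯ ⊗ f_{i_k})`. -/
@[ext]
structure MInfStr {R : Type u} [CommRing R] {P : OperadOps.{u, v₁} R} {Q : OperadOps.{u, v₂} R}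
    (M : BimoduleOps.{u, v} P Q) (μP : AInfStr P) (μQ : AInfStr Q) where
  op : ∀ n : ℕ, 1 ≤ n → M.X n ((n : ℤ) - 1)
  rel : ∀ (n : ℕ) (h : 1 ≤ n), M.d (op n h) =
    (∑ x : Split n, ksign R x.exp • M.evalTreeN μP.op μQ.op op x.upperFacet) -
    ∑ x : ProperComposition n, ksign R x.exp • M.evalTreeN μP.op μQ.op op x.lowerFacet

/-- The map `M_∞ → M` determined by operations `f_n` in `M`. -/
def MInfStr.eval {R : Type u} [CommRing R] {P : OperadOps.{u, v₁} R} {Q : OperadOps.{u, v₂} R}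
    {M : BimoduleOps.{u, v} P Q} {μP : AInfStr P} {μQ : AInfStr Q} (F : MInfStr M μP μQ)
    {n : ℕ} {d : ℤ} : (MInf R).X n d →ₗ[R] M.X n d :=
  Finsupp.linearCombination R fun t : MTreeN n d => M.evalTreeN μP.op μQ.op F.op t

/-! ### dg modules -/

/-- A dg module (chain complex) over `R`, homologically graded by `ℤ`. -/
structure DGMod (R : Type u) [CommRing R] where
  X : ℤ → Type v
  [acg : ∀ i, AddCommGroup (X i)]
  [mod : ∀ i, Module R (X i)]
  d : ∀ i, X i →ₗ[R] X (i - 1)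
  d_d : ∀ i (x : X i), d (i - 1) (d i x) = 0

attribute [instance] DGMod.acg DGMod.mod

namespace DGMod

variable {R : Type u} [CommRing R]

/-- The total module `⨁ i, A_i`. -/
abbrev Tot (A : DGMod.{u, v} R) : Type v := ⨁ i, A.X i

/-- The inclusion of the component of degree `i`. -/
abbrev ι (A : DGMod.{u, v} R) (i : ℤ) : A.X i →ₗ[R] A.Tot := DirectSum.lof R ℤ A.X i

/-- The submodule of elements of degree `i`. -/
def homog (A : DGMod.{u, v} R) (i : ℤ) : Submodule R A.Tot := LinearMap.range (A.ι i)

/-- The differential. -/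
def diff (A : DGMod.{u, v} R) : A.Tot →ₗ[R] A.Tot :=
  DirectSum.toModule R ℤ A.Tot fun i => A.ι (i - 1) ∘ₗ A.d i

/-- The map `x ↦ (-1)^{k |x|} x`. -/
def eps (A : DGMod.{u, v} R) (k : ℤ) : A.Tot →ₗ[R] A.Tot :=
  DirectSum.toModule R ℤ A.Tot fun i => ksign R (k * i) • A.ι i

/-- The tensor power `A^{⊗ n}`. -/
abbrev TPow (A : DGMod.{u, v} R) (n : ℕ) : Type max u v := ⨂[R] (_ : Fin n), A.Tot

/-- The submodule of elements of degree `m` of `A^{⊗ n}`. -/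
def tHomog (A : DGMod.{u, v} R) (n : ℕ) (m : ℤ) : Submodule R (A.TPow n) :=
  Submodule.span R {y | ∃ (e : Fin n → ℤ) (x : ∀ i, A.X (e i)), ∑ i, e i = m ∧
    y = PiTensorProduct.tprod R fun i => A.ι (e i) (x i)}

/-- The operator `α^{⊗ i} ⊗ β ⊗ id^{⊗ (n - i - 1)}`, as a family of maps. -/
def slot (A : DGMod.{u, v} R) {n : ℕ} (α β : A.Tot →ₗ[R] A.Tot) (i j : Fin n) :
    A.Tot →ₗ[R] A.Tot :=
  if j < i then α else if j = i then β else LinearMap.id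

/-- The differential `∑_i id^{⊗ i} ⊗ ∂ ⊗ id^{⊗ (n - i - 1)}` of `A^{⊗ n}`, with the Koszul sign. -/
def tDiff (A : DGMod.{u, v} R) (n : ℕ) : A.TPow n →ₗ[R] A.TPow n :=
  ∑ i : Fin n, PiTensorProduct.map (A.slot (A.eps 1) A.diff i)

@[simp] theorem diff_ι (A : DGMod.{u, v} R) (i : ℤ) (x : A.X i) :
    A.diff (A.ι i x) = A.ι (i - 1) (A.d i x) := by
  simp [diff, ι, DirectSum.toModule_lof]

@[simp] theorem eps_ι (A : DGMod.{u, v} R) (k i : ℤ) (x : A.X i) :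
    A.eps k (A.ι i x) = ksign R (k * i) • A.ι i x := by
  simp [eps, ι, DirectSum.toModule_lof]

theorem ι_mem (A : DGMod.{u, v} R) (i : ℤ) (x : A.X i) : A.ι i x ∈ A.homog i := ⟨x, rfl⟩

theorem diff_mem (A : DGMod.{u, v} R) {i : ℤ} {x : A.Tot} (hx : x ∈ A.homog i) :
    A.diff x ∈ A.homog (i - 1) := by
  obtain ⟨y, rfl⟩ := hx
  rw [diff_ι]
  exact ι_mem _ _ _

theorem eps_mem (A : DGMod.{u, v} R) (k : ℤ) {i : ℤ} {x : A.Tot} (hx : x ∈ A.homog i) :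
    A.eps k x ∈ A.homog i := by
  obtain ⟨y, rfl⟩ := hx
  rw [eps_ι]
  exact Submodule.smul_mem _ _ (ι_mem _ _ _)

theorem diff_diff (A : DGMod.{u, v} R) (x : A.Tot) : A.diff (A.diff x) = 0 := by
  have : A.diff ∘ₗ A.diff = 0 := by
    refine DirectSum.linearMap_ext R fun i => LinearMap.ext fun x => ?_
    change A.diff (A.diff (A.ι i x)) = 0
    rw [diff_ι, diff_ι, A.d_d, map_zero]
  exact LinearMap.congr_fun this x

/-- Homogeneous vectors generate the homogeneous tensors. -/
theorem tprod_mem (A : DGMod.{u, v} R) {n : ℕ} {m : ℤ} (e : Fin n → ℤ) (x : Fin n → A.Tot)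
    (hx : ∀ i, x i ∈ A.homog (e i)) (he : ∑ i, e i = m) :
    PiTensorProduct.tprod R x ∈ A.tHomog n m := by
  choose y hy using hx
  refine Submodule.subset_span ⟨e, y, he, ?_⟩
  congr 1
  funext i
  exact (hy i).symm

/-- A family of maps of degrees `b i` induces a map of degree `∑ i, b i` on tensor powers. -/
theorem map_mem (A : DGMod.{u, v₁} R) (B : DGMod.{u, v₂} R) {n : ℕ}
    (f : Fin n → (A.Tot →ₗ[R] B.Tot)) (b : Fin n → ℤ)
    (hf : ∀ j i x, f j (A.ι i x) ∈ B.homog (i + b j)) {m m' : ℤ} (hm : m + ∑ j, b j = m')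
    {y : A.TPow n} (hy : y ∈ A.tHomog n m) : PiTensorProduct.map f y ∈ B.tHomog n m' := by
  have : A.tHomog n m ≤ (B.tHomog n m').comap (PiTensorProduct.map f) := by
    refine Submodule.span_le.2 ?_
    rintro _ ⟨e, x, he, rfl⟩
    rw [SetLike.mem_coe, Submodule.mem_comap, PiTensorProduct.map_tprod]
    refine B.tprod_mem (fun i => e i + b i) _ (fun i => hf i _ _) ?_
    rw [Finset.sum_add_distrib, he, hm]
  exact this hy

theorem slot_mem (A : DGMod.{u, v} R) {n : ℕ} (i j : Fin n) {k : ℤ} {x : A.Tot}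
    (hx : x ∈ A.homog k) :
    A.slot (A.eps 1) A.diff i j x ∈ A.homog (k + if j = i then -1 else 0) := by
  unfold slot
  rcases lt_trichotomy j i with h | h | h
  · rw [if_pos h, if_neg h.ne, add_zero]; exact A.eps_mem 1 hx
  · rw [if_neg h.not_lt, if_pos h, if_pos h]; exact A.diff_mem hx
  · rw [if_neg h.not_gt, if_neg h.ne', if_neg h.ne', add_zero]; exact hx

theorem tDiff_mem (A : DGMod.{u, v} R) {n : ℕ} {m : ℤ} {y : A.TPow n} (hy : y ∈ A.tHomog n m) :
    A.tDiff n y ∈ A.tHomog n (m - 1) := by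
  unfold tDiff
  rw [LinearMap.sum_apply]
  refine Submodule.sum_mem _ fun i _ => ?_
  refine A.map_mem A _ (fun j => if j = i then -1 else 0)
    (fun j k x => A.slot_mem i j (A.ι_mem k x)) ?_ hy
  simp; ring

end DGMod

section Hom

variable {R : Type u} [CommRing R]

/-- The linear maps `C → A` of degree `d`. -/
def homSub (C : DGMod.{u, v₁} R) (A : DGMod.{u, v₂} R) (d : ℤ) :
    Submodule R (C.Tot →ₗ[R] A.Tot) where
  carrier := {f | ∀ i x, f (C.ι i x) ∈ A.homog (i + d)}
  add_mem' hf hg i x := add_mem (hf i x) (hg i x)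
  zero_mem' _ _ := zero_mem _
  smul_mem' r _ hf i x := Submodule.smul_mem _ r (hf i x)

/-- The differential `f ↦ [∂, f] = ∂ f - (-1)^{|f|} f ∂`. -/
def homDiff (C : DGMod.{u, v₁} R) (A : DGMod.{u, v₂} R) (d : ℤ) :
    homSub C A d →ₗ[R] homSub C A (d - 1) :=
  LinearMap.codRestrict _
    { toFun := fun f => A.diff ∘ₗ f.1 - ksign R d • (f.1 ∘ₗ C.diff)
      map_add' := fun f g => by
        ext i x
        simp [smul_add]; abel
      map_smul' := fun r f => by
        ext i x
        simp [smul_sub, smul_comm r] }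
    fun f i x => by
      change A.diff (f.1 (C.ι i x)) - ksign R d • f.1 (C.diff (C.ι i x)) ∈ _
      rw [DGMod.diff_ι]
      refine sub_mem ?_ (Submodule.smul_mem _ _ ?_)
      · have := A.diff_mem (f.2 i x)
        rwa [add_sub_assoc] at this
      · have := f.2 (i - 1) (C.d i x)
        rwa [show i - 1 + d = i + (d - 1) by ring] at this

theorem ksign_sub_one (d : ℤ) : ksign R (d - 1) = -ksign R d := by
  simp [ksign, Int.negOnePow_sub]

/-- The dg module `(Hom(C, A), [∂, ·])`, whose component of degree `d` consists of the linear maps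
`C → A` of degree `d`. -/
def HomDG (C : DGMod.{u, v₁} R) (A : DGMod.{u, v₂} R) : DGMod.{u, max v₁ v₂} R where
  X d := homSub C A d
  d d := homDiff C A d
  d_d d f := by
    apply Subtype.ext
    change A.diff ∘ₗ (A.diff ∘ₗ f.1 - ksign R d • (f.1 ∘ₗ C.diff)) -
      ksign R (d - 1) • ((A.diff ∘ₗ f.1 - ksign R d • (f.1 ∘ₗ C.diff)) ∘ₗ C.diff) = 0
    rw [ksign_sub_one]
    refine LinearMap.ext fun x => ?_
    simp [DGMod.diff_diff]

/-! ### Multilinear maps: `End_A` and `Hom^A_B` -/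

/-- The module `Hom^A_B(n)_d` of maps `A^{⊗ n} → B` of degree `d`. -/
def mulSub (A : DGMod.{u, v₁} R) (B : DGMod.{u, v₂} R) (n : ℕ) (d : ℤ) :
    Submodule R (MultilinearMap R (fun _ : Fin n => A.Tot) B.Tot) where
  carrier := {f | ∀ (e : Fin n → ℤ) (x : ∀ i, A.X (e i)),
    f (fun i => A.ι (e i) (x i)) ∈ B.homog (d + ∑ i, e i)}
  add_mem' hf hg e x := add_mem (hf e x) (hg e x)
  zero_mem' _ _ := zero_mem _
  smul_mem' r _ hf e x := Submodule.smul_mem _ r (hf e x)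

theorem mulSub_apply_mem {A : DGMod.{u, v₁} R} {B : DGMod.{u, v₂} R} {n : ℕ} {d m : ℤ}
    (f : mulSub A B n d) (e : Fin n → ℤ) (x : Fin n → A.Tot) (hx : ∀ i, x i ∈ A.homog (e i))
    (hm : d + ∑ i, e i = m) : f.1 x ∈ B.homog m := by
  choose y hy using hx
  have := f.2 e y
  simp only [hy] at this
  rwa [hm] at this

/-- The composition `f ∘ (g₁ ⊗ ⋯ ⊗ g_k)`, where `g₁ ⊗ ⋯ ⊗ g_k` is the tensor product of homogeneous
maps with the Koszul sign `(g ⊗ g')(x ⊗ x') = (-1)^{|g'||x|} g(x) ⊗ g'(x')`. -/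
def mulComp {A : DGMod.{u, v₁} R} {B : DGMod.{u, v₂} R} {D : DGMod.{u, v₃} R} {k : ℕ} {a : ℤ}
    {n : Fin k → ℕ} {e : Fin k → ℤ} (f : mulSub B D k a) (g : ∀ j, mulSub A B (n j) (e j)) :
    mulSub A D (∑ j, n j) (a + ∑ j, e j) :=
  ⟨(f.1.compMultilinearMap fun j => (g j).1.compLinearMap fun _ =>
      A.eps (∑ i ∈ Finset.Ioi j, e i)).domDomCongr finSigmaFinEquiv, fun c x => by
    change f.1 (fun j => (g j).1 fun i => A.eps (∑ i ∈ Finset.Ioi j, e i)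
      (A.ι _ (x (finSigmaFinEquiv ⟨j, i⟩)))) ∈ _
    refine mulSub_apply_mem f (fun j => e j + ∑ i, c (finSigmaFinEquiv ⟨j, i⟩)) _ (fun j => ?_) ?_
    · exact mulSub_apply_mem (g j) (fun i => c (finSigmaFinEquiv ⟨j, i⟩)) _
        (fun i => A.eps_mem _ (A.ι_mem _ _)) rfl
    · rw [Finset.sum_add_distrib, add_assoc]
      congr 2
      rw [← Finset.sum_sigma (s := Finset.univ) (t := fun _ => Finset.univ)
        (f := fun y : (j : Fin k) × Fin (n j) => c (finSigmaFinEquiv y))]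
      exact Fintype.sum_equiv finSigmaFinEquiv _ _ fun _ => rfl⟩

/-- The differential `f ↦ [∂, f] = ∂ f - (-1)^{|f|} f ∂`, where `∂` also denotes the differential
`∑_i id^{⊗ i} ⊗ ∂ ⊗ id^{⊗ (n - i - 1)}` of `A^{⊗ n}`. -/
def mulDiff {A : DGMod.{u, v₁} R} {B : DGMod.{u, v₂} R} {n : ℕ} {d : ℤ} :
    mulSub A B n d →ₗ[R] mulSub A B n (d - 1) :=
  LinearMap.codRestrict _
    { toFun := fun f => B.diff.compMultilinearMap f.1 -
        ksign R d • ∑ i : Fin n, f.1.compLinearMap (A.slot (A.eps 1) A.diff i)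
      map_add' := fun f g => by
        ext x
        simp [smul_add, Finset.sum_add_distrib]; abel
      map_smul' := fun r f => by
        ext x
        simp [smul_sub, smul_comm r, Finset.smul_sum] }
    fun f e x => by
      change B.diff (f.1 _) - (ksign R d • ∑ i : Fin n,
        f.1.compLinearMap (A.slot (A.eps 1) A.diff i)) _ ∈ _
      refine sub_mem ?_ ?_
      · have := B.diff_mem (f.2 e x)
        rwa [show d + ∑ i, e i - 1 = d - 1 + ∑ i, e i by ring] at this
      · rw [_root_.smul_apply, _root_.sum_apply]
        refine Submodule.smul_mem _ _ (Submodule.sum_mem _ fun i _ => ?_)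
        refine mulSub_apply_mem f (fun j => e j + if j = i then -1 else 0) _
          (fun j => A.slot_mem i j (A.ι_mem _ _)) ?_
        rw [Finset.sum_add_distrib]
        simp; ring

/-- The endomorphism operad `End_A`. -/
def EndOp (A : DGMod.{u, v} R) : OperadOps.{u, v} R where
  X n d := mulSub A A n d
  one := ⟨MultilinearMap.ofSubsingleton R A.Tot A.Tot (0 : Fin 1) LinearMap.id, fun e x => by
    simpa using A.ι_mem _ _⟩
  comp f g := mulComp f g
  d := mulDiff

/-- The `(End_B, End_A)`-operadic bimodule `Hom^A_B`. -/
def HomBi (A : DGMod.{u, v₁} R) (B : DGMod.{u, v₂} R) :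
    BimoduleOps.{u, max v₁ v₂, v₂, v₁} (EndOp B) (EndOp A) where
  X n d := mulSub A B n d
  lact f g := mulComp f g
  ract f g := mulComp f g
  d := mulDiff

/-! ### Maps into tensor powers: `coEnd_C` and `coHom^C_D` -/

/-- The module `coHom^C_D(n)_d` of maps `C → D^{⊗ n}` of degree `d`. -/
def comulSub (C : DGMod.{u, v₁} R) (D : DGMod.{u, v₂} R) (n : ℕ) (d : ℤ) :
    Submodule R (C.Tot →ₗ[R] D.TPow n) where
  carrier := {f | ∀ i x, f (C.ι i x) ∈ D.tHomog n (i + d)}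
  add_mem' hf hg i x := add_mem (hf i x) (hg i x)
  zero_mem' _ _ := zero_mem _
  smul_mem' r _ hf i x := Submodule.smul_mem _ r (hf i x)

/-- The canonical map `D^{⊗ n₁} ⊗ ⋯ ⊗ D^{⊗ n_k} → D^{⊗ (n₁ + ⋯ + n_k)}`, obtained by multiplication
in the tensor algebra. -/
def flatten (D : DGMod.{u, v} R) {k : ℕ} (n : Fin k → ℕ) :
    (⨂[R] j, D.TPow (n j)) →ₗ[R] D.TPow (∑ j, n j) :=
  DirectSum.component R ℕ (fun m => ⨂[R]^m D.Tot) (∑ j, n j) ∘ₗ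
    TensorAlgebra.toDirectSum.toLinearMap ∘ₗ
    PiTensorProduct.lift ((MultilinearMap.mkPiAlgebraFin R k (TensorAlgebra R D.Tot)).compLinearMap
      fun j => TensorPower.toTensorAlgebra (n := n j))

theorem ofFn_sigma {α : Type*} {k : ℕ} (n : Fin k → ℕ) (g : Fin (∑ j, n j) → α) :
    List.ofFn g =
      (List.ofFn fun j => List.ofFn fun i => g (finSigmaFinEquiv ⟨j, i⟩)).flatten := by
  induction k with
  | zero => simp
  | succ k ih =>
    have hs : ∑ j, n j = ∑ j : Fin k, n j.castSucc + n (Fin.last k) := Fin.sum_univ_castSucc n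
    rw [List.ofFn_congr hs, List.ofFn_add, ih (fun j => n j.castSucc), List.ofFn_succ',
      List.concat_eq_append, List.flatten_concat]
    congr 1
    · congr 2
      funext j
      congr 1
      funext i
      congr 1
      apply Fin.ext
      simp
    · congr 1
      funext i
      congr 1
      apply Fin.ext
      simp
      rfl

theorem flatten_tprod (D : DGMod.{u, v} R) {k : ℕ} (n : Fin k → ℕ)
    (y : Fin (∑ j, n j) → D.Tot) :
    flatten D n (PiTensorProduct.tprod R fun j =>
      PiTensorProduct.tprod R fun i : Fin (n j) => y (finSigmaFinEquiv ⟨j, i⟩)) =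
      PiTensorProduct.tprod R y := by
  have h : (List.ofFn fun j => TensorPower.toTensorAlgebra (R := R) (n := n j)
      (PiTensorProduct.tprod R fun i : Fin (n j) => y (finSigmaFinEquiv ⟨j, i⟩))).prod =
      TensorAlgebra.tprod R D.Tot (∑ j, n j) y := by
    simp only [TensorPower.toTensorAlgebra_tprod, TensorAlgebra.tprod_apply]
    rw [ofFn_sigma n (fun i => TensorAlgebra.ι R (y i)), List.prod_flatten, List.map_ofFn]
    rfl
  change DirectSum.component R ℕ (fun m => ⨂[R]^m D.Tot) (∑ j, n j) (TensorAlgebra.toDirectSum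
    (PiTensorProduct.lift _ (PiTensorProduct.tprod R _))) = _
  rw [PiTensorProduct.lift.tprod, MultilinearMap.compLinearMap_apply,
    MultilinearMap.mkPiAlgebraFin_apply, h, TensorAlgebra.toDirectSum_tensorPower_tprod]
  exact DirectSum.component.lof_self _ _ _

theorem flatten_mem (D : DGMod.{u, v} R) {k : ℕ} (n : Fin k → ℕ) (m : Fin k → ℤ)
    (T : ∀ j, D.TPow (n j)) (hT : ∀ j, T j ∈ D.tHomog (n j) (m j)) :
    flatten D n (PiTensorProduct.tprod R T) ∈ D.tHomog (∑ j, n j) (∑ j, m j) := by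
  have key : ∀ (s : Finset (Fin k)) (T : ∀ j, D.TPow (n j)),
      (∀ j, T j ∈ D.tHomog (n j) (m j)) →
      (∀ j, j ∉ s → ∃ (e : Fin (n j) → ℤ) (x : ∀ i, D.X (e i)), ∑ i, e i = m j ∧
        T j = PiTensorProduct.tprod R fun i => D.ι (e i) (x i)) →
      flatten D n (PiTensorProduct.tprod R T) ∈ D.tHomog (∑ j, n j) (∑ j, m j) := by
    intro s
    induction s using Finset.induction_on with
    | empty =>
      intro T _ h
      choose e x he hx using fun j => h j (Finset.notMem_empty j)
      let y : Fin (∑ j, n j) → D.Tot := fun i =>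
        D.ι (e (finSigmaFinEquiv.symm i).1 (finSigmaFinEquiv.symm i).2)
          (x (finSigmaFinEquiv.symm i).1 (finSigmaFinEquiv.symm i).2)
      have hy : T = fun j => PiTensorProduct.tprod R fun i => y (finSigmaFinEquiv ⟨j, i⟩) := by
        funext j
        rw [hx j]
        congr 1
        funext i
        simp only [y]
        rw [Equiv.symm_apply_apply]
      rw [hy, flatten_tprod]
      refine D.tprod_mem (fun i => e (finSigmaFinEquiv.symm i).1 (finSigmaFinEquiv.symm i).2) y
        (fun i => D.ι_mem _ _) ?_
      simp only [← he]
      rw [← Finset.sum_sigma (s := Finset.univ) (t := fun _ => Finset.univ)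
        (f := fun y : (j : Fin k) × Fin (n j) => e y.1 y.2)]
      exact Fintype.sum_equiv finSigmaFinEquiv.symm _ _ fun _ => rfl
    | insert j₀ s hj ih =>
      intro T hT h
      let L : D.TPow (n j₀) →ₗ[R] D.TPow (∑ j, n j) :=
        flatten D n ∘ₗ (PiTensorProduct.tprod R).toLinearMap T j₀
      have hL : D.tHomog (n j₀) (m j₀) ≤ (D.tHomog (∑ j, n j) (∑ j, m j)).comap L := by
        refine Submodule.span_le.2 ?_
        rintro z ⟨e, x, he, rfl⟩
        refine ih (Function.update T j₀ _) (fun j => ?_) (fun j hjs => ?_)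
        · by_cases hjj : j = j₀
          · subst hjj
            rw [Function.update_self]
            exact Submodule.subset_span ⟨e, x, he, rfl⟩
          · rw [Function.update_of_ne hjj]
            exact hT j
        · by_cases hjj : j = j₀
          · subst hjj
            exact ⟨e, x, he, by rw [Function.update_self]⟩
          · rw [Function.update_of_ne hjj]
            exact h j (by simp [hjj, hjs])
      have := hL (hT j₀)
      rw [Submodule.mem_comap] at this
      simpa [L] using this
  exact key Finset.univ T hT fun j hj => absurd (Finset.mem_univ j) hj

/-- The composite `(-1)^{|f|(|g₁| + ⋯ + |g_k|)} (g₁ ⊗ ⋯ ⊗ g_k) ∘ f`, which is the composition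
`γ(f; g₁, …, g_k)` of operations with one input and several outputs. -/
def comulComp {C : DGMod.{u, v₁} R} {D : DGMod.{u, v₂} R} {E : DGMod.{u, v₃} R} {k : ℕ} {a : ℤ}
    {n : Fin k → ℕ} {e : Fin k → ℤ} (f : comulSub C D k a) (g : ∀ j, comulSub D E (n j) (e j)) :
    comulSub C E (∑ j, n j) (a + ∑ j, e j) :=
  ⟨ksign R (a * ∑ j, e j) • (flatten E n ∘ₗ
      PiTensorProduct.map (fun j => (g j).1 ∘ₗ D.eps (∑ i ∈ Finset.Ioi j, e i)) ∘ₗ f.1),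
    fun i x => by
      refine Submodule.smul_mem _ _ ?_
      change flatten E n (PiTensorProduct.map _ (f.1 (C.ι i x))) ∈ _
      have h : D.tHomog k (i + a) ≤ (E.tHomog (∑ j, n j) (i + (a + ∑ j, e j))).comap
          (flatten E n ∘ₗ PiTensorProduct.map
            (fun j => (g j).1 ∘ₗ D.eps (∑ i ∈ Finset.Ioi j, e i))) := by
        refine Submodule.span_le.2 ?_
        rintro _ ⟨c, z, hc, rfl⟩
        rw [SetLike.mem_coe, Submodule.mem_comap, LinearMap.comp_apply, PiTensorProduct.map_tprod]
        have := flatten_mem E n (fun j => c j + e j)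
          (fun j => ((g j).1 ∘ₗ D.eps (∑ i ∈ Finset.Ioi j, e i)) (D.ι (c j) (z j))) (fun j => by
            rw [LinearMap.comp_apply, DGMod.eps_ι, map_smul]
            exact Submodule.smul_mem _ _ ((g j).2 _ _))
        rwa [Finset.sum_add_distrib, hc, add_assoc] at this
      exact h (f.2 i x)⟩

/-- The differential `f ↦ [∂, f] = ∂ f - (-1)^{|f|} f ∂`, where `∂` also denotes the differential of
`D^{⊗ n}`. -/
def comulDiff {C : DGMod.{u, v₁} R} {D : DGMod.{u, v₂} R} {n : ℕ} {d : ℤ} :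
    comulSub C D n d →ₗ[R] comulSub C D n (d - 1) :=
  LinearMap.codRestrict _
    { toFun := fun f => D.tDiff n ∘ₗ f.1 + (-ksign R d) • (f.1 ∘ₗ C.diff)
      map_add' := fun f g => by
        rw [Submodule.coe_add, LinearMap.comp_add, LinearMap.add_comp, smul_add, add_add_add_comm]
      map_smul' := fun r f => by
        rw [Submodule.coe_smul, LinearMap.comp_smul, LinearMap.smul_comp, RingHom.id_apply,
          smul_add, smul_comm r] }
    fun f i x => by
      change D.tDiff n (f.1 (C.ι i x)) + (-ksign R d) • f.1 (C.diff (C.ι i x)) ∈ _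
      rw [DGMod.diff_ι]
      refine add_mem ?_ (Submodule.smul_mem _ _ ?_)
      · have := D.tDiff_mem (f.2 i x)
        rwa [add_sub_assoc] at this
      · have := f.2 (i - 1) (C.d i x)
        rwa [show i - 1 + d = i + (d - 1) by ring] at this

instance comulSub.instAddCommGroup (C : DGMod.{u, v₁} R) (D : DGMod.{u, v₂} R) (n : ℕ) (d : ℤ) :
    AddCommGroup (comulSub C D n d) :=
  Module.addCommMonoidToAddCommGroup R

/-- The coendomorphism operad `coEnd_C`, with `coEnd_C(n) = Hom(C, C^{⊗ n})`. -/
def CoEndOp (C : DGMod.{u, v} R) : OperadOps.{u, max u v} R where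
  X n d := comulSub C C n d
  one := ⟨(PiTensorProduct.subsingletonEquiv (R := R) (s := fun _ : Fin 1 => C.Tot) 0).symm.toLinearMap, fun i x => by
    change (PiTensorProduct.subsingletonEquiv (R := R) (s := fun _ : Fin 1 => C.Tot) 0).symm
      (C.ι i x) ∈ _
    rw [PiTensorProduct.subsingletonEquiv_symm_apply']
    exact C.tprod_mem (fun _ => i) _ (fun _ => C.ι_mem _ _) (by simp)⟩
  comp f g := comulComp f g
  d := comulDiff

/-- The `(coEnd_C, coEnd_D)`-operadic bimodule `coHom^C_D`, with
`coHom^C_D(n) = Hom(C, D^{⊗ n})`. -/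
def CoHomBi (C : DGMod.{u, v₁} R) (D : DGMod.{u, v₂} R) :
    BimoduleOps.{u, max u v₁ v₂, max u v₁, max u v₂} (CoEndOp C) (CoEndOp D) where
  X n d := comulSub C D n d
  lact f g := comulComp f g
  ract f g := comulComp f g
  d := comulDiff

/-! ### The convolution operations on `Hom(C, A)` -/

/-- For homogeneous maps `h_i : C → A` of degrees `e i`, the map
`h₁ ⊗ ⋯ ⊗ h_n : C^{⊗ n} → A^{⊗ n}`, with the Koszul sign
`(h ⊗ h')(x ⊗ x') = (-1)^{|h'||x|} h(x) ⊗ h'(x')`. -/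
def homTensor {C : DGMod.{u, v₁} R} {A : DGMod.{u, v₂} R} {n : ℕ} {e : Fin n → ℤ}
    (h : ∀ i, homSub C A (e i)) : C.TPow n →ₗ[R] A.TPow n :=
  PiTensorProduct.map fun i => (h i).1 ∘ₗ C.eps (∑ j ∈ Finset.Ioi i, e j)

theorem homTensor_update {C : DGMod.{u, v₁} R} {A : DGMod.{u, v₂} R} {n : ℕ} {e : Fin n → ℤ}
    [DecidableEq (Fin n)] (h : ∀ i, homSub C A (e i)) (i : Fin n) (x : homSub C A (e i)) :
    homTensor (Function.update h i x) = PiTensorProduct.map (Function.update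
      (fun i => (h i).1 ∘ₗ C.eps (∑ j ∈ Finset.Ioi i, e j)) i
      (x.1 ∘ₗ C.eps (∑ j ∈ Finset.Ioi i, e j))) := by
  unfold homTensor
  congr 1
  funext j
  by_cases hj : j = i
  · subst hj; simp
  · simp [hj]

theorem homTensor_update_add {C : DGMod.{u, v₁} R} {A : DGMod.{u, v₂} R} {n : ℕ} {e : Fin n → ℤ}
    [DecidableEq (Fin n)] (h : ∀ i, homSub C A (e i)) (i : Fin n) (x y : homSub C A (e i)) :
    homTensor (Function.update h i (x + y)) =
      homTensor (Function.update h i x) + homTensor (Function.update h i y) := by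
  simp only [homTensor_update, Submodule.coe_add, LinearMap.add_comp,
    PiTensorProduct.map_update_add]

theorem homTensor_update_smul {C : DGMod.{u, v₁} R} {A : DGMod.{u, v₂} R} {n : ℕ} {e : Fin n → ℤ}
    [DecidableEq (Fin n)] (h : ∀ i, homSub C A (e i)) (i : Fin n) (r : R) (x : homSub C A (e i)) :
    homTensor (Function.update h i (r • x)) = r • homTensor (Function.update h i x) := by
  simp only [homTensor_update, Submodule.coe_smul, LinearMap.smul_comp,
    PiTensorProduct.map_update_smul]

/-- For `φ : C₂ → C₁^{⊗ n}` of degree `a`, `g : A₁^{⊗ n} → A₂` of degree `b` and homogeneous maps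
`h_i : C₁ → A₁`, the map
`(-1)^{|φ|(|g| + |h₁| + ⋯ + |h_n|)} g ∘ (h₁ ⊗ ⋯ ⊗ h_n) ∘ φ : C₂ → A₂`. -/
def convApply {C₁ : DGMod.{u, v₁} R} {C₂ : DGMod.{u, v₂} R} {A₁ : DGMod.{u, v₃} R}
    {A₂ : DGMod.{u, v₄} R} {n : ℕ} {a b : ℤ} (φ : comulSub C₂ C₁ n a) (g : mulSub A₁ A₂ n b)
    {e : Fin n → ℤ} (h : ∀ i, homSub C₁ A₁ (e i)) : homSub C₂ A₂ (a + b + ∑ i, e i) :=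
  ⟨ksign R (a * (b + ∑ i, e i)) • (PiTensorProduct.lift g.1 ∘ₗ homTensor h ∘ₗ φ.1), fun i x => by
    refine Submodule.smul_mem _ _ ?_
    change PiTensorProduct.lift g.1 (homTensor h (φ.1 (C₂.ι i x))) ∈ _
    have h1 := C₁.map_mem A₁ (fun i => (h i).1 ∘ₗ C₁.eps (∑ j ∈ Finset.Ioi i, e j)) e
      (fun j i x => by
        rw [LinearMap.comp_apply, DGMod.eps_ι, map_smul]
        exact Submodule.smul_mem _ _ ((h j).2 _ _)) rfl (φ.2 i x)
    have h2 : A₁.tHomog n (i + a + ∑ j, e j) ≤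
        (A₂.homog (i + (a + b + ∑ j, e j))).comap (PiTensorProduct.lift g.1) := by
      refine Submodule.span_le.2 ?_
      rintro _ ⟨c, z, hc, rfl⟩
      rw [SetLike.mem_coe, Submodule.mem_comap, PiTensorProduct.lift.tprod]
      exact mulSub_apply_mem g c _ (fun i => A₁.ι_mem _ _) (by rw [hc]; ring)
    exact h2 h1⟩

/-- For `φ : C₂ → C₁^{⊗ n}` of degree `a` and `g : A₁^{⊗ n} → A₂` of degree `b`, the map
`Hom(C₁, A₁)^{⊗ n} → Hom(C₂, A₂)` of degree `a + b` given on homogeneous elements by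
`h₁ ⊗ ⋯ ⊗ h_n ↦ (-1)^{|φ|(|g| + |h₁| + ⋯ + |h_n|)} g ∘ (h₁ ⊗ ⋯ ⊗ h_n) ∘ φ`. -/
def convMul {C₁ : DGMod.{u, v₁} R} {C₂ : DGMod.{u, v₂} R} {A₁ : DGMod.{u, v₃} R}
    {A₂ : DGMod.{u, v₄} R} {n : ℕ} {a b : ℤ} (φ : comulSub C₂ C₁ n a) (g : mulSub A₁ A₂ n b) :
    mulSub (HomDG C₁ A₁) (HomDG C₂ A₂) n (a + b) :=
  ⟨MultilinearMap.fromDirectSumEquiv fun e : Fin n → ℤ =>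
      ((HomDG C₂ A₂).ι (a + b + ∑ i, e i)).compMultilinearMap
        { toFun := fun h : ∀ i, homSub C₁ A₁ (e i) => convApply φ g h
          map_update_add' := fun h i x y => by
            apply Subtype.ext
            refine (congrArg (fun T => ksign R (a * (b + ∑ i, e i)) •
              (PiTensorProduct.lift g.1 ∘ₗ T ∘ₗ φ.1)) (homTensor_update_add h i x y)).trans ?_
            simp only [LinearMap.add_comp, LinearMap.comp_add, smul_add]
            rfl
          map_update_smul' := fun h i r x => by
            apply Subtype.ext
            refine (congrArg (fun T => ksign R (a * (b + ∑ i, e i)) •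
              (PiTensorProduct.lift g.1 ∘ₗ T ∘ₗ φ.1)) (homTensor_update_smul h i r x)).trans ?_
            simp only [LinearMap.smul_comp, LinearMap.comp_smul]
            rw [smul_comm]
            rfl },
    fun e h => by
      rw [MultilinearMap.fromDirectSumEquiv_lof]
      exact DGMod.ι_mem _ _ _⟩

theorem convMul_ι {C₁ : DGMod.{u, v₁} R} {C₂ : DGMod.{u, v₂} R} {A₁ : DGMod.{u, v₃} R}
    {A₂ : DGMod.{u, v₄} R} {n : ℕ} {a b : ℤ} (φ : comulSub C₂ C₁ n a) (g : mulSub A₁ A₂ n b)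
    {e : Fin n → ℤ} (h : ∀ i, homSub C₁ A₁ (e i)) :
    (convMul φ g).1 (fun i => (HomDG C₁ A₁).ι (e i) (h i)) =
      (HomDG C₂ A₂).ι (a + b + ∑ i, e i) (convApply φ g h) :=
  MultilinearMap.fromDirectSumEquiv_lof _ _ _

/-- The composite of `A_∞ ⊗ A_∞ → coEnd_C ⊗ End_A`, given by an `A_∞`-coalgebra structure on `C` and
an `A_∞`-algebra structure on `A`, with `coEnd_C ⊗ End_A → End_{Hom(C, A)}`. -/
def convEval {C : DGMod.{u, v₁} R} {A : DGMod.{u, v₂} R} (c : AInfStr (CoEndOp C))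
    (m : AInfStr (EndOp A)) {n : ℕ} {d : ℤ} :
    (AInfTensor R).X n d →ₗ[R] (EndOp (HomDG C A)).X n d :=
  Finsupp.linearCombination R fun t : TreePairN n d =>
    (EndOp (HomDG C A)).cast rfl t.2.2.2
      (convMul ((CoEndOp C).evalTreeN c.op t.fst) ((EndOp A).evalTreeN m.op t.snd))

/-- The composite of `M_∞ ⊗ M_∞ → coHom^{C₂}_{C₁} ⊗ Hom^{A₁}_{A₂}`, given by an `A_∞`-morphism of
coalgebras `G : C₂ ⇝ C₁` and an `A_∞`-morphism of algebras `F : A₁ ⇝ A₂`, with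
`coHom^{C₂}_{C₁} ⊗ Hom^{A₁}_{A₂} → Hom^{Hom(C₁, A₁)}_{Hom(C₂, A₂)}`. -/
def convMorEval {C₁ : DGMod.{u, v₁} R} {C₂ : DGMod.{u, v₂} R} {A₁ : DGMod.{u, v₃} R}
    {A₂ : DGMod.{u, v₄} R} {c₁ : AInfStr (CoEndOp C₁)} {c₂ : AInfStr (CoEndOp C₂)}
    {m₁ : AInfStr (EndOp A₁)} {m₂ : AInfStr (EndOp A₂)}
    (G : MInfStr (CoHomBi C₂ C₁) c₂ c₁) (F : MInfStr (HomBi A₁ A₂) m₂ m₁) {n : ℕ} {d : ℤ} :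
    (MInfTensor R).X n d →ₗ[R] (HomBi (HomDG C₁ A₁) (HomDG C₂ A₂)).X n d :=
  Finsupp.linearCombination R fun t : MTreePairN n d =>
    (HomBi (HomDG C₁ A₁) (HomDG C₂ A₂)).cast rfl t.2.2.2
      (convMul ((CoHomBi C₂ C₁).evalTreeN c₂.op c₁.op G.op t.fst)
        ((HomBi A₁ A₂).evalTreeN m₂.op m₁.op F.op t.snd))

end Hom

/-- An `A_∞`-algebra structure on the dg module `A`: an `A_∞`-structure in `End_A`. -/
abbrev AInfAlgStr {R : Type u} [CommRing R] (A : DGMod.{u, v} R) := AInfStr (EndOp A)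

/-- An `A_∞`-coalgebra structure on the dg module `C`: an `A_∞`-structure in `coEnd_C`. -/
abbrev AInfCoalgStr {R : Type u} [CommRing R] (C : DGMod.{u, v} R) := AInfStr (CoEndOp C)

/-- `A_∞`-morphisms `A ⇝ B` between `A_∞`-algebras. -/
abbrev AInfAlgMor {R : Type u} [CommRing R] {A : DGMod.{u, v₁} R} {B : DGMod.{u, v₂} R}
    (mA : AInfAlgStr A) (mB : AInfAlgStr B) := MInfStr (HomBi A B) mB mA

/-- `A_∞`-morphisms `C ⇝ D` between `A_∞`-coalgebras. -/
abbrev AInfCoalgMor {R : Type u} [CommRing R] {C : DGMod.{u, v₁} R} {D : DGMod.{u, v₂} R}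
    (cC : AInfCoalgStr C) (cD : AInfCoalgStr D) := MInfStr (CoHomBi C D) cC cD

/-- The `A_∞`-algebra structure `μ` on `Hom(C, A)` is the one induced by the diagonal: the morphism
`A_∞ → End_{Hom(C, A)}` classifying `μ` is the composite
`A_∞ → A_∞ ⊗ A_∞ → coEnd_C ⊗ End_A → End_{Hom(C, A)}`. -/
def IsConvolution {R : Type u} [CommRing R] (Δ : AInfDiagonal R) {C : DGMod.{u, v₁} R}
    {A : DGMod.{u, v₂} R} (c : AInfCoalgStr C) (m : AInfAlgStr A) (μ : AInfAlgStr (HomDG C A)) :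
    Prop :=
  ∀ (n : ℕ) (d : ℤ) (x : (AInf R).X n d), μ.eval x = convEval c m (Δ.map x)

/-- The `A_∞`-morphism `H : Hom(C₁, A₁) ⇝ Hom(C₂, A₂)` is the one induced by the diagonal on `M_∞`:
the morphism of bimodules classifying `H` is the composite
`M_∞ → M_∞ ⊗ M_∞ → coHom^{C₂}_{C₁} ⊗ Hom^{A₁}_{A₂} → Hom^{Hom(C₁, A₁)}_{Hom(C₂, A₂)}`. -/
def IsConvolutionMor {R : Type u} [CommRing R] {Δ : AInfDiagonal R} (ΔM : MInfDiagonal Δ)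
    {C₁ : DGMod.{u, v₁} R} {C₂ : DGMod.{u, v₂} R} {A₁ : DGMod.{u, v₃} R} {A₂ : DGMod.{u, v₄} R}
    {c₁ : AInfCoalgStr C₁} {c₂ : AInfCoalgStr C₂} {m₁ : AInfAlgStr A₁} {m₂ : AInfAlgStr A₂}
    (G : AInfCoalgMor c₂ c₁) (F : AInfAlgMor m₁ m₂)
    {μ₁ : AInfAlgStr (HomDG C₁ A₁)} {μ₂ : AInfAlgStr (HomDG C₂ A₂)} (H : AInfAlgMor μ₁ μ₂) :
    Prop :=
  ∀ (n : ℕ) (d : ℤ) (x : (MInf R).X n d), H.eval x = convMorEval G F (ΔM.map x)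

end ConvAInf

end

open ConvAInf

universe u v₁ v₂ v₃ v₄

/-!
The operad `A_∞` and the bimodule `M_∞` are free as graded objects, on the operations `m_n` and `f_n`,
and their differentials on generators are the right hand sides of the defining relations. Hence a
morphism of dg operads from `A_∞` to a dg operad is the same as an `A_∞`-structure
(`OperadHom.existsUnique_eval`), and likewise for `M_∞` and `A_∞`-morphisms
(`BimoduleOps.existsUnique_eval`). Existence and uniqueness of the two convolution structures therefore
follow once the composites `A_∞ → A_∞ ⊗ A_∞ → coEnd ⊗ End → End` and
`M_∞ → M_∞ ⊗ M_∞ → coHom ⊗ Hom → Hom` are known to be morphisms. The first arrows are morphisms by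
hypothesis, which leaves three points.

* `End`, `coEnd`, `Hom` and `coHom` satisfy the axioms of dg operads and operadic bimodules
  (`endOp_lawful`, `coEndOp_lawful`, `homBi_lawful`, `coHomBi_lawful`). Everything reduces to two facts
  on Koszul tensor products of maps: the interchange law `koszulMap_comp` and the Leibniz rule
  `koszulMap_leibniz`. They hold for arbitrary modules with parity operators, so that they apply to dg
  modules, to their tensor powers and to blocks of these alike. Tensors in powers with equal but not
  definitionally equal exponents are compared in the tensor algebra.

* The evaluation of trees in an operad or bimodule satisfying the axioms respects grafting and
  differentials, by induction on trees: `OperadOps.evalTree_graft`, `BimoduleOps.evalTree_lgraft`,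
  `BimoduleOps.evalTree_rgraft`, `OperadOps.d_evalTree`, `BimoduleOps.d_evalTree`. Here the relations
  of the given algebras, coalgebras and morphisms enter.

* The map `Θ` respects units, compositions and differentials: `convMul_one`, `convMul_comp`,
  `convMul_leibniz`. For compositions the interchange law is applied twice to
  `g ∘ (l₁ ⊗ ⋯ ⊗ l_k) ∘ (h₁ ⊗ ⋯ ⊗ h_n) ∘ (ψ₁ ⊗ ⋯ ⊗ ψ_k) ∘ φ`, and the resulting signs agree modulo
  two with those of a tensor product of operads.

The last two points combine to the statements on `pairEval` and `pairMorEval`, the maps that evaluate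
pairs of trees and pair the results.
-/

noncomputable section

open scoped DirectSum TensorProduct

namespace ConvAInf

universe v w w₁ w₂ w₃

/-! ### Calculus of signs -/

section Signs

variable (R : Type u) [CommRing R]

theorem ksign_add (a b : ℤ) : ksign R (a + b) = ksign R a * ksign R b := by
  simp [ksign, Int.negOnePow_add]

@[simp] theorem ksign_zero : ksign R 0 = 1 := by simp [ksign]

theorem ksign_mul_self (a : ℤ) : ksign R a * ksign R a = 1 := by
  rw [← ksign_add, ksign, Int.negOnePow_even _ ⟨a, rfl⟩]; simp

/-- A sign depends only on the parity of its exponent; the witness `c` is half of the difference. -/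
theorem ksign_congr {a b : ℤ} (c : ℤ) (h : a = b + (c + c)) : ksign R a = ksign R b := by
  rw [h, ksign_add, ksign_add, ksign_mul_self, mul_one]

theorem ksign_sum {ι : Type*} (s : Finset ι) (f : ι → ℤ) :
    ksign R (∑ i ∈ s, f i) = ∏ i ∈ s, ksign R (f i) := by
  induction s using Finset.cons_induction with
  | empty => simp
  | cons i s hi ih => rw [Finset.sum_cons, Finset.prod_cons, ksign_add, ih]

end Signs

/-! ### Sums over blocks of consecutive indices -/

theorem finSigmaFinEquiv_lt_of_lt {k : ℕ} {n : Fin k → ℕ} {j j' : Fin k} (h : j < j')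
    (i : Fin (n j)) (i' : Fin (n j')) :
    finSigmaFinEquiv (⟨j, i⟩ : (j : Fin k) × Fin (n j)) < finSigmaFinEquiv ⟨j', i'⟩ := by
  rw [Fin.lt_def, finSigmaFinEquiv_apply, finSigmaFinEquiv_apply]
  have key : ∑ x : Fin (j : ℕ), n (Fin.castLE j.2.le x) + n j ≤
      ∑ x : Fin (j' : ℕ), n (Fin.castLE j'.2.le x) := by
    have h1 : ∀ m (hm : m < k), ∑ x : Fin m, n (Fin.castLE hm.le x) =
        ∑ x ∈ Finset.range m, if hx : x < k then n ⟨x, hx⟩ else 0 := fun m hm => by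
      rw [Finset.sum_range]
      refine Finset.sum_congr rfl fun x _ => ?_
      rw [dif_pos (x.2.trans hm)]
      rfl
    rw [h1 _ j.2, h1 _ j'.2]
    have h2 : n j = if hx : (j : ℕ) < k then n ⟨j, hx⟩ else 0 := by simp
    rw [h2, ← Finset.sum_range_succ]
    exact Finset.sum_le_sum_of_subset (Finset.range_subset_range.2 h)
  have := i.2
  dsimp only at *
  omega

/-- Blocks of consecutive indices are ordered lexicographically. -/
theorem finSigmaFinEquiv_lt_iff {k : ℕ} {n : Fin k → ℕ} {j j' : Fin k}
    (i : Fin (n j)) (i' : Fin (n j')) :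
    finSigmaFinEquiv (⟨j, i⟩ : (j : Fin k) × Fin (n j)) < finSigmaFinEquiv ⟨j', i'⟩ ↔
      j < j' ∨ (j = j' ∧ (i : ℕ) < i') := by
  rcases lt_trichotomy j j' with h | h | h
  · simp [h, finSigmaFinEquiv_lt_of_lt h]
  · subst h
    rw [Fin.lt_def, finSigmaFinEquiv_apply, finSigmaFinEquiv_apply]
    simp
  · simp only [h.not_gt, h.ne', (finSigmaFinEquiv_lt_of_lt h i' i).not_gt, false_and, or_self]

theorem sum_finSigmaFinEquiv {M : Type*} [AddCommMonoid M] {k : ℕ} {n : Fin k → ℕ}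
    (F : Fin (∑ j, n j) → M) :
    ∑ q, F q = ∑ j, ∑ i, F (finSigmaFinEquiv ⟨j, i⟩) := by
  rw [← Finset.sum_sigma (s := Finset.univ) (t := fun _ => Finset.univ)
    (f := fun x : (j : Fin k) × Fin (n j) => F (finSigmaFinEquiv x))]
  exact (Fintype.sum_equiv finSigmaFinEquiv _ _ fun _ => rfl).symm

theorem sum_Ioi_finSigmaFinEquiv {M : Type*} [AddCommMonoid M] {k : ℕ} {n : Fin k → ℕ}
    (F : Fin (∑ j, n j) → M) (j : Fin k) (i : Fin (n j)) :
    ∑ q ∈ Finset.Ioi (finSigmaFinEquiv ⟨j, i⟩), F q =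
      ∑ i' ∈ Finset.Ioi i, F (finSigmaFinEquiv ⟨j, i'⟩) +
        ∑ j' ∈ Finset.Ioi j, ∑ i', F (finSigmaFinEquiv ⟨j', i'⟩) := by
  have h : ∀ {m : ℕ} (a : Fin m), Finset.Ioi a = Finset.univ.filter fun b => a < b := fun a => by
    ext; simp
  simp only [h, Finset.sum_filter]
  rw [sum_finSigmaFinEquiv]
  simp only [finSigmaFinEquiv_lt_iff]
  have h3 : ∀ j' : Fin k, (∑ i' : Fin (n j'), if j < j' ∨ (j = j' ∧ (i : ℕ) < i') then
      F (finSigmaFinEquiv ⟨j', i'⟩) else 0) =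
      (if j = j' then ∑ i' : Fin (n j'), if (i : ℕ) < i' then F (finSigmaFinEquiv ⟨j', i'⟩) else 0
        else 0) + if j < j' then ∑ i' : Fin (n j'), F (finSigmaFinEquiv ⟨j', i'⟩) else 0 := by
    intro j'
    by_cases h1 : j = j'
    · subst h1; simp
    · by_cases h2 : j < j' <;> simp [h1, h2]
  simp only [h3, Finset.sum_add_distrib, Finset.sum_ite_eq, Finset.mem_univ, if_true]
  rfl

theorem sum_univ_eq_Iio_add_Ioi {M : Type*} [AddCommMonoid M] {k : ℕ} (F : Fin k → M) (j : Fin k) :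
    ∑ i, F i = ∑ i ∈ Finset.Iio j, F i + (F j + ∑ i ∈ Finset.Ioi j, F i) := by
  have h : ∀ i, F i = (if i < j then F i else 0) + ((if i = j then F i else 0) +
      if j < i then F i else 0) := fun i => by
    rcases lt_trichotomy i j with h | h | h
    · simp [h, h.ne, h.not_gt]
    · simp [h]
    · simp [h, h.ne', h.not_gt]
  rw [Finset.sum_congr rfl fun i _ => h i]
  simp only [Finset.sum_add_distrib, Finset.sum_ite_eq', Finset.mem_univ, if_true,
    ← Finset.sum_filter]
  refine congrArg₂ _ (Finset.sum_congr ?_ fun _ _ => rfl)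
    (congrArg₂ _ rfl (Finset.sum_congr ?_ fun _ _ => rfl)) <;> ext <;> simp

/-! ### Koszul tensor products of families of maps -/

section Koszul

variable {R : Type u} [CommRing R]

/-- A linear map `F` between modules with operators `ε k`, standing for `x ↦ (-1)^{k |x|} x`, has
the parity of `e` if it commutes with these operators up to the sign `(-1)^{k e}`. -/
def HasParity {V : Type v₁} {W : Type v₂} [AddCommMonoid V] [Module R V] [AddCommMonoid W]
    [Module R W] (εV : ℤ → V →ₗ[R] V) (εW : ℤ → W →ₗ[R] W) (e : ℤ) (F : V →ₗ[R] W) : Prop :=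
  ∀ k, F ∘ₗ εV k = ksign R (k * e) • (εW k ∘ₗ F)

/-- The tensor product `F₁ ⊗ ⋯ ⊗ F_k` of maps of degrees `e₁, …, e_k`, with the Koszul sign. -/
def koszulMap {k : ℕ} {V : Fin k → Type v₁} {W : Fin k → Type v₂} [∀ j, AddCommMonoid (V j)]
    [∀ j, Module R (V j)] [∀ j, AddCommMonoid (W j)] [∀ j, Module R (W j)]
    (ε : ∀ j, ℤ → V j →ₗ[R] V j) (e : Fin k → ℤ) (F : ∀ j, V j →ₗ[R] W j) :
    (⨂[R] j, V j) →ₗ[R] ⨂[R] j, W j :=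
  PiTensorProduct.map fun j => F j ∘ₗ ε j (∑ i ∈ Finset.Ioi j, e i)

/-- The map `id ⊗ ⋯ ⊗ δ_i ⊗ ⋯ ⊗ id` for a map `δ_i` of degree `-1`, with the Koszul sign. -/
def koszulSlot {k : ℕ} {V : Fin k → Type v₁} [∀ j, AddCommMonoid (V j)]
    [∀ j, Module R (V j)] (ε δ : ∀ j, V j →ₗ[R] V j) (i : Fin k) :
    (⨂[R] j, V j) →ₗ[R] ⨂[R] j, V j :=
  PiTensorProduct.map fun j => if j < i then ε j else if j = i then δ j else LinearMap.id

theorem linearMap_comp_sum {ι : Type*} {M : Type v₁} {N : Type v₂} {P : Type v₃} [AddCommMonoid M]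
    [Module R M] [AddCommMonoid N] [Module R N] [AddCommMonoid P] [Module R P] (s : Finset ι)
    (f : N →ₗ[R] P) (g : ι → M →ₗ[R] N) : f ∘ₗ ∑ i ∈ s, g i = ∑ i ∈ s, f ∘ₗ g i := by
  ext; simp

theorem linearMap_sum_comp {ι : Type*} {M : Type v₁} {N : Type v₂} {P : Type v₃} [AddCommMonoid M]
    [Module R M] [AddCommMonoid N] [Module R N] [AddCommMonoid P] [Module R P] (s : Finset ι)
    (f : ι → N →ₗ[R] P) (g : M →ₗ[R] N) : (∑ i ∈ s, f i) ∘ₗ g = ∑ i ∈ s, f i ∘ₗ g := by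
  ext; simp

theorem piTensor_map_smul {k : ℕ} {V : Fin k → Type v₁} {W : Fin k → Type v₂}
    [∀ j, AddCommMonoid (V j)]
    [∀ j, Module R (V j)] [∀ j, AddCommMonoid (W j)] [∀ j, Module R (W j)]
    (c : Fin k → R) (F : ∀ j, V j →ₗ[R] W j) :
    PiTensorProduct.map (fun j => c j • F j) = (∏ j, c j) • PiTensorProduct.map F := by
  refine PiTensorProduct.ext (MultilinearMap.ext fun x => ?_)
  simp only [LinearMap.compMultilinearMap_apply, PiTensorProduct.map_tprod, LinearMap.smul_apply]
  exact MultilinearMap.map_smul_univ _ _ _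

/-- The interchange law `(F₁ ⊗ ⋯ ⊗ F_k) ∘ (G₁ ⊗ ⋯ ⊗ G_k) = ± (F₁ G₁) ⊗ ⋯ ⊗ (F_k G_k)`. -/
theorem koszulMap_comp {k : ℕ} {U : Fin k → Type v₃} {V : Fin k → Type v₁} {W : Fin k → Type v₂}
    [∀ j, AddCommMonoid (U j)] [∀ j, Module R (U j)]
    [∀ j, AddCommMonoid (V j)] [∀ j, Module R (V j)]
    [∀ j, AddCommMonoid (W j)] [∀ j, Module R (W j)]
    (εU : ∀ j, ℤ → U j →ₗ[R] U j) (hU : ∀ j a b, εU j (a + b) = εU j a ∘ₗ εU j b)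
    (εV : ∀ j, ℤ → V j →ₗ[R] V j) (e e' : Fin k → ℤ)
    (F : ∀ j, V j →ₗ[R] W j) (G : ∀ j, U j →ₗ[R] V j)
    (hG : ∀ j, HasParity (εU j) (εV j) (e' j) (G j)) :
    koszulMap εV e F ∘ₗ koszulMap εU e' G =
      ksign R (shuffleExp e e') • koszulMap εU (fun j => e j + e' j) fun j => F j ∘ₗ G j := by
  have h : ∀ j, (F j ∘ₗ εV j (∑ i ∈ Finset.Ioi j, e i)) ∘ₗ
      (G j ∘ₗ εU j (∑ i ∈ Finset.Ioi j, e' i)) = ksign R (∑ i ∈ Finset.Ioi j, e' j * e i) •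
      ((F j ∘ₗ G j) ∘ₗ εU j (∑ i ∈ Finset.Ioi j, (e i + e' i))) := fun j => by
    have h1 := hG j (∑ i ∈ Finset.Ioi j, e i)
    have h2 : εV j (∑ i ∈ Finset.Ioi j, e i) ∘ₗ G j =
        ksign R (∑ i ∈ Finset.Ioi j, e' j * e i) • (G j ∘ₗ εU j (∑ i ∈ Finset.Ioi j, e i)) := by
      rw [h1, smul_smul, ← Finset.mul_sum, mul_comm (e' j), ksign_mul_self, one_smul]
    rw [Finset.sum_add_distrib, hU, LinearMap.comp_assoc, ← LinearMap.comp_assoc (εU _ _), h2]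
    simp only [LinearMap.smul_comp, LinearMap.comp_smul, LinearMap.comp_assoc]
  rw [koszulMap, koszulMap, ← PiTensorProduct.map_comp]
  simp only [h]
  rw [piTensor_map_smul, ← ksign_sum]
  rfl

/-- The Leibniz rule for the commutator of the total differential with a tensor product of maps. -/
theorem koszulMap_leibniz {k : ℕ} {V : Fin k → Type v₁} {W : Fin k → Type v₂}
    [∀ j, AddCommMonoid (V j)] [∀ j, Module R (V j)]
    [∀ j, AddCommMonoid (W j)] [∀ j, Module R (W j)]
    (εV : ∀ j, ℤ → V j →ₗ[R] V j) (hV : ∀ j a b, εV j (a + b) = εV j a ∘ₗ εV j b)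
    (hV2 : ∀ j a, εV j (a + a) = LinearMap.id)
    (εW : ∀ j, ℤ → W j →ₗ[R] W j) (δV : ∀ j, V j →ₗ[R] V j)
    (hδ : ∀ j a, δV j ∘ₗ εV j a = ksign R a • (εV j a ∘ₗ δV j))
    (δW : ∀ j, W j →ₗ[R] W j) (e : Fin k → ℤ)
    (F : ∀ j, V j →ₗ[R] W j) (hF : ∀ j, HasParity (εV j) (εW j) (e j) (F j))
    (F' : ∀ (_ j : Fin k), V j →ₗ[R] W j)
    (hF' : ∀ i j, j ≠ i → F' i j = F j)
    (hF'' : ∀ i, F' i i = δW i ∘ₗ F i + (-ksign R (e i)) • (F i ∘ₗ δV i)) :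
    (∑ i, koszulSlot (fun j => εW j 1) δW i) ∘ₗ koszulMap εV e F +
      (-ksign R (∑ i, e i)) • (koszulMap εV e F ∘ₗ ∑ i, koszulSlot (fun j => εV j 1) δV i) =
    ∑ i, ksign R (∑ j ∈ Finset.Iio i, e j) •
      koszulMap εV (fun j => e j - if j = i then 1 else 0) (F' i) := by
  have hcongr : ∀ j a b c, a = b + (c + c) → εV j a = εV j b := fun j a b c h => by
    rw [h, hV, hV2, LinearMap.comp_id]
  -- the operator `T i X` has `X` in the slot `i` and the maps `F j`, twisted by signs, elsewhere
  let T : ∀ i : Fin k, (V i →ₗ[R] W i) → ((⨂[R] j, V j) →ₗ[R] ⨂[R] j, W j) := fun i X =>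
    PiTensorProduct.map (Function.update (fun j => F j ∘ₗ εV j
      ((∑ l ∈ Finset.Ioi j, e l) + if j < i then 1 else 0)) i
      (X ∘ₗ εV i (∑ l ∈ Finset.Ioi i, e l)))
  have hTadd : ∀ i X Y, T i (X + Y) = T i X + T i Y := fun i X Y => by
    simp only [T, LinearMap.add_comp, PiTensorProduct.map_update_add]
  have hTsmul : ∀ i (c : R) X, T i (c • X) = c • T i X := fun i c X => by
    simp only [T, LinearMap.smul_comp, PiTensorProduct.map_update_smul]
  have h1 : ∀ i, koszulSlot (fun j => εW j 1) δW i ∘ₗ koszulMap εV e F =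
      ksign R (∑ j ∈ Finset.Iio i, e j) • T i (δW i ∘ₗ F i) := fun i => by
    rw [koszulSlot, koszulMap, ← PiTensorProduct.map_comp]
    have : ∀ j, (if j < i then εW j 1 else if j = i then δW j else LinearMap.id) ∘ₗ
        F j ∘ₗ εV j (∑ l ∈ Finset.Ioi j, e l) = (if j ∈ Finset.Iio i then ksign R (e j) else 1) •
        Function.update (fun j => F j ∘ₗ εV j ((∑ l ∈ Finset.Ioi j, e l) + if j < i then 1 else 0))
          i ((δW i ∘ₗ F i) ∘ₗ εV i (∑ l ∈ Finset.Ioi i, e l)) j := fun j => by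
      rcases lt_trichotomy j i with h | h | h
      · have h3 : εW j 1 ∘ₗ F j = ksign R (e j) • (F j ∘ₗ εV j 1) := by
          rw [hF j 1, smul_smul, one_mul, ksign_mul_self, one_smul]
        rw [if_pos h, if_pos (Finset.mem_Iio.2 h), Function.update_of_ne h.ne, if_pos h,
          ← LinearMap.comp_assoc, h3, LinearMap.smul_comp, LinearMap.comp_assoc, ← hV, add_comm]
      · subst h
        simp [LinearMap.comp_assoc]
      · rw [if_neg h.not_gt, if_neg h.ne', if_neg (by simpa using h.le),
          Function.update_of_ne h.ne', if_neg h.not_gt, add_zero, one_smul, LinearMap.id_comp]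
    simp only [this]
    rw [piTensor_map_smul, Finset.prod_ite_mem, Finset.univ_inter, ← ksign_sum]
  have h2 : ∀ i, koszulMap εV e F ∘ₗ koszulSlot (fun j => εV j 1) δV i =
      ksign R (∑ j ∈ Finset.Ioi i, e j) • T i (F i ∘ₗ δV i) := fun i => by
    rw [koszulSlot, koszulMap, ← PiTensorProduct.map_comp, ← hTsmul]
    congr 1
    funext j
    rcases lt_trichotomy j i with h | h | h
    · rw [if_pos h, Function.update_of_ne h.ne, if_pos h, LinearMap.comp_assoc, ← hV]
    · subst h
      simp only [lt_self_iff_false, if_false, if_true, Function.update_self]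
      rw [LinearMap.comp_assoc, LinearMap.smul_comp, LinearMap.comp_assoc, hδ, LinearMap.comp_smul,
        smul_smul, ksign_mul_self, one_smul]
    · rw [if_neg h.not_gt, if_neg h.ne',
          Function.update_of_ne h.ne', if_neg h.not_gt, add_zero, LinearMap.comp_id]
  have h3 : ∀ i, koszulMap εV (fun j => e j - if j = i then 1 else 0) (F' i) = T i (F' i i) := by
    intro i
    rw [koszulMap]
    congr 1
    funext j
    have hs : ∑ l ∈ Finset.Ioi j, (e l - if l = i then 1 else 0) =
        ∑ l ∈ Finset.Ioi j, e l - if j < i then 1 else 0 := by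
      rw [Finset.sum_sub_distrib, Finset.sum_ite_eq']
      simp
    rw [hs]
    by_cases h : j = i
    · subst h
      simp
    · rw [Function.update_of_ne h, hF' i j h]
      congr 1
      refine hcongr j _ _ (-if j < i then 1 else 0) ?_
      ring
  rw [linearMap_comp_sum, linearMap_sum_comp, Finset.smul_sum, ← Finset.sum_add_distrib]
  refine Finset.sum_congr rfl fun i _ => ?_
  rw [h1, h2, h3, hF'', hTadd, hTsmul, smul_add, smul_smul, smul_smul]
  congr 2
  rw [neg_mul, mul_neg, ← ksign_add, ← ksign_add, sum_univ_eq_Iio_add_Ioi e i]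
  congr 1
  exact ksign_congr R (∑ j ∈ Finset.Ioi i, e j) (by ring)

end Koszul

/-! ### Parity and differential on tensor powers -/

section TensorPowers

variable {R : Type u} [CommRing R]

/-- Multilinear maps agree if they agree on families taken from spanning sets: the entries are
replaced by arbitrary elements one at a time. -/
theorem multilinear_ext_of_span {k : ℕ} {M : Fin k → Type v₁} {N : Type v₂}
    [∀ j, AddCommMonoid (M j)] [∀ j, Module R (M j)] [AddCommMonoid N] [Module R N]
    (S : ∀ j, Set (M j)) (hS : ∀ j, Submodule.span R (S j) = ⊤) {f g : MultilinearMap R M N}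
    (h : ∀ x : ∀ j, M j, (∀ j, x j ∈ S j) → f x = g x) : f = g := by
  -- induction on the set `s` of indices whose entries are arbitrary
  have key : ∀ (s : Finset (Fin k)) (x : ∀ j, M j), (∀ j, j ∉ s → x j ∈ S j) → f x = g x := by
    intro s
    induction s using Finset.induction_on with
    | empty => exact fun x hx => h x fun j => hx j (Finset.notMem_empty j)
    | insert i s hi ih =>
      intro x hx
      have hL : f.toLinearMap x i = g.toLinearMap x i := by
        refine LinearMap.ext_on (hS i) fun z hz => ih (Function.update x i z) fun j hj => ?_
        by_cases hji : j = i
        · subst hji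
          rwa [Function.update_self]
        · rw [Function.update_of_ne hji]
          exact hx j (by simp [hji, hj])
      simpa using LinearMap.congr_fun hL (x i)
  exact MultilinearMap.ext fun x => key Finset.univ x fun j hj => absurd (Finset.mem_univ j) hj

theorem piTensor_ext_of_span {k : ℕ} {M : Fin k → Type v₁} {N : Type v₂}
    [∀ j, AddCommMonoid (M j)] [∀ j, Module R (M j)] [AddCommMonoid N] [Module R N]
    (S : ∀ j, Set (M j)) (hS : ∀ j, Submodule.span R (S j) = ⊤) {f g : (⨂[R] j, M j) →ₗ[R] N}
    (h : ∀ x : ∀ j, M j, (∀ j, x j ∈ S j) →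
      f (PiTensorProduct.tprod R x) = g (PiTensorProduct.tprod R x)) : f = g :=
  PiTensorProduct.ext (multilinear_ext_of_span S hS h)

namespace DGMod

variable (A : DGMod.{u, v} R)

theorem tot_hom_ext {N : Type w} [AddCommMonoid N] [Module R N] {f g : A.Tot →ₗ[R] N}
    (h : ∀ i x, f (A.ι i x) = g (A.ι i x)) : f = g :=
  DirectSum.linearMap_ext R fun i => LinearMap.ext (h i)

theorem eps_add (a b : ℤ) : A.eps (a + b) = A.eps a ∘ₗ A.eps b := by
  refine A.tot_hom_ext fun i x => ?_
  rw [LinearMap.comp_apply, eps_ι, eps_ι, map_smul, eps_ι, smul_smul, add_mul, ksign_add, mul_comm]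

theorem eps_add_self (a : ℤ) : A.eps (a + a) = LinearMap.id := by
  refine A.tot_hom_ext fun i x => ?_
  rw [eps_ι, add_mul, ksign_add, ksign_mul_self, one_smul]
  rfl

theorem eps_zero : A.eps 0 = LinearMap.id := by
  simpa using A.eps_add_self 0

theorem diff_comp_eps (a : ℤ) : A.diff ∘ₗ A.eps a = ksign R a • (A.eps a ∘ₗ A.diff) := by
  refine A.tot_hom_ext fun i x => ?_
  rw [LinearMap.comp_apply, eps_ι, map_smul, diff_ι, LinearMap.smul_apply, LinearMap.comp_apply,
    diff_ι, eps_ι, smul_smul, ← ksign_add]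
  congr 2
  ring

/-- The map `x ↦ (-1)^{k |x|} x` on the tensor power `A^{⊗ n}`. -/
def tEps (n : ℕ) (k : ℤ) : A.TPow n →ₗ[R] A.TPow n := PiTensorProduct.map fun _ => A.eps k

theorem tEps_add (n : ℕ) (a b : ℤ) : A.tEps n (a + b) = A.tEps n a ∘ₗ A.tEps n b := by
  rw [tEps, tEps, tEps, ← PiTensorProduct.map_comp]
  simp only [eps_add]

theorem tEps_add_self (n : ℕ) (a : ℤ) : A.tEps n (a + a) = LinearMap.id := by
  rw [tEps, eps_add_self]
  exact PiTensorProduct.map_id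

/-- The operator `tEps n k`, defined factor by factor, does multiply a homogeneous tensor of total
degree `m` by `(-1)^{k m}`. -/
theorem tEps_of_mem {n : ℕ} (k : ℤ) {m : ℤ} {y : A.TPow n} (hy : y ∈ A.tHomog n m) :
    A.tEps n k y = ksign R (k * m) • y := by
  have : A.tHomog n m ≤ LinearMap.ker (A.tEps n k - ksign R (k * m) • LinearMap.id) := by
    refine Submodule.span_le.2 ?_
    rintro _ ⟨e, x, he, rfl⟩
    rw [SetLike.mem_coe, LinearMap.mem_ker, LinearMap.sub_apply, tEps, PiTensorProduct.map_tprod]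
    simp only [eps_ι]
    rw [← he, Finset.mul_sum, ksign_sum]
    exact sub_eq_zero.2 (MultilinearMap.map_smul_univ _ _ _)
  have h := this hy
  rw [LinearMap.mem_ker, LinearMap.sub_apply, sub_eq_zero] at h
  exact h

theorem tDiff_eq (n : ℕ) :
    A.tDiff n = ∑ i, koszulSlot (fun _ : Fin n => A.eps 1) (fun _ => A.diff) i := rfl

theorem tDiff_comp_tEps (n : ℕ) (a : ℤ) :
    A.tDiff n ∘ₗ A.tEps n a = ksign R a • (A.tEps n a ∘ₗ A.tDiff n) := by
  rw [tDiff_eq, linearMap_sum_comp, linearMap_comp_sum, Finset.smul_sum]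
  refine Finset.sum_congr rfl fun i _ => ?_
  rw [koszulSlot, tEps, ← PiTensorProduct.map_comp, ← PiTensorProduct.map_comp]
  have : ∀ j, (if j < i then A.eps 1 else if j = i then A.diff else LinearMap.id) ∘ₗ A.eps a =
      (if j = i then ksign R a else 1) •
        (A.eps a ∘ₗ if j < i then A.eps 1 else if j = i then A.diff else LinearMap.id) :=
      fun j => by
    rcases lt_trichotomy j i with h | h | h
    · rw [if_pos h, if_neg h.ne, one_smul, ← eps_add, ← eps_add, add_comm]
    · subst h
      simp [diff_comp_eps]
    · rw [if_neg h.not_gt, if_neg h.ne', if_neg h.ne', one_smul, LinearMap.comp_id,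
        LinearMap.id_comp]
  simp only [this]
  rw [piTensor_map_smul]
  simp

theorem span_range_tprod (n : ℕ) :
    Submodule.span R (Set.range (PiTensorProduct.tprod R : (Fin n → A.Tot) → A.TPow n)) = ⊤ :=
  PiTensorProduct.span_tprod_eq_top

/-- Linear maps on `A^{⊗ n₁} ⊗ ⋯ ⊗ A^{⊗ n_k}` agree if they agree on decomposable tensors. -/
theorem nested_hom_ext {k : ℕ} (n : Fin k → ℕ) {N : Type w} [AddCommMonoid N] [Module R N]
    {f g : (⨂[R] j, A.TPow (n j)) →ₗ[R] N}
    (h : ∀ y : Fin (∑ j, n j) → A.Tot,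
      f (PiTensorProduct.tprod R fun j =>
        PiTensorProduct.tprod R fun i => y (finSigmaFinEquiv ⟨j, i⟩)) =
      g (PiTensorProduct.tprod R fun j =>
        PiTensorProduct.tprod R fun i => y (finSigmaFinEquiv ⟨j, i⟩))) : f = g := by
  refine piTensor_ext_of_span _ (fun j => A.span_range_tprod (n j)) fun T hT => ?_
  choose x hx using hT
  have hy : T = fun j => PiTensorProduct.tprod R fun i => x
      (finSigmaFinEquiv.symm (finSigmaFinEquiv (⟨j, i⟩ : (j : Fin k) × Fin (n j)))).1
      (finSigmaFinEquiv.symm (finSigmaFinEquiv (⟨j, i⟩ : (j : Fin k) × Fin (n j)))).2 := by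
    funext j
    rw [← hx j]
    congr 1
    funext i
    rw [Equiv.symm_apply_apply]
  rw [hy]
  exact h fun p => x (finSigmaFinEquiv.symm p).1 (finSigmaFinEquiv.symm p).2

/-- Multilinear maps on `A` agree if they agree on homogeneous elements. -/
theorem multilinear_ext {n : ℕ} {N : Type w} [AddCommMonoid N] [Module R N]
    {f g : MultilinearMap R (fun _ : Fin n => A.Tot) N}
    (h : ∀ (e : Fin n → ℤ) (x : ∀ i, A.X (e i)),
      f (fun i => A.ι (e i) (x i)) = g (fun i => A.ι (e i) (x i))) : f = g :=
  MultilinearMap.directSum_ext fun e => MultilinearMap.ext (h e)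

/-- Naturality of the identification of an iterated tensor power with a tensor power. -/
theorem map_comp_flatten (B : DGMod.{u, w} R) {k : ℕ} (n : Fin k → ℕ)
    (H : Fin (∑ j, n j) → (A.Tot →ₗ[R] B.Tot)) :
    PiTensorProduct.map H ∘ₗ flatten A n = flatten B n ∘ₗ
      PiTensorProduct.map fun j => PiTensorProduct.map fun i => H (finSigmaFinEquiv ⟨j, i⟩) := by
  refine A.nested_hom_ext n fun y => ?_
  rw [LinearMap.comp_apply, LinearMap.comp_apply, flatten_tprod, PiTensorProduct.map_tprod,
    PiTensorProduct.map_tprod]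
  simp only [PiTensorProduct.map_tprod]
  exact (flatten_tprod B n fun p => H p (y p)).symm

/-- The differential of `A^{⊗ (n₁ + ⋯ + n_k)}` is the differential of the tensor product of the
complexes `A^{⊗ n₁}, …, A^{⊗ n_k}`. -/
theorem tDiff_comp_flatten {k : ℕ} (n : Fin k → ℕ) :
    A.tDiff (∑ j, n j) ∘ₗ flatten A n = flatten A n ∘ₗ
      ∑ j, koszulSlot (fun j => A.tEps (n j) 1) (fun j => A.tDiff (n j)) j := by
  rw [tDiff_eq, sum_finSigmaFinEquiv, linearMap_sum_comp, linearMap_comp_sum]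
  refine Finset.sum_congr rfl fun j _ => ?_
  -- the differential of the block `j` is itself a sum over the positions in this block
  have h1 : koszulSlot (fun j => A.tEps (n j) 1) (fun j => A.tDiff (n j)) j =
      ∑ i, PiTensorProduct.map (Function.update
        (fun j' => if j' < j then A.tEps (n j') 1 else LinearMap.id) j
        (koszulSlot (fun _ => A.eps 1) (fun _ => A.diff) i)) := by
    have := (PiTensorProduct.mapMultilinear R (fun j => A.TPow (n j))
      (fun j => A.TPow (n j))).map_update_sum Finset.univ j
      (fun i => koszulSlot (fun _ => A.eps 1) (fun _ => A.diff) i)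
      (fun j' => if j' < j then A.tEps (n j') 1 else LinearMap.id)
    refine Eq.trans ?_ this
    rw [PiTensorProduct.mapMultilinear_apply, koszulSlot]
    congr 1
    funext j'
    by_cases h : j' = j
    · subst h
      simp [tDiff_eq]
    · simp [h]
  rw [linearMap_sum_comp, h1, linearMap_comp_sum]
  refine Finset.sum_congr rfl fun i _ => ?_
  rw [koszulSlot, map_comp_flatten]
  congr 2
  funext j'
  rcases lt_trichotomy j' j with h | h | h
  · rw [Function.update_of_ne h.ne, if_pos h, tEps]
    congr 1
    funext i'
    rw [if_pos (finSigmaFinEquiv_lt_of_lt h i' i)]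
  · subst h
    rw [Function.update_self, koszulSlot]
    congr 1
    funext i'
    have : (finSigmaFinEquiv ⟨j', i'⟩ = finSigmaFinEquiv (⟨j', i⟩ : (j : Fin k) × Fin (n j))) ↔
        i' = i := by simp
    simp only [finSigmaFinEquiv_lt_iff, this]
    simp
  · rw [Function.update_of_ne h.ne', if_neg h.not_gt, ← PiTensorProduct.map_id]
    congr 1
    funext i'
    have h2 := finSigmaFinEquiv_lt_of_lt h i i'
    rw [if_neg h2.not_gt, if_neg h2.ne']

/-- Every tensor in `A^{⊗ (n₁ + ⋯ + n_k)}` comes from `A^{⊗ n₁} ⊗ ⋯ ⊗ A^{⊗ n_k}`. -/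
theorem hom_ext_flatten {k : ℕ} (n : Fin k → ℕ) {N : Type w} [AddCommMonoid N] [Module R N]
    {f g : A.TPow (∑ j, n j) →ₗ[R] N} (h : f ∘ₗ flatten A n = g ∘ₗ flatten A n) : f = g := by
  refine PiTensorProduct.ext (MultilinearMap.ext fun y => ?_)
  rw [LinearMap.compMultilinearMap_apply, LinearMap.compMultilinearMap_apply, ← flatten_tprod]
  exact LinearMap.congr_fun h _

end DGMod

/-- Tensor powers embed in the tensor algebra. Comparing tensors there avoids transports between
tensor powers whose exponents are equal but not definitionally so. -/
theorem toTensorAlgebra_injective (D : DGMod.{u, v} R) (n : ℕ) :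
    Function.Injective (TensorPower.toTensorAlgebra (R := R) (M := D.Tot) (n := n)) := by
  -- a left inverse: decompose the tensor algebra into tensor powers and project to the `n`-th one
  have h : ∀ y : D.TPow n, DirectSum.component R ℕ (fun m => ⨂[R]^m D.Tot) n
      (TensorAlgebra.toDirectSum (TensorPower.toTensorAlgebra y)) = y := fun y => by
    have : (DirectSum.component R ℕ (fun m => ⨂[R]^m D.Tot) n ∘ₗ
        TensorAlgebra.toDirectSum.toLinearMap ∘ₗ TensorPower.toTensorAlgebra) =
        (LinearMap.id : D.TPow n →ₗ[R] D.TPow n) := by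
      refine PiTensorProduct.ext (MultilinearMap.ext fun x => ?_)
      change DirectSum.component R ℕ (fun m => ⨂[R]^m D.Tot) n
        (TensorAlgebra.toDirectSum (TensorPower.toTensorAlgebra (PiTensorProduct.tprod R x))) = _
      rw [TensorPower.toTensorAlgebra_tprod, TensorAlgebra.toDirectSum_tensorPower_tprod]
      exact DirectSum.component.lof_self _ _ _
    exact LinearMap.congr_fun this y
  intro x y hxy
  rw [← h x, ← h y, hxy]

/-- In the tensor algebra, the identification of an iterated tensor power is the product. -/
theorem toTensorAlgebra_flatten (D : DGMod.{u, v} R) {k : ℕ} (n : Fin k → ℕ)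
    (T : ∀ j, D.TPow (n j)) :
    TensorPower.toTensorAlgebra (flatten D n (PiTensorProduct.tprod R T)) =
      (List.ofFn fun j => TensorPower.toTensorAlgebra (T j)).prod := by
  have h : TensorPower.toTensorAlgebra ∘ₗ flatten D n =
      PiTensorProduct.lift
        ((MultilinearMap.mkPiAlgebraFin R k (TensorAlgebra R D.Tot)).compLinearMap fun j =>
          TensorPower.toTensorAlgebra (n := n j)) := by
    refine D.nested_hom_ext n fun y => ?_
    rw [LinearMap.comp_apply, flatten_tprod, PiTensorProduct.lift.tprod,
      MultilinearMap.compLinearMap_apply, MultilinearMap.mkPiAlgebraFin_apply]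
    simp only [TensorPower.toTensorAlgebra_tprod, TensorAlgebra.tprod_apply]
    rw [ofFn_sigma n (fun i => TensorAlgebra.ι R (y i)), List.prod_flatten, List.map_ofFn]
    rfl
  have := LinearMap.congr_fun h (PiTensorProduct.tprod R T)
  rw [PiTensorProduct.lift.tprod, MultilinearMap.compLinearMap_apply,
    MultilinearMap.mkPiAlgebraFin_apply] at this
  exact this

theorem prod_ofFn_finSigmaFinEquiv {M : Type*} [Monoid M] {k : ℕ} (n : Fin k → ℕ)
    (x : Fin (∑ j, n j) → M) :
    (List.ofFn x).prod =
      (List.ofFn fun j => (List.ofFn fun i => x (finSigmaFinEquiv ⟨j, i⟩)).prod).prod := by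
  rw [ofFn_sigma, List.prod_flatten, List.map_ofFn]
  rfl

/-- Associativity of the canonical maps between tensor powers. -/
theorem flatten_assoc (D : DGMod.{u, v₁} R) (E : DGMod.{u, v₂} R) {k : ℕ} (n : Fin k → ℕ)
    (N : Fin (∑ j, n j) → ℕ) (H : ∀ p, D.Tot →ₗ[R] E.TPow (N p)) (y : ⨂[R] j, D.TPow (n j)) :
    TensorPower.toTensorAlgebra (flatten E N (PiTensorProduct.map H (flatten D n y))) =
      TensorPower.toTensorAlgebra (flatten E (fun j => ∑ i, N (finSigmaFinEquiv ⟨j, i⟩))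
        (PiTensorProduct.map (fun j => flatten E (fun i => N (finSigmaFinEquiv ⟨j, i⟩)) ∘ₗ
          PiTensorProduct.map fun i => H (finSigmaFinEquiv ⟨j, i⟩)) y)) := by
  have : TensorPower.toTensorAlgebra ∘ₗ flatten E N ∘ₗ PiTensorProduct.map H ∘ₗ flatten D n =
      TensorPower.toTensorAlgebra ∘ₗ flatten E (fun j => ∑ i, N (finSigmaFinEquiv ⟨j, i⟩)) ∘ₗ
        PiTensorProduct.map (fun j => flatten E (fun i => N (finSigmaFinEquiv ⟨j, i⟩)) ∘ₗ
          PiTensorProduct.map fun i => H (finSigmaFinEquiv ⟨j, i⟩)) := by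
    refine D.nested_hom_ext n fun y => ?_
    simp only [LinearMap.comp_apply]
    rw [flatten_tprod, PiTensorProduct.map_tprod, PiTensorProduct.map_tprod,
      toTensorAlgebra_flatten, toTensorAlgebra_flatten, prod_ofFn_finSigmaFinEquiv]
    simp only [LinearMap.comp_apply, PiTensorProduct.map_tprod, toTensorAlgebra_flatten]
  exact LinearMap.congr_fun this y

/-! ### Parity of homogeneous maps -/

/-- A map of degree `d` commutes with the parity operators up to `(-1)^{k d}`. This is the only way
in which homogeneity enters the interchange law and the Leibniz rule. -/
theorem homSub_parity {C : DGMod.{u, v₁} R} {A : DGMod.{u, v₂} R} {d : ℤ} (f : homSub C A d) :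
    HasParity C.eps A.eps d f.1 := by
  refine fun k => C.tot_hom_ext fun i x => ?_
  obtain ⟨y, hy⟩ := f.2 i x
  rw [LinearMap.comp_apply, DGMod.eps_ι, map_smul, LinearMap.smul_apply, LinearMap.comp_apply, ← hy,
    DGMod.eps_ι, smul_smul, mul_add, ksign_add, mul_left_comm, ksign_mul_self, mul_one]

theorem comulSub_parity {C : DGMod.{u, v₁} R} {D : DGMod.{u, v₂} R} {n : ℕ} {d : ℤ}
    (f : comulSub C D n d) : HasParity C.eps (D.tEps n) d f.1 := by
  refine fun k => C.tot_hom_ext fun i x => ?_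
  rw [LinearMap.comp_apply, DGMod.eps_ι, map_smul, LinearMap.smul_apply, LinearMap.comp_apply,
    D.tEps_of_mem k (f.2 i x), smul_smul, mul_add, ksign_add, mul_left_comm, ksign_mul_self,
    mul_one]

theorem mulSub_parity {A : DGMod.{u, v₁} R} {B : DGMod.{u, v₂} R} {n : ℕ} {d : ℤ}
    (f : mulSub A B n d) : HasParity (A.tEps n) B.eps d (PiTensorProduct.lift f.1) := by
  refine fun k => PiTensorProduct.ext (A.multilinear_ext fun e x => ?_)
  obtain ⟨y, hy⟩ := f.2 e x
  rw [LinearMap.compMultilinearMap_apply, LinearMap.compMultilinearMap_apply, LinearMap.comp_apply,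
    LinearMap.smul_apply, LinearMap.comp_apply,
    A.tEps_of_mem k (A.tprod_mem e _ (fun i => A.ι_mem _ _) rfl), map_smul,
    PiTensorProduct.lift.tprod, ← hy, DGMod.eps_ι, smul_smul, ← ksign_add]
  congr 1
  exact ksign_congr R (-(k * d)) (by ring)

theorem mulSub_apply_eps {A : DGMod.{u, v₁} R} {B : DGMod.{u, v₂} R} {n : ℕ} {d : ℤ}
    (f : mulSub A B n d) (k : ℤ) (x : Fin n → A.Tot) :
    B.eps k (f.1 x) = ksign R (k * d) • f.1 fun i => A.eps k (x i) := by
  have := LinearMap.congr_fun (mulSub_parity f k) (PiTensorProduct.tprod R x)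
  rw [LinearMap.comp_apply, LinearMap.smul_apply, LinearMap.comp_apply, DGMod.tEps,
    PiTensorProduct.map_tprod, PiTensorProduct.lift.tprod, PiTensorProduct.lift.tprod] at this
  rw [this, smul_smul, ksign_mul_self, one_smul]

end TensorPowers

/-! ### Composition laws for families indexed by arity and degree -/

section Calculus

/-- Transport along an equality of degrees. -/
def degCast {Y : ℤ → Type v} {d d' : ℤ} (h : d = d') (x : Y d) : Y d' := h ▸ x

/-- Transport along equalities of arities and degrees. -/
def famCast {X : ℕ → ℤ → Type v} {n n' : ℕ} {d d' : ℤ} (hn : n = n') (hd : d = d') (x : X n d) :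
    X n' d' := hn ▸ hd ▸ x

/-- The family `g` with its `j`-th member replaced by `z`, whose degree is one less. -/
def slotFam {k : ℕ} {Y : Fin k → ℤ → Type v} {e : Fin k → ℤ} (g : ∀ j, Y j (e j)) (j : Fin k)
    (z : Y j (e j - 1)) (i : Fin k) : Y i (e i - if i = j then 1 else 0) :=
  if h : i = j then degCast (by rw [if_pos h]) (h.symm ▸ z : Y i (e i - 1))
  else degCast (by rw [if_neg h, sub_zero]) (g i)

theorem slotFam_self {k : ℕ} {Y : Fin k → ℤ → Type v} {e : Fin k → ℤ} (g : ∀ j, Y j (e j))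
    (j : Fin k) (z : Y j (e j - 1)) :
    slotFam g j z j = degCast (by rw [if_pos rfl]) z := by
  simp [slotFam]

theorem slotFam_of_ne {k : ℕ} {Y : Fin k → ℤ → Type v} {e : Fin k → ℤ} (g : ∀ j, Y j (e j))
    {j i : Fin k} (h : i ≠ j) (z : Y j (e j - 1)) :
    slotFam g j z i = degCast (by rw [if_neg h, sub_zero]) (g i) := by
  simp [slotFam, h]

theorem sum_sub_ite_eq {k : ℕ} (a : ℤ) (e : Fin k → ℤ) (j : Fin k) :
    a + ∑ i, (e i - if i = j then 1 else 0) = a + ∑ i, e i - 1 := by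
  rw [Finset.sum_sub_distrib]
  simp
  ring

/-- A total composition `c(x; y₁, …, y_k)`, adding arities and degrees. -/
abbrev TotalComp (X : ℕ → ℤ → Type v₁) (Y : ℕ → ℤ → Type v₂) (Z : ℕ → ℤ → Type v₃) :=
  ∀ {k : ℕ} {a : ℤ} {n : Fin k → ℕ} {e : Fin k → ℤ},
    X k a → (∀ j, Y (n j) (e j)) → Z (∑ j, n j) (a + ∑ j, e j)

variable (R : Type u) [CommRing R]

/-- Linearity of a total composition in each of its arguments. -/
structure IsMultilinearComp {X : ℕ → ℤ → Type v₁} {Y : ℕ → ℤ → Type v₂} {Z : ℕ → ℤ → Type v₃}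
    [∀ n d, AddCommGroup (X n d)] [∀ n d, Module R (X n d)] [∀ n d, AddCommGroup (Y n d)]
    [∀ n d, Module R (Y n d)] [∀ n d, AddCommGroup (Z n d)] [∀ n d, Module R (Z n d)]
    (c : TotalComp X Y Z) : Prop where
  add_left : ∀ {k : ℕ} {a : ℤ} {n : Fin k → ℕ} {e : Fin k → ℤ} (f f' : X k a)
    (g : ∀ j, Y (n j) (e j)), c (f + f') g = c f g + c f' g
  smul_left : ∀ {k : ℕ} {a : ℤ} {n : Fin k → ℕ} {e : Fin k → ℤ} (r : R) (f : X k a)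
    (g : ∀ j, Y (n j) (e j)), c (r • f) g = r • c f g
  update_add : ∀ {k : ℕ} {a : ℤ} {n : Fin k → ℕ} {e : Fin k → ℤ} (f : X k a)
    (g : ∀ j, Y (n j) (e j)) (j : Fin k) (x y : Y (n j) (e j)),
    c f (Function.update g j (x + y)) = c f (Function.update g j x) + c f (Function.update g j y)
  update_smul : ∀ {k : ℕ} {a : ℤ} {n : Fin k → ℕ} {e : Fin k → ℤ} (f : X k a)
    (g : ∀ j, Y (n j) (e j)) (j : Fin k) (r : R) (x : Y (n j) (e j)),
    c f (Function.update g j (r • x)) = r • c f (Function.update g j x)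

/-- The associativity `(f ∘ g) ∘ h = ± f ∘ (g ∘ h)` of total compositions, with the Koszul sign. -/
def IsAssocComp {X : ℕ → ℤ → Type v₁} {Y : ℕ → ℤ → Type v₂} {Z : ℕ → ℤ → Type v₃}
    {U : ℕ → ℤ → Type w₁} {V : ℕ → ℤ → Type w₂} {W : ℕ → ℤ → Type w₃}
    [∀ n d, AddCommGroup (W n d)] [∀ n d, Module R (W n d)]
    (c₁ : TotalComp X Y U) (c₂ : TotalComp U Z W) (c₃ : TotalComp Y Z V)
    (c₄ : TotalComp X V W) : Prop :=
  ∀ {k : ℕ} {a : ℤ} {n : Fin k → ℕ} {e : Fin k → ℤ} {N : Fin (∑ j, n j) → ℕ}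
    {e' : Fin (∑ j, n j) → ℤ} (f : X k a) (g : ∀ j, Y (n j) (e j)) (h : ∀ p, Z (N p) (e' p)),
    c₂ (c₁ f g) h = ksign R (shuffleExp e fun j => ∑ i, e' (finSigmaFinEquiv ⟨j, i⟩)) •
      famCast (X := W) (sum_finSigmaFinEquiv N).symm
        (by rw [Finset.sum_add_distrib, sum_finSigmaFinEquiv e', add_assoc])
        (c₄ f fun j => c₃ (g j) fun i => h (finSigmaFinEquiv ⟨j, i⟩))

/-- The Leibniz rule for a total composition. -/
def IsLeibnizComp {X : ℕ → ℤ → Type v₁} {Y : ℕ → ℤ → Type v₂} {Z : ℕ → ℤ → Type v₃}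
    [∀ n d, AddCommGroup (X n d)] [∀ n d, Module R (X n d)] [∀ n d, AddCommGroup (Y n d)]
    [∀ n d, Module R (Y n d)] [∀ n d, AddCommGroup (Z n d)] [∀ n d, Module R (Z n d)]
    (c : TotalComp X Y Z) (dX : ∀ {n : ℕ} {a : ℤ}, X n a →ₗ[R] X n (a - 1))
    (dY : ∀ {n : ℕ} {a : ℤ}, Y n a →ₗ[R] Y n (a - 1))
    (dZ : ∀ {n : ℕ} {a : ℤ}, Z n a →ₗ[R] Z n (a - 1)) : Prop :=
  ∀ {k : ℕ} {a : ℤ} {n : Fin k → ℕ} {e : Fin k → ℤ} (f : X k a) (g : ∀ j, Y (n j) (e j)),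
    dZ (c f g) = degCast (Y := Z (∑ j, n j)) (sub_add_eq_add_sub _ _ _) (c (dX f) g) +
      ∑ j, ksign R (a + ∑ i ∈ Finset.Iio j, e i) •
        degCast (Y := Z (∑ j, n j)) (sum_sub_ite_eq a e j)
          (c f (slotFam (Y := fun j => Y (n j)) g j (dY (g j))))

/-- The product of two total degrees splits into the pairs on either side of the diagonal and the
diagonal terms. -/
theorem shuffleExp_add_comm {k : ℕ} (a b : Fin k → ℤ) :
    (∑ j, a j) * ∑ j, b j = shuffleExp a b + shuffleExp b a + ∑ j, a j * b j := by
  have h1 : shuffleExp b a = ∑ j, ∑ i ∈ Finset.Iio j, a i * b j := by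
    unfold shuffleExp
    rw [Finset.sum_comm' (t' := Finset.univ) (s' := fun i => Finset.Iio i) (by simp)]
  rw [h1, shuffleExp, Finset.mul_sum, ← Finset.sum_add_distrib, ← Finset.sum_add_distrib]
  refine Finset.sum_congr rfl fun j _ => ?_
  rw [sum_univ_eq_Iio_add_Ioi a j, add_mul, add_mul, Finset.sum_mul, Finset.sum_mul]
  simp only [mul_comm (b j)]
  ring

theorem shuffleExp_add_left {k : ℕ} (a a' b : Fin k → ℤ) :
    shuffleExp (fun j => a j + a' j) b = shuffleExp a b + shuffleExp a' b := by
  simp only [shuffleExp, mul_add, Finset.sum_add_distrib]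

end Calculus

/-! ### The compositions of multilinear maps -/

section MulSub

variable {R : Type u} [CommRing R]

@[simp] theorem mulSub_degCast {A : DGMod.{u, v₁} R} {B : DGMod.{u, v₂} R} {n : ℕ} {d d' : ℤ}
    (h : d = d') (f : mulSub A B n d) :
    (degCast (Y := fun d => mulSub A B n d) h f).1 = f.1 := by
  subst h; rfl

theorem mulSub_famCast {A : DGMod.{u, v₁} R} {B : DGMod.{u, v₂} R} {n n' : ℕ} {d d' : ℤ}
    (hn : n = n') (hd : d = d') (f : mulSub A B n d) (x : Fin n' → A.Tot) :
    (famCast (X := fun n d => mulSub A B n d) hn hd f).1 x = f.1 fun i => x (Fin.cast hn i) := by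
  subst hn hd; rfl

theorem koszulMap_congr {k : ℕ} {V : Fin k → Type v₁} {W : Fin k → Type v₂}
    [∀ j, AddCommMonoid (V j)]
    [∀ j, Module R (V j)] [∀ j, AddCommMonoid (W j)] [∀ j, Module R (W j)]
    (ε : ∀ j, ℤ → V j →ₗ[R] V j) {e e' : Fin k → ℤ} {F G : ∀ j, V j →ₗ[R] W j}
    (he : ∀ j, e j = e' j) (h : ∀ j, F j = G j) : koszulMap ε e F = koszulMap ε e' G := by
  rw [funext h, funext he]

theorem koszulMap_smul {k : ℕ} {V : Fin k → Type v₁} {W : Fin k → Type v₂}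
    [∀ j, AddCommMonoid (V j)]
    [∀ j, Module R (V j)] [∀ j, AddCommMonoid (W j)] [∀ j, Module R (W j)]
    (ε : ∀ j, ℤ → V j →ₗ[R] V j) (e : Fin k → ℤ) (c : Fin k → R) (F : ∀ j, V j →ₗ[R] W j) :
    koszulMap ε e (fun j => c j • F j) = (∏ j, c j) • koszulMap ε e F := by
  rw [koszulMap, koszulMap, ← piTensor_map_smul]
  rfl

theorem koszulMap_update {k : ℕ} {V : Fin k → Type v₁} {W : Fin k → Type v₂}
    [∀ j, AddCommMonoid (V j)]
    [∀ j, Module R (V j)] [∀ j, AddCommMonoid (W j)] [∀ j, Module R (W j)]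
    (ε : ∀ j, ℤ → V j →ₗ[R] V j) (e : Fin k → ℤ) (F : ∀ j, V j →ₗ[R] W j) (j : Fin k)
    (x : V j →ₗ[R] W j) :
    koszulMap ε e (Function.update F j x) = PiTensorProduct.map (Function.update
      (fun j => F j ∘ₗ ε j (∑ i ∈ Finset.Ioi j, e i)) j (x ∘ₗ ε j (∑ i ∈ Finset.Ioi j, e i))) := by
  rw [koszulMap]
  congr 1
  funext i
  exact Function.apply_update
    (fun i (w : V i →ₗ[R] W i) => w ∘ₗ ε i (∑ l ∈ Finset.Ioi i, e l)) F j x i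

theorem koszulMap_update_add {k : ℕ} {V : Fin k → Type v₁} {W : Fin k → Type v₂}
    [∀ j, AddCommMonoid (V j)]
    [∀ j, Module R (V j)] [∀ j, AddCommMonoid (W j)] [∀ j, Module R (W j)]
    (ε : ∀ j, ℤ → V j →ₗ[R] V j) (e : Fin k → ℤ) (F : ∀ j, V j →ₗ[R] W j) (j : Fin k)
    (x y : V j →ₗ[R] W j) : koszulMap ε e (Function.update F j (x + y)) =
      koszulMap ε e (Function.update F j x) + koszulMap ε e (Function.update F j y) := by
  simp only [koszulMap_update, LinearMap.add_comp, PiTensorProduct.map_update_add]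

theorem koszulMap_update_smul {k : ℕ} {V : Fin k → Type v₁} {W : Fin k → Type v₂}
    [∀ j, AddCommMonoid (V j)]
    [∀ j, Module R (V j)] [∀ j, AddCommMonoid (W j)] [∀ j, Module R (W j)]
    (ε : ∀ j, ℤ → V j →ₗ[R] V j) (e : Fin k → ℤ) (F : ∀ j, V j →ₗ[R] W j) (j : Fin k)
    (r : R) (x : V j →ₗ[R] W j) : koszulMap ε e (Function.update F j (r • x)) =
      r • koszulMap ε e (Function.update F j x) := by
  simp only [koszulMap_update, LinearMap.smul_comp, PiTensorProduct.map_update_smul]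

/-- The Koszul tensor product of maps is associative: grouping the factors in blocks introduces no
sign. -/
theorem koszulMap_comp_flatten (A : DGMod.{u, v₁} R) (B : DGMod.{u, v₂} R) {k : ℕ} (n : Fin k → ℕ)
    (c : Fin (∑ j, n j) → ℤ) (H : Fin (∑ j, n j) → (A.Tot →ₗ[R] B.Tot)) :
    koszulMap (fun _ => A.eps) c H ∘ₗ flatten A n = flatten B n ∘ₗ
      koszulMap (fun j => A.tEps (n j)) (fun j => ∑ i, c (finSigmaFinEquiv ⟨j, i⟩)) fun j =>
        koszulMap (fun _ => A.eps) (fun i => c (finSigmaFinEquiv ⟨j, i⟩))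
          fun i => H (finSigmaFinEquiv ⟨j, i⟩) := by
  rw [koszulMap, A.map_comp_flatten B, koszulMap]
  congr 2
  funext j
  rw [koszulMap, DGMod.tEps, ← PiTensorProduct.map_comp]
  congr 1
  funext i
  rw [sum_Ioi_finSigmaFinEquiv, DGMod.eps_add, LinearMap.comp_assoc]

/-- A Koszul tensor product of homogeneous maps has the sum of their degrees. -/
theorem koszulMap_parity {A : DGMod.{u, v₁} R} {B : DGMod.{u, v₂} R} {n : ℕ} {c : Fin n → ℤ}
    (h : ∀ i, homSub A B (c i)) :
    HasParity (A.tEps n) (B.tEps n) (∑ i, c i)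
      (koszulMap (fun _ => A.eps) c fun i => (h i).1) := by
  intro k
  rw [koszulMap, DGMod.tEps, DGMod.tEps, ← PiTensorProduct.map_comp, ← PiTensorProduct.map_comp,
    Finset.mul_sum, ksign_sum, ← piTensor_map_smul]
  congr 1
  funext i
  rw [LinearMap.comp_assoc, ← DGMod.eps_add, add_comm, DGMod.eps_add, ← LinearMap.comp_assoc,
    homSub_parity (h i) k, LinearMap.smul_comp, LinearMap.comp_assoc]

/-- On tensor powers, `mulComp f g` is `f ∘ (g₁ ⊗ ⋯ ⊗ g_k)`; this reduces statements about it to the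
calculus of Koszul tensor products. -/
theorem lift_mulComp {A : DGMod.{u, v₁} R} {B : DGMod.{u, v₂} R} {D : DGMod.{u, v₃} R} {k : ℕ}
    {a : ℤ} {n : Fin k → ℕ} {e : Fin k → ℤ} (f : mulSub B D k a)
    (g : ∀ j, mulSub A B (n j) (e j)) :
    PiTensorProduct.lift (mulComp f g).1 ∘ₗ flatten A n =
      PiTensorProduct.lift f.1 ∘ₗ
        koszulMap (fun j => A.tEps (n j)) e fun j => PiTensorProduct.lift (g j).1 := by
  refine A.nested_hom_ext n fun y => ?_
  rw [LinearMap.comp_apply, flatten_tprod, PiTensorProduct.lift.tprod, LinearMap.comp_apply,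
    koszulMap, PiTensorProduct.map_tprod, PiTensorProduct.lift.tprod]
  simp only [LinearMap.comp_apply, DGMod.tEps, PiTensorProduct.map_tprod,
    PiTensorProduct.lift.tprod]
  rfl

theorem lift_mulDiff {A : DGMod.{u, v₁} R} {B : DGMod.{u, v₂} R} {n : ℕ} {d : ℤ}
    (f : mulSub A B n d) : PiTensorProduct.lift (mulDiff f).1 =
      B.diff ∘ₗ PiTensorProduct.lift f.1 +
        (-ksign R d) • (PiTensorProduct.lift f.1 ∘ₗ A.tDiff n) := by
  refine PiTensorProduct.ext (MultilinearMap.ext fun x => ?_)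
  rw [LinearMap.compMultilinearMap_apply, PiTensorProduct.lift.tprod]
  change B.diff (f.1 x) - (ksign R d • ∑ i : Fin n,
    f.1.compLinearMap (A.slot (A.eps 1) A.diff i)) x = _
  rw [LinearMap.compMultilinearMap_apply, LinearMap.add_apply, LinearMap.smul_apply,
    LinearMap.comp_apply, LinearMap.comp_apply, PiTensorProduct.lift.tprod, DGMod.tDiff,
    LinearMap.sum_apply, map_sum, neg_smul, sub_eq_add_neg]
  simp [PiTensorProduct.map_tprod]

theorem mulComp_multilinear (A : DGMod.{u, v₁} R) (B : DGMod.{u, v₂} R) (D : DGMod.{u, v₃} R) :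
    IsMultilinearComp R (X := fun n d => mulSub B D n d) (Y := fun n d => mulSub A B n d)
      (Z := fun n d => mulSub A D n d) (fun f g => mulComp f g) where
  add_left _ _ _ := rfl
  smul_left _ _ _ := rfl
  update_add {k a n e} f g j x y := by
    apply Subtype.ext
    refine PiTensorProduct.lift.injective (A.hom_ext_flatten n ?_)
    have h : ∀ z, (fun i => PiTensorProduct.lift (Function.update g j z i).1) =
        Function.update (fun i => PiTensorProduct.lift (g i).1) j (PiTensorProduct.lift z.1) :=
      fun z => funext fun i =>
        Function.apply_update
          (fun i (w : mulSub A B (n i) (e i)) => PiTensorProduct.lift w.1) g j z i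
    rw [Submodule.coe_add, map_add, LinearMap.add_comp, lift_mulComp, lift_mulComp, lift_mulComp,
      h, h, h, Submodule.coe_add, map_add, koszulMap_update_add, LinearMap.comp_add]
  update_smul {k a n e} f g j r x := by
    apply Subtype.ext
    refine PiTensorProduct.lift.injective (A.hom_ext_flatten n ?_)
    have h : ∀ z, (fun i => PiTensorProduct.lift (Function.update g j z i).1) =
        Function.update (fun i => PiTensorProduct.lift (g i).1) j (PiTensorProduct.lift z.1) :=
      fun z => funext fun i =>
        Function.apply_update
          (fun i (w : mulSub A B (n i) (e i)) => PiTensorProduct.lift w.1) g j z i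
    rw [Submodule.coe_smul, map_smul, LinearMap.smul_comp, lift_mulComp, lift_mulComp,
      h, h, Submodule.coe_smul, map_smul, koszulMap_update_smul, LinearMap.comp_smul]

theorem finSigmaFinEquiv_val {k : ℕ} {n : Fin k → ℕ} (j : Fin k) (i : Fin (n j)) :
    (finSigmaFinEquiv (⟨j, i⟩ : (j : Fin k) × Fin (n j)) : ℕ) =
      ∑ j' ∈ Finset.Iio j, n j' + i := by
  rw [finSigmaFinEquiv_apply]
  congr 1
  refine Finset.sum_bij (fun x _ => Fin.castLE j.2.le x) (fun x _ => ?_) (fun x _ y _ h => ?_)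
    (fun y hy => ⟨⟨y, Fin.lt_def.1 (Finset.mem_Iio.1 hy)⟩, Finset.mem_univ _, rfl⟩) fun _ _ => rfl
  · rw [Finset.mem_Iio, Fin.lt_def]
    exact x.2
  · simpa using h

theorem sum_Iio_finSigmaFinEquiv {k : ℕ} {n : Fin k → ℕ}
    (F : Fin (∑ j, n j) → ℕ) (j : Fin k) (i : Fin (n j)) :
    ∑ q ∈ Finset.Iio (finSigmaFinEquiv ⟨j, i⟩), F q =
      ∑ j' ∈ Finset.Iio j, ∑ i', F (finSigmaFinEquiv ⟨j', i'⟩) +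
        ∑ i' ∈ Finset.Iio i, F (finSigmaFinEquiv ⟨j, i'⟩) := by
  have h1 := sum_univ_eq_Iio_add_Ioi F (finSigmaFinEquiv ⟨j, i⟩)
  have h2 := sum_univ_eq_Iio_add_Ioi (fun j' => ∑ i', F (finSigmaFinEquiv ⟨j', i'⟩)) j
  have h3 := sum_univ_eq_Iio_add_Ioi (fun i' => F (finSigmaFinEquiv ⟨j, i'⟩)) i
  rw [sum_finSigmaFinEquiv, sum_Ioi_finSigmaFinEquiv] at h1
  omega

/-- Iterated positions: the two ways of numbering a nested family of blocks agree. -/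
theorem finSigmaFinEquiv_assoc {k : ℕ} {n : Fin k → ℕ} (N : Fin (∑ j, n j) → ℕ) (j : Fin k)
    (i : Fin (n j)) (l : Fin (N (finSigmaFinEquiv ⟨j, i⟩))) :
    Fin.cast (sum_finSigmaFinEquiv N) (finSigmaFinEquiv ⟨finSigmaFinEquiv ⟨j, i⟩, l⟩) =
      finSigmaFinEquiv (⟨j, finSigmaFinEquiv ⟨i, l⟩⟩ :
        (j : Fin k) × Fin (∑ i, N (finSigmaFinEquiv ⟨j, i⟩))) := by
  apply Fin.ext
  rw [Fin.val_cast, finSigmaFinEquiv_val, finSigmaFinEquiv_val, finSigmaFinEquiv_val,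
    sum_Iio_finSigmaFinEquiv, add_assoc]

/-- Associativity of `f ∘ (g₁ ⊗ ⋯ ⊗ g_k)`. The sign comes from moving the outer maps `g_{j'}`, with
`j' > j`, past the maps `h` in the block `j`. -/
theorem mulComp_assoc (A : DGMod.{u, v₁} R) (B : DGMod.{u, v₂} R) (D : DGMod.{u, v₃} R)
    (E : DGMod.{u, v₄} R) :
    IsAssocComp R (X := fun n d => mulSub D E n d) (Y := fun n d => mulSub B D n d)
      (Z := fun n d => mulSub A B n d) (U := fun n d => mulSub B E n d)
      (V := fun n d => mulSub A D n d) (W := fun n d => mulSub A E n d)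
      (fun f g => mulComp f g) (fun f g => mulComp f g) (fun f g => mulComp f g)
      (fun f g => mulComp f g) := by
  intro k a n e N e' f g h
  refine Subtype.ext (MultilinearMap.ext fun x => ?_)
  rw [Submodule.coe_smul, _root_.smul_apply, mulSub_famCast]
  change f.1 (fun j => (g j).1 fun i => B.eps (∑ j' ∈ Finset.Ioi j, e j')
      ((h (finSigmaFinEquiv ⟨j, i⟩)).1 fun l => A.eps
        (∑ q ∈ Finset.Ioi (finSigmaFinEquiv ⟨j, i⟩), e' q)
          (x (finSigmaFinEquiv ⟨finSigmaFinEquiv ⟨j, i⟩, l⟩)))) =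
    ksign R _ • f.1 (fun j => (g j).1 fun i => (h (finSigmaFinEquiv ⟨j, i⟩)).1 fun l =>
      A.eps (∑ i' ∈ Finset.Ioi i, e' (finSigmaFinEquiv ⟨j, i'⟩))
        (A.eps (∑ j' ∈ Finset.Ioi j, (e j' + ∑ i', e' (finSigmaFinEquiv ⟨j', i'⟩)))
          (x (Fin.cast (sum_finSigmaFinEquiv N).symm
            (finSigmaFinEquiv (⟨j, finSigmaFinEquiv ⟨i, l⟩⟩ :
              (j : Fin k) × Fin (∑ i, N (finSigmaFinEquiv ⟨j, i⟩))))))))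
  -- inside the block `j`, the parity operator of the maps `g j'` with `j' > j` moves from the
  -- outputs of the maps `h` to their inputs, at the price of the sign `(-1)^{|h| |g j'|}`
  have key : ∀ j, ((g j).1 fun i => B.eps (∑ j' ∈ Finset.Ioi j, e j')
      ((h (finSigmaFinEquiv ⟨j, i⟩)).1 fun l => A.eps
        (∑ q ∈ Finset.Ioi (finSigmaFinEquiv ⟨j, i⟩), e' q)
          (x (finSigmaFinEquiv ⟨finSigmaFinEquiv ⟨j, i⟩, l⟩)))) =
      ksign R (∑ j' ∈ Finset.Ioi j, (∑ i, e' (finSigmaFinEquiv ⟨j, i⟩)) * e j') •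
      ((g j).1 fun i => (h (finSigmaFinEquiv ⟨j, i⟩)).1 fun l =>
        A.eps (∑ i' ∈ Finset.Ioi i, e' (finSigmaFinEquiv ⟨j, i'⟩))
          (A.eps (∑ j' ∈ Finset.Ioi j, (e j' + ∑ i', e' (finSigmaFinEquiv ⟨j', i'⟩)))
            (x (Fin.cast (sum_finSigmaFinEquiv N).symm
              (finSigmaFinEquiv (⟨j, finSigmaFinEquiv ⟨i, l⟩⟩ :
                (j : Fin k) × Fin (∑ i, N (finSigmaFinEquiv ⟨j, i⟩)))))))) := fun j => by
    rw [← Finset.mul_sum, Finset.sum_mul, ksign_sum, ← MultilinearMap.map_smul_univ]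
    congr 1
    funext i
    rw [mulSub_apply_eps, mul_comm]
    congr 2
    funext l
    have hx : Fin.cast (sum_finSigmaFinEquiv N).symm
        (finSigmaFinEquiv (⟨j, finSigmaFinEquiv ⟨i, l⟩⟩ :
                (j : Fin k) × Fin (∑ i, N (finSigmaFinEquiv ⟨j, i⟩)))) =
        finSigmaFinEquiv ⟨finSigmaFinEquiv ⟨j, i⟩, l⟩ := by
      rw [← finSigmaFinEquiv_assoc]
      rfl
    rw [hx, ← LinearMap.comp_apply, ← LinearMap.comp_apply, ← DGMod.eps_add, ← DGMod.eps_add,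
      sum_Ioi_finSigmaFinEquiv, Finset.sum_add_distrib]
    congr 2
    ring
  simp only [key]
  rw [MultilinearMap.map_smul_univ, ← ksign_sum]
  rfl

/-- The Leibniz rule for `f ∘ (g₁ ⊗ ⋯ ⊗ g_k)`, from the Leibniz rule for `g₁ ⊗ ⋯ ⊗ g_k`. -/
theorem mulComp_leibniz (A : DGMod.{u, v₁} R) (B : DGMod.{u, v₂} R) (D : DGMod.{u, v₃} R) :
    IsLeibnizComp R (X := fun n d => mulSub B D n d) (Y := fun n d => mulSub A B n d)
      (Z := fun n d => mulSub A D n d) (fun f g => mulComp f g) mulDiff mulDiff mulDiff := by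
  intro k a n e f g
  have hL := koszulMap_leibniz (fun j => A.tEps (n j)) (fun j => A.tEps_add (n j))
    (fun j => A.tEps_add_self (n j)) (fun _ => B.eps) (fun j => A.tDiff (n j))
    (fun j => A.tDiff_comp_tEps (n j)) (fun _ => B.diff) e (fun j => PiTensorProduct.lift (g j).1)
    (fun j => mulSub_parity (g j))
    (fun i j => PiTensorProduct.lift
      (slotFam (Y := fun j d => mulSub A B (n j) d) g i (mulDiff (g i)) j).1)
    (fun i j h => by rw [slotFam_of_ne _ h, mulSub_degCast])
    (fun i => by rw [slotFam_self, mulSub_degCast, lift_mulDiff])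
  apply Subtype.ext
  refine PiTensorProduct.lift.injective (A.hom_ext_flatten n ?_)
  have h0 : PiTensorProduct.lift (mulDiff (mulComp f g)).1 ∘ₗ flatten A n =
      D.diff ∘ₗ (PiTensorProduct.lift f.1 ∘ₗ
        koszulMap (fun j => A.tEps (n j)) e fun j => PiTensorProduct.lift (g j).1) +
      (-ksign R (a + ∑ j, e j)) • ((PiTensorProduct.lift f.1 ∘ₗ
        koszulMap (fun j => A.tEps (n j)) e fun j => PiTensorProduct.lift (g j).1) ∘ₗ
        ∑ j, koszulSlot (fun j => A.tEps (n j) 1) (fun j => A.tDiff (n j)) j) := by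
    rw [← lift_mulComp, lift_mulDiff, LinearMap.add_comp, LinearMap.smul_comp,
      LinearMap.comp_assoc, LinearMap.comp_assoc, LinearMap.comp_assoc, A.tDiff_comp_flatten]
  dsimp only
  rw [h0, Submodule.coe_add, Submodule.coe_sum, map_add, map_sum,
    LinearMap.add_comp, linearMap_sum_comp, mulSub_degCast, lift_mulComp, lift_mulDiff]
  simp only [Submodule.coe_smul, map_smul, mulSub_degCast, LinearMap.smul_comp, lift_mulComp]
  -- the sum over the differentials of the `g j` is `f` applied to the right hand side of `hL`
  have hR : (∑ j, ksign R (a + ∑ i ∈ Finset.Iio j, e i) • (PiTensorProduct.lift f.1 ∘ₗ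
      koszulMap (fun j => A.tEps (n j)) (fun i => e i - if i = j then 1 else 0) fun i =>
        PiTensorProduct.lift
          (slotFam (Y := fun j d => mulSub A B (n j) d) g j (mulDiff (g j)) i).1)) =
      ksign R a • (PiTensorProduct.lift f.1 ∘ₗ ∑ i, ksign R (∑ j ∈ Finset.Iio i, e j) •
        koszulMap (fun j => A.tEps (n j)) (fun j => e j - if j = i then 1 else 0) fun j =>
          PiTensorProduct.lift
            (slotFam (Y := fun j d => mulSub A B (n j) d) g i (mulDiff (g i)) j).1) := by
    rw [linearMap_comp_sum, Finset.smul_sum]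
    refine Finset.sum_congr rfl fun i _ => ?_
    rw [LinearMap.comp_smul, smul_smul, ← ksign_add]
  refine Eq.trans ?_ (congrArg _ hR.symm)
  rw [← hL, ← DGMod.tDiff_eq]
  simp only [LinearMap.comp_add, LinearMap.add_comp, LinearMap.smul_comp, LinearMap.comp_smul,
    LinearMap.comp_assoc, smul_add, smul_smul, ksign_add]
  module

end MulSub

/-! ### Units -/

section Units

variable {R : Type u} [CommRing R]

/-- The identity, as a map with one input. -/
def mulOne (A : DGMod.{u, v} R) : mulSub A A 1 0 := (EndOp A).one

/-- The identity, as a map with one output. -/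
def comulOne (C : DGMod.{u, v} R) : comulSub C C 1 0 := (CoEndOp C).one

theorem comulOne_apply (C : DGMod.{u, v} R) (x : C.Tot) :
    (comulOne C).1 x = PiTensorProduct.tprod R fun _ => x :=
  PiTensorProduct.subsingletonEquiv_symm_apply' _ _

theorem mulComp_one_left {A : DGMod.{u, v₁} R} {B : DGMod.{u, v₂} R} {n : Fin 1 → ℕ}
    {e : Fin 1 → ℤ} (g : ∀ j, mulSub A B (n j) (e j)) :
    mulComp (mulOne B) g = famCast (X := fun n d => mulSub A B n d)
      (by rw [Fin.sum_univ_one]) (by rw [Fin.sum_univ_one, zero_add]) (g 0) := by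
  refine Subtype.ext (MultilinearMap.ext fun x => ?_)
  rw [mulSub_famCast]
  change (g 0).1 (fun i => A.eps (∑ j ∈ Finset.Ioi (0 : Fin 1), e j)
    (x (finSigmaFinEquiv ⟨0, i⟩))) = _
  congr 1
  funext i
  have h : (Finset.Ioi (0 : Fin 1)) = ∅ := rfl
  rw [h, Finset.sum_empty, DGMod.eps_zero, LinearMap.id_apply]
  congr 1
  apply Fin.ext
  rw [finSigmaFinEquiv_val]
  simp

theorem mulComp_one_right {A : DGMod.{u, v₁} R} {B : DGMod.{u, v₂} R} {k : ℕ} {a : ℤ}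
    (f : mulSub A B k a) :
    mulComp f (n := fun _ => 1) (e := fun _ => 0) (fun _ => (mulOne A)) =
      famCast (X := fun n d => mulSub A B n d) (by simp) (by simp) f := by
  refine Subtype.ext (MultilinearMap.ext fun x => ?_)
  rw [mulSub_famCast]
  change f.1 (fun j => A.eps (∑ j ∈ Finset.Ioi j, 0) (x (finSigmaFinEquiv ⟨j, 0⟩))) = _
  congr 1
  funext j
  rw [Finset.sum_const_zero, DGMod.eps_zero, LinearMap.id_apply]
  congr 1
  apply Fin.ext
  rw [finSigmaFinEquiv_val]
  simp

theorem mulDiff_one (A : DGMod.{u, v₁} R) : mulDiff (mulOne A) = 0 := by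
  refine Subtype.ext (PiTensorProduct.lift.injective ?_)
  rw [lift_mulDiff, Submodule.coe_zero, map_zero]
  refine PiTensorProduct.ext (MultilinearMap.ext fun x => ?_)
  change A.diff (PiTensorProduct.lift (mulOne A).1 (PiTensorProduct.tprod R x)) +
    (-ksign R 0) • PiTensorProduct.lift (mulOne A).1
      (A.tDiff 1 (PiTensorProduct.tprod R x)) = 0
  rw [DGMod.tDiff, Fin.sum_univ_one, PiTensorProduct.map_tprod, PiTensorProduct.lift.tprod,
    PiTensorProduct.lift.tprod]
  change A.diff (x 0) + (-ksign R 0) • A.diff (x 0) = 0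
  simp

/-- Transport along an equality of arities is invisible in the tensor algebra. -/
theorem comulSub_famCast {C : DGMod.{u, v₁} R} {D : DGMod.{u, v₂} R} {n n' : ℕ} {d d' : ℤ}
    (hn : n = n') (hd : d = d') (f : comulSub C D n d) (x : C.Tot) :
    TensorPower.toTensorAlgebra ((famCast (X := fun n d => comulSub C D n d) hn hd f).1 x) =
      TensorPower.toTensorAlgebra (f.1 x) := by
  subst hn hd; rfl

@[simp] theorem comulSub_degCast {C : DGMod.{u, v₁} R} {D : DGMod.{u, v₂} R} {n : ℕ} {d d' : ℤ}
    (h : d = d') (f : comulSub C D n d) :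
    (degCast (Y := fun d => comulSub C D n d) h f).1 = f.1 := by
  subst h; rfl

theorem comulSub_ext {C : DGMod.{u, v₁} R} {D : DGMod.{u, v₂} R} {n : ℕ} {d : ℤ}
    {f g : comulSub C D n d} (h : ∀ x, TensorPower.toTensorAlgebra (f.1 x) =
      TensorPower.toTensorAlgebra (g.1 x)) : f = g :=
  Subtype.ext (LinearMap.ext fun x => toTensorAlgebra_injective D n (h x))

theorem comulComp_val {C : DGMod.{u, v₁} R} {D : DGMod.{u, v₂} R} {E : DGMod.{u, v₃} R} {k : ℕ}
    {a : ℤ} {n : Fin k → ℕ} {e : Fin k → ℤ} (f : comulSub C D k a)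
    (g : ∀ j, comulSub D E (n j) (e j)) :
    (comulComp f g).1 = ksign R (a * ∑ j, e j) •
      (flatten E n ∘ₗ koszulMap (fun _ => D.eps) e (fun j => (g j).1) ∘ₗ f.1) := rfl

theorem comulComp_one_left {C : DGMod.{u, v₁} R} {D : DGMod.{u, v₂} R} {n : Fin 1 → ℕ}
    {e : Fin 1 → ℤ} (g : ∀ j, comulSub C D (n j) (e j)) :
    comulComp (comulOne C) g = famCast (X := fun n d => comulSub C D n d)
      (by rw [Fin.sum_univ_one]) (by rw [Fin.sum_univ_one, zero_add]) (g 0) := by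
  refine comulSub_ext fun x => ?_
  rw [comulSub_famCast, comulComp_val, zero_mul, ksign_zero, one_smul, LinearMap.comp_apply,
    LinearMap.comp_apply, comulOne_apply, koszulMap, PiTensorProduct.map_tprod,
    toTensorAlgebra_flatten]
  simp [DGMod.eps_zero]

theorem comulComp_one_right {C : DGMod.{u, v₁} R} {D : DGMod.{u, v₂} R} {k : ℕ} {a : ℤ}
    (f : comulSub C D k a) :
    comulComp f (n := fun _ => 1) (e := fun _ => 0) (fun _ => (comulOne D)) =
      famCast (X := fun n d => comulSub C D n d) (by simp) (by simp) f := by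
  refine comulSub_ext fun x => ?_
  have key : TensorPower.toTensorAlgebra ∘ₗ flatten D (fun _ => 1) ∘ₗ
      koszulMap (fun _ : Fin k => D.eps) (fun _ => 0) (fun _ => (comulOne D).1) =
      TensorPower.toTensorAlgebra := by
    refine PiTensorProduct.ext (MultilinearMap.ext fun y => ?_)
    simp only [LinearMap.compMultilinearMap_apply, LinearMap.comp_apply, koszulMap,
      PiTensorProduct.map_tprod, toTensorAlgebra_flatten, TensorPower.toTensorAlgebra_tprod,
      TensorAlgebra.tprod_apply]
    congr 2
    funext j
    rw [comulOne_apply]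
    simp [DGMod.eps_zero, TensorPower.toTensorAlgebra_tprod]
  rw [comulSub_famCast, comulComp_val, Finset.sum_const_zero, mul_zero, ksign_zero, one_smul]
  exact LinearMap.congr_fun key (f.1 x)

theorem comulDiff_val {C : DGMod.{u, v₁} R} {D : DGMod.{u, v₂} R} {n : ℕ} {d : ℤ}
    (f : comulSub C D n d) :
    (comulDiff f).1 = D.tDiff n ∘ₗ f.1 + (-ksign R d) • (f.1 ∘ₗ C.diff) := rfl

theorem comulDiff_one (C : DGMod.{u, v₁} R) : comulDiff (comulOne C) = 0 := by
  refine Subtype.ext (LinearMap.ext fun x => ?_)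
  rw [comulDiff_val]
  change C.tDiff 1 ((comulOne C).1 x) + (-ksign R 0) • (comulOne C).1 (C.diff x) = 0
  rw [comulOne_apply, comulOne_apply, DGMod.tDiff, Fin.sum_univ_one, PiTensorProduct.map_tprod]
  have h2 : ∀ j : Fin 1, C.slot (C.eps 1) C.diff 0 j = C.diff := fun j => by
    rw [Subsingleton.elim j 0]; rfl
  simp only [h2, ksign_zero]
  exact (congrArg _ (neg_one_smul R (PiTensorProduct.tprod R fun _ : Fin 1 => C.diff x))).trans
    (add_neg_cancel _)

end Units

/-! ### The compositions of maps into tensor powers -/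

section ComulSub

variable {R : Type u} [CommRing R]

theorem comulComp_multilinear (C : DGMod.{u, v₁} R) (D : DGMod.{u, v₂} R) (E : DGMod.{u, v₃} R) :
    IsMultilinearComp R (X := fun n d => comulSub C D n d) (Y := fun n d => comulSub D E n d)
      (Z := fun n d => comulSub C E n d) (fun f g => comulComp f g) where
  add_left f f' g := by
    apply Subtype.ext
    rw [Submodule.coe_add, comulComp_val, comulComp_val, comulComp_val, Submodule.coe_add,
      LinearMap.comp_add, LinearMap.comp_add, smul_add]
  smul_left r f g := by
    apply Subtype.ext
    rw [Submodule.coe_smul, comulComp_val, comulComp_val, Submodule.coe_smul,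
      LinearMap.comp_smul, LinearMap.comp_smul, smul_comm]
  update_add {k a n e} f g j x y := by
    apply Subtype.ext
    have h : ∀ z, (fun i => (Function.update g j z i).1) =
        Function.update (fun i => (g i).1) j z.1 :=
      fun z => funext fun i =>
        Function.apply_update (fun i (w : comulSub D E (n i) (e i)) => w.1) g j z i
    rw [Submodule.coe_add, comulComp_val, comulComp_val, comulComp_val,
      h, h, h, Submodule.coe_add, koszulMap_update_add, LinearMap.add_comp, LinearMap.comp_add,
      smul_add]
  update_smul {k a n e} f g j r x := by
    apply Subtype.ext
    have h : ∀ z, (fun i => (Function.update g j z i).1) =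
        Function.update (fun i => (g i).1) j z.1 :=
      fun z => funext fun i =>
        Function.apply_update (fun i (w : comulSub D E (n i) (e i)) => w.1) g j z i
    rw [Submodule.coe_smul, comulComp_val, comulComp_val,
      h, h, Submodule.coe_smul, koszulMap_update_smul, LinearMap.smul_comp, LinearMap.comp_smul,
      smul_comm]

/-- Associativity of `± (g₁ ⊗ ⋯ ⊗ g_k) ∘ f`. The order of composition is opposite to that of
multilinear maps; the sign `(-1)^{|f| ∑ |g_j|}` in `comulComp` is what makes the same associativity
law hold. -/
theorem comulComp_assoc (A : DGMod.{u, v₁} R) (B : DGMod.{u, v₂} R) (D : DGMod.{u, v₃} R)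
    (E : DGMod.{u, v₄} R) :
    IsAssocComp R (X := fun n d => comulSub A B n d) (Y := fun n d => comulSub B D n d)
      (Z := fun n d => comulSub D E n d) (U := fun n d => comulSub A D n d)
      (V := fun n d => comulSub B E n d) (W := fun n d => comulSub A E n d)
      (fun f g => comulComp f g) (fun f g => comulComp f g) (fun f g => comulComp f g)
      (fun f g => comulComp f g) := by
  intro k a n e N e' f g h
  refine comulSub_ext fun x => ?_
  rw [Submodule.coe_smul, LinearMap.smul_apply, map_smul, comulSub_famCast]
  dsimp only
  rw [comulComp_val, comulComp_val, comulComp_val]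
  -- the parity operators on the factor `(j, i)` come from the later factors of the block `j` and
  -- from the later blocks; the latter assemble into the parity operator of the whole block
  have hm : ∀ j : Fin k, flatten E (fun i => N (finSigmaFinEquiv ⟨j, i⟩)) ∘ₗ
      PiTensorProduct.map (fun i => (h (finSigmaFinEquiv ⟨j, i⟩)).1 ∘ₗ
        D.eps (∑ q ∈ Finset.Ioi (finSigmaFinEquiv ⟨j, i⟩), e' q)) =
      (flatten E (fun i => N (finSigmaFinEquiv ⟨j, i⟩)) ∘ₗ
        koszulMap (fun _ => D.eps) (fun i => e' (finSigmaFinEquiv ⟨j, i⟩))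
          (fun i => (h (finSigmaFinEquiv ⟨j, i⟩)).1)) ∘ₗ
        D.tEps (n j) (∑ j' ∈ Finset.Ioi j, ∑ i, e' (finSigmaFinEquiv ⟨j', i⟩)) := fun j => by
    rw [LinearMap.comp_assoc, koszulMap, DGMod.tEps, ← PiTensorProduct.map_comp]
    congr 2
    funext i
    rw [sum_Ioi_finSigmaFinEquiv, DGMod.eps_add, LinearMap.comp_assoc]
  -- the signs in the definition of the inner composites
  have hv : (fun j => (comulComp (g j) fun i => h (finSigmaFinEquiv ⟨j, i⟩)).1) = fun j =>
      ksign R (e j * ∑ i, e' (finSigmaFinEquiv ⟨j, i⟩)) •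
        ((flatten E (fun i => N (finSigmaFinEquiv ⟨j, i⟩)) ∘ₗ
          koszulMap (fun _ => D.eps) (fun i => e' (finSigmaFinEquiv ⟨j, i⟩))
            (fun i => (h (finSigmaFinEquiv ⟨j, i⟩)).1)) ∘ₗ (g j).1) := by
    funext j
    rw [comulComp_val, LinearMap.comp_assoc]
  rw [hv, koszulMap_smul, ← ksign_sum]
  simp only [LinearMap.smul_apply, LinearMap.comp_apply, map_smul, smul_smul]
  rw [koszulMap, flatten_assoc]
  simp only [hm]
  have hc := koszulMap_comp (fun _ : Fin k => B.eps) (fun _ => B.eps_add)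
    (fun j => D.tEps (n j)) (fun j => ∑ i, e' (finSigmaFinEquiv ⟨j, i⟩)) e
    (fun j => flatten E (fun i => N (finSigmaFinEquiv ⟨j, i⟩)) ∘ₗ
        koszulMap (fun _ => D.eps) (fun i => e' (finSigmaFinEquiv ⟨j, i⟩))
          (fun i => (h (finSigmaFinEquiv ⟨j, i⟩)).1)) (fun j => (g j).1)
    (fun j => comulSub_parity (g j))
  have hc' := LinearMap.congr_fun hc (f.1 x)
  rw [LinearMap.comp_apply, LinearMap.smul_apply] at hc'
  rw [koszulMap] at hc'
  erw [hc']
  rw [map_smul, map_smul, smul_smul]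
  simp only [add_comm (∑ i, e' (finSigmaFinEquiv ⟨_, i⟩)) (e _)]
  congr 1
  rw [← ksign_add, ← ksign_add, ← ksign_add, ← ksign_add]
  -- moving the `h`-blocks past the `g`s gives a sign for each pair of `g j` and a block `i > j`,
  -- the associativity law has one for each pair with `i < j`; the signs in the composition law
  -- account for the difference
  have hs := shuffleExp_add_comm e fun j => ∑ i, e' (finSigmaFinEquiv ⟨j, i⟩)
  rw [Finset.sum_add_distrib, sum_finSigmaFinEquiv e']
  refine ksign_congr R (shuffleExp (fun j => ∑ i, e' (finSigmaFinEquiv ⟨j, i⟩)) e) ?_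
  linear_combination hs

/-- The Leibniz rule for `± (g₁ ⊗ ⋯ ⊗ g_k) ∘ f`, from the Leibniz rule for `g₁ ⊗ ⋯ ⊗ g_k`. -/
theorem comulComp_leibniz (C : DGMod.{u, v₁} R) (D : DGMod.{u, v₂} R) (E : DGMod.{u, v₃} R) :
    IsLeibnizComp R (X := fun n d => comulSub C D n d) (Y := fun n d => comulSub D E n d)
      (Z := fun n d => comulSub C E n d) (fun f g => comulComp f g) comulDiff comulDiff
      comulDiff := by
  intro k a n e f g
  have hL := koszulMap_leibniz (fun _ : Fin k => D.eps) (fun _ => D.eps_add)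
    (fun _ => D.eps_add_self) (fun j => E.tEps (n j)) (fun _ => D.diff)
    (fun _ => D.diff_comp_eps) (fun j => E.tDiff (n j)) e (fun j => (g j).1)
    (fun j => comulSub_parity (g j))
    (fun i j =>
      (slotFam (Y := fun j d => comulSub D E (n j) d) g i (comulDiff (g i)) j).1)
    (fun i j h => by rw [slotFam_of_ne _ h, comulSub_degCast])
    (fun i => by rw [slotFam_self, comulSub_degCast, comulDiff_val])
  apply Subtype.ext
  dsimp only
  rw [Submodule.coe_add, Submodule.coe_sum, comulSub_degCast, comulDiff_val, comulComp_val,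
    comulComp_val, comulDiff_val]
  simp only [Submodule.coe_smul, comulSub_degCast, comulComp_val]
  -- lowering the degree of one `g j` changes the composition sign by `(-1)^a`, which cancels
  -- against the sign of moving the differential past `f`
  have hR : (∑ j, ksign R (a + ∑ i ∈ Finset.Iio j, e i) •
      ksign R (a * ∑ i, (e i - if i = j then 1 else 0)) • (flatten E n ∘ₗ
      koszulMap (fun _ => D.eps) (fun i => e i - if i = j then 1 else 0) (fun i =>
          (slotFam (Y := fun j d => comulSub D E (n j) d) g j (comulDiff (g j)) i).1) ∘ₗ f.1)) =
      ksign R (a * ∑ j, e j) • (flatten E n ∘ₗ (∑ i, ksign R (∑ j ∈ Finset.Iio i, e j) •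
        koszulMap (fun _ => D.eps) (fun j => e j - if j = i then 1 else 0) fun j =>
            (slotFam (Y := fun j d => comulSub D E (n j) d) g i (comulDiff (g i)) j).1) ∘ₗ
              f.1) := by
    rw [linearMap_sum_comp, linearMap_comp_sum, Finset.smul_sum]
    refine Finset.sum_congr rfl fun i _ => ?_
    rw [LinearMap.smul_comp, LinearMap.comp_smul, smul_smul, smul_smul, ← ksign_add, ← ksign_add]
    congr 1
    rw [Finset.sum_sub_distrib]
    refine ksign_congr R 0 ?_
    simp
    ring
  refine Eq.trans ?_ (congrArg _ hR.symm)
  rw [← hL, ← DGMod.tDiff_eq]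
  have ht : ∀ y, E.tDiff (∑ j, n j) (flatten E n y) = flatten E n
      ((∑ j, koszulSlot (fun j => E.tEps (n j) 1) (fun j => E.tDiff (n j)) j) y) := fun y =>
    LinearMap.congr_fun (E.tDiff_comp_flatten n) y
  refine LinearMap.ext fun x => ?_
  simp only [LinearMap.comp_apply, LinearMap.add_apply, LinearMap.smul_apply, map_add, map_smul,
    ht, smul_add, smul_smul]
  have h1 : ksign R ((a - 1) * ∑ j, e j) = ksign R (a * ∑ j, e j) * ksign R (∑ j, e j) := by
    rw [← ksign_add]
    exact ksign_congr R (-∑ j, e j) (by ring)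
  rw [h1, ksign_add]
  module

end ComulSub

/-! ### The convolution map is compatible with compositions and differentials -/

section Convolution

variable {R : Type u} [CommRing R]

/-- The inclusion of the maps `C → A` of degree `d` into the total module of `Hom(C, A)`. -/
def homι (C : DGMod.{u, v₁} R) (A : DGMod.{u, v₂} R) (d : ℤ) :
    homSub C A d →ₗ[R] (HomDG C A).Tot := (HomDG C A).ι d

theorem eps_homι (C : DGMod.{u, v₁} R) (A : DGMod.{u, v₂} R) (k d : ℤ) (x : homSub C A d) :
    (HomDG C A).eps k (homι C A d x) = ksign R (k * d) • homι C A d x :=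
  DGMod.eps_ι _ _ _ _

theorem diff_homι (C : DGMod.{u, v₁} R) (A : DGMod.{u, v₂} R) (d : ℤ) (x : homSub C A d) :
    (HomDG C A).diff (homι C A d x) = homι C A (d - 1) (homDiff C A d x) :=
  DGMod.diff_ι _ _ _

theorem homι_congr {C : DGMod.{u, v₁} R} {A : DGMod.{u, v₂} R} {d d' : ℤ} (h : d = d')
    {x : homSub C A d} {y : homSub C A d'} (hxy : x.1 = y.1) :
    homι C A d x = homι C A d' y := by
  subst h
  rw [Subtype.ext hxy]

theorem convApply_val {C₁ : DGMod.{u, v₁} R} {C₂ : DGMod.{u, v₂} R} {A₁ : DGMod.{u, v₃} R}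
    {A₂ : DGMod.{u, v₄} R} {n : ℕ} {a b : ℤ} (φ : comulSub C₂ C₁ n a) (g : mulSub A₁ A₂ n b)
    {e : Fin n → ℤ} (h : ∀ i, homSub C₁ A₁ (e i)) :
    (convApply φ g h).1 = ksign R (a * (b + ∑ i, e i)) • (PiTensorProduct.lift g.1 ∘ₗ
      koszulMap (fun _ => C₁.eps) e (fun i => (h i).1) ∘ₗ φ.1) := rfl

theorem convMul_homι {C₁ : DGMod.{u, v₁} R} {C₂ : DGMod.{u, v₂} R} {A₁ : DGMod.{u, v₃} R}
    {A₂ : DGMod.{u, v₄} R} {n : ℕ} {a b : ℤ} (φ : comulSub C₂ C₁ n a) (g : mulSub A₁ A₂ n b)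
    {e : Fin n → ℤ} (h : ∀ i, homSub C₁ A₁ (e i)) :
    (convMul φ g).1 (fun i => homι C₁ A₁ (e i) (h i)) =
      homι C₂ A₂ (a + b + ∑ i, e i) (convApply φ g h) :=
  convMul_ι φ g h

/-- Multilinear operations on `Hom(C₁, A₁)` agree if they agree on homogeneous maps `C₁ → A₁`. -/
theorem convMul_ext {C₁ : DGMod.{u, v₁} R} {A₁ : DGMod.{u, v₃} R} {B : DGMod.{u, v₂} R} {n : ℕ}
    {d : ℤ} {f f' : mulSub (HomDG C₁ A₁) B n d}
    (h : ∀ (e : Fin n → ℤ) (x : ∀ i, homSub C₁ A₁ (e i)),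
      f.1 (fun i => homι C₁ A₁ (e i) (x i)) = f'.1 (fun i => homι C₁ A₁ (e i) (x i))) :
    f = f' :=
  Subtype.ext (DGMod.multilinear_ext _ h)

section Linear

variable {C₁ : DGMod.{u, v₁} R} {C₂ : DGMod.{u, v₂} R} {A₁ : DGMod.{u, v₃} R}
    {A₂ : DGMod.{u, v₄} R} {n : ℕ} {a b : ℤ}

/-- The map `coHom ⊗ Hom → Hom` sending `φ ⊗ g` to `h ↦ ± g ∘ h ∘ φ`, as a bilinear map. -/
def convMulₗ : comulSub C₂ C₁ n a →ₗ[R] mulSub A₁ A₂ n b →ₗ[R]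
    mulSub (HomDG C₁ A₁) (HomDG C₂ A₂) n (a + b) :=
  LinearMap.mk₂ R convMul
    (fun φ φ' g => convMul_ext fun e h => by
      rw [Submodule.coe_add, _root_.add_apply, convMul_homι, convMul_homι, convMul_homι, ← map_add]
      refine homι_congr rfl ?_
      rw [Submodule.coe_add, convApply_val, convApply_val, convApply_val, Submodule.coe_add,
        LinearMap.comp_add, LinearMap.comp_add, smul_add])
    (fun r φ g => convMul_ext fun e h => by
      rw [Submodule.coe_smul, _root_.smul_apply, convMul_homι, convMul_homι, ← map_smul]
      refine homι_congr rfl ?_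
      rw [Submodule.coe_smul, convApply_val, convApply_val, Submodule.coe_smul,
        LinearMap.comp_smul, LinearMap.comp_smul, smul_comm])
    (fun φ g g' => convMul_ext fun e h => by
      rw [Submodule.coe_add, _root_.add_apply, convMul_homι, convMul_homι, convMul_homι, ← map_add]
      refine homι_congr rfl ?_
      rw [Submodule.coe_add, convApply_val, convApply_val, convApply_val, Submodule.coe_add,
        map_add, LinearMap.add_comp, smul_add])
    (fun r φ g => convMul_ext fun e h => by
      rw [Submodule.coe_smul, _root_.smul_apply, convMul_homι, convMul_homι, ← map_smul]
      refine homι_congr rfl ?_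
      rw [Submodule.coe_smul, convApply_val, convApply_val, Submodule.coe_smul,
        map_smul, LinearMap.smul_comp, smul_comm])

end Linear

/-- The convolution map preserves units. -/
theorem convMul_one (C : DGMod.{u, v₁} R) (A : DGMod.{u, v₂} R) :
    degCast (Y := fun d => mulSub (HomDG C A) (HomDG C A) 1 d) (zero_add 0)
      (convMul (comulOne C) (mulOne A)) = mulOne (HomDG C A) := by
  refine convMul_ext fun e h => ?_
  rw [mulSub_degCast, convMul_homι]
  change _ = homι C A (e 0) (h 0)
  refine homι_congr (by rw [Fin.sum_univ_one]; ring) (LinearMap.ext fun x => ?_)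
  rw [convApply_val, zero_mul, ksign_zero, one_smul, LinearMap.comp_apply, LinearMap.comp_apply,
    comulOne_apply, koszulMap, PiTensorProduct.map_tprod, PiTensorProduct.lift.tprod]
  change (h 0).1 (C.eps (∑ i ∈ Finset.Ioi (0 : Fin 1), e i) x) = _
  have h : (Finset.Ioi (0 : Fin 1)) = ∅ := rfl
  rw [h, Finset.sum_empty, DGMod.eps_zero, LinearMap.id_apply]

/-- The convolution map `Θ` is compatible with compositions. The sign `tensorExp` is the one in the
composition of a tensor product of operads, so this covers the operads `coEnd ⊗ End` and both
actions on the bimodule `coHom ⊗ Hom`. -/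
theorem convMul_comp {C₁ : DGMod.{u, v₁} R} {C₂ : DGMod.{u, v₂} R} {C₃ : DGMod.{u, v₃} R}
    {A₁ : DGMod.{u, w₁} R} {A₂ : DGMod.{u, w₂} R} {A₃ : DGMod.{u, w₃} R} {k : ℕ} {a b : ℤ}
    {n : Fin k → ℕ} {e e' : Fin k → ℤ} (φ : comulSub C₃ C₂ k a) (g : mulSub A₂ A₃ k b)
    (ψ : ∀ j, comulSub C₂ C₁ (n j) (e j)) (l : ∀ j, mulSub A₁ A₂ (n j) (e' j)) :
    mulComp (convMul φ g) (fun j => convMul (ψ j) (l j)) = ksign R (tensorExp b e e') •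
      degCast (Y := fun d => mulSub (HomDG C₁ A₁) (HomDG C₃ A₃) (∑ j, n j) d)
        (by rw [Finset.sum_add_distrib]; ring) (convMul (comulComp φ ψ) (mulComp g l)) := by
  refine convMul_ext fun c h => ?_
  rw [Submodule.coe_smul, _root_.smul_apply, mulSub_degCast, convMul_homι, ← map_smul]
  change (convMul φ g).1 (fun j => (convMul (ψ j) (l j)).1 fun i => (HomDG C₁ A₁).eps
    (∑ j' ∈ Finset.Ioi j, (e j' + e' j')) (homι C₁ A₁ _ (h (finSigmaFinEquiv ⟨j, i⟩)))) = _
  -- the inner operations on homogeneous maps, with the Koszul sign of the outer tensor product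
  have hj : ∀ j, ((convMul (ψ j) (l j)).1 fun i => (HomDG C₁ A₁).eps
      (∑ j' ∈ Finset.Ioi j, (e j' + e' j')) (homι C₁ A₁ _ (h (finSigmaFinEquiv ⟨j, i⟩)))) =
      homι C₂ A₂ (e j + e' j + ∑ i, c (finSigmaFinEquiv ⟨j, i⟩))
        (ksign R (∑ j' ∈ Finset.Ioi j, (∑ i, c (finSigmaFinEquiv ⟨j, i⟩)) * (e j' + e' j')) •
          convApply (ψ j) (l j) fun i => h (finSigmaFinEquiv ⟨j, i⟩)) := fun j => by
    simp only [eps_homι]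
    rw [MultilinearMap.map_smul_univ, ← ksign_sum, convMul_homι, ← map_smul, ← Finset.mul_sum,
      ← Finset.mul_sum, mul_comm]
  simp only [hj]
  rw [convMul_homι]
  refine homι_congr (by rw [sum_finSigmaFinEquiv c]; simp only [Finset.sum_add_distrib]; ring) ?_
  rw [Submodule.coe_smul, convApply_val, convApply_val, comulComp_val]
  -- `C j` is the total degree and `H j` the tensor product of the maps `h` in the block `j`
  set C : Fin k → ℤ := fun j => ∑ i, c (finSigmaFinEquiv ⟨j, i⟩) with hC
  let H : ∀ j, C₁.TPow (n j) →ₗ[R] A₁.TPow (n j) := fun j =>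
    koszulMap (fun _ => C₁.eps) (fun i => c (finSigmaFinEquiv ⟨j, i⟩))
      fun i => (h (finSigmaFinEquiv ⟨j, i⟩)).1
  have hH : ∀ j, HasParity (C₁.tEps (n j)) (A₁.tEps (n j)) (C j) (H j) := fun j =>
    koszulMap_parity fun i => h (finSigmaFinEquiv ⟨j, i⟩)
  have hv : (fun j => (ksign R (∑ j' ∈ Finset.Ioi j, C j * (e j' + e' j')) •
      convApply (ψ j) (l j) fun i => h (finSigmaFinEquiv ⟨j, i⟩)).1) = fun j =>
      ksign R (∑ j' ∈ Finset.Ioi j, C j * (e j' + e' j') + e j * (e' j + C j)) •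
        ((PiTensorProduct.lift (l j).1 ∘ₗ H j) ∘ₗ (ψ j).1) := by
    funext j
    rw [Submodule.coe_smul, convApply_val, smul_smul, ← ksign_add, LinearMap.comp_assoc]
  -- two applications of the interchange law: to `(l ⊗ ⋯) ∘ (H ⊗ ⋯)`, then to the result and `ψ ⊗ ⋯`
  have h1 : PiTensorProduct.lift (mulComp g l).1 ∘ₗ
      koszulMap (fun _ => C₁.eps) c (fun p => (h p).1) ∘ₗ flatten C₁ n ∘ₗ
        koszulMap (fun _ => C₂.eps) e (fun j => (ψ j).1) =
      ksign R (shuffleExp e' C + shuffleExp (fun j => e' j + C j) e) • (PiTensorProduct.lift g.1 ∘ₗ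
        koszulMap (fun _ => C₂.eps) (fun j => e' j + C j + e j)
          (fun j => (PiTensorProduct.lift (l j).1 ∘ₗ H j) ∘ₗ (ψ j).1)) := by
    rw [← LinearMap.comp_assoc (koszulMap _ e _), koszulMap_comp_flatten, ← LinearMap.comp_assoc,
      ← LinearMap.comp_assoc, lift_mulComp, LinearMap.comp_assoc, LinearMap.comp_assoc,
      ← LinearMap.comp_assoc (koszulMap _ e _),
      koszulMap_comp (fun j => C₁.tEps (n j)) (fun j => C₁.tEps_add (n j))
        (fun j => A₁.tEps (n j)) e' C (fun j => PiTensorProduct.lift (l j).1) H hH,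
      LinearMap.smul_comp, koszulMap_comp (fun _ : Fin k => C₂.eps) (fun _ => C₂.eps_add)
        (fun j => C₁.tEps (n j)) (fun j => e' j + C j) e _ (fun j => (ψ j).1)
        (fun j => comulSub_parity (ψ j)), smul_smul, LinearMap.comp_smul, ← ksign_add]
  have h2 : PiTensorProduct.lift (mulComp g l).1 ∘ₗ
      koszulMap (fun _ => C₁.eps) c (fun p => (h p).1) ∘ₗ (ksign R (a * ∑ j, e j) •
        (flatten C₁ n ∘ₗ koszulMap (fun _ => C₂.eps) e (fun j => (ψ j).1) ∘ₗ φ.1)) =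
      ksign R (a * ∑ j, e j) • ((PiTensorProduct.lift (mulComp g l).1 ∘ₗ
      koszulMap (fun _ => C₁.eps) c (fun p => (h p).1) ∘ₗ flatten C₁ n ∘ₗ
        koszulMap (fun _ => C₂.eps) e (fun j => (ψ j).1)) ∘ₗ φ.1) := by
    simp only [LinearMap.comp_smul, LinearMap.comp_assoc]
  rw [h2, h1, hv, koszulMap_smul, ← ksign_sum]
  simp only [LinearMap.smul_comp, LinearMap.comp_smul, smul_smul, LinearMap.comp_assoc]
  rw [koszulMap_congr _ (e := fun j => e' j + C j + e j) (e' := fun j => e j + e' j + C j)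
    (fun j => by ring) fun j => rfl]
  congr 1
  simp only [← ksign_add]
  -- what remains is a congruence modulo 2 between quadratic expressions in the degrees
  have s1 := shuffleExp_add_comm e e'
  have s2 := shuffleExp_add_comm e C
  have s3 : ∑ j, ∑ j' ∈ Finset.Ioi j, C j * (e j' + e' j') = shuffleExp e C + shuffleExp e' C :=
    shuffleExp_add_left e e' C
  have s4 : ∑ q, c q = ∑ j, C j := sum_finSigmaFinEquiv c
  have s5 : ∑ j, (e j + e' j + C j) = ∑ j, e j + ∑ j, e' j + ∑ j, C j := by
    simp only [Finset.sum_add_distrib]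
  have s6 : ∑ j, (∑ j' ∈ Finset.Ioi j, C j * (e j' + e' j') + e j * (e' j + C j)) =
      shuffleExp e C + shuffleExp e' C + (∑ j, e j * e' j + ∑ j, e j * C j) := by
    rw [← s3, Finset.sum_add_distrib, ← Finset.sum_add_distrib (f := fun j => e j * e' j)]
    simp only [mul_add]
  rw [shuffleExp_add_left, s4, tensorExp]
  refine (congrArg (ksign R) (congrArg₂ (fun x y => a * (b + x) + y) s5 s6)).trans ?_
  refine ksign_congr R (-(b * ∑ j, e j + shuffleExp e e' + shuffleExp e' e + shuffleExp C e)) ?_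
  linear_combination - s1 - s2

theorem mulDiff_apply {A : DGMod.{u, v₁} R} {B : DGMod.{u, v₂} R} {n : ℕ} {d : ℤ}
    (f : mulSub A B n d) (x : Fin n → A.Tot) : (mulDiff f).1 x = B.diff (f.1 x) +
      (-ksign R d) • ∑ i, f.1 fun j => A.slot (A.eps 1) A.diff i j (x j) := by
  change B.diff (f.1 x) - (ksign R d • ∑ i : Fin n,
    f.1.compLinearMap (A.slot (A.eps 1) A.diff i)) x = _
  rw [_root_.smul_apply, _root_.sum_apply, neg_smul, sub_eq_add_neg]
  rfl

@[simp] theorem homSub_degCast {C : DGMod.{u, v₁} R} {A : DGMod.{u, v₂} R} {d d' : ℤ}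
    (h : d = d') (f : homSub C A d) :
    (degCast (Y := fun d => homSub C A d) h f).1 = f.1 := by
  subst h; rfl

theorem homι_degCast {C : DGMod.{u, v₁} R} {A : DGMod.{u, v₂} R} {d d' : ℤ}
    (h : d = d') (f : homSub C A d) :
    homι C A d f = homι C A d' (degCast (Y := fun d => homSub C A d) h f) :=
  homι_congr h (homSub_degCast h f).symm

theorem homDiff_val {C : DGMod.{u, v₁} R} {A : DGMod.{u, v₂} R} {d : ℤ} (f : homSub C A d) :
    (homDiff C A d f).1 = A.diff ∘ₗ f.1 + (-ksign R d) • (f.1 ∘ₗ C.diff) := by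
  refine LinearMap.ext fun x => ?_
  change A.diff (f.1 x) - ksign R d • f.1 (C.diff x) =
    A.diff (f.1 x) + (-ksign R d) • f.1 (C.diff x)
  rw [neg_smul, sub_eq_add_neg]

/-- The convolution map `Θ` is a morphism of complexes, for the differential of a tensor product on
its source. -/
theorem convMul_leibniz {C₁ : DGMod.{u, v₁} R} {C₂ : DGMod.{u, v₂} R}
    {A₁ : DGMod.{u, v₃} R} {A₂ : DGMod.{u, v₄} R} {n : ℕ} {a b : ℤ}
    (φ : comulSub C₂ C₁ n a) (g : mulSub A₁ A₂ n b) :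
    mulDiff (convMul φ g) =
      degCast (Y := fun d => mulSub (HomDG C₁ A₁) (HomDG C₂ A₂) n d) (sub_add_eq_add_sub _ _ _)
        (convMul (comulDiff φ) g) + ksign R a •
      degCast (Y := fun d => mulSub (HomDG C₁ A₁) (HomDG C₂ A₂) n d) (add_sub_assoc _ _ _).symm
        (convMul φ (mulDiff g)) := by
  refine convMul_ext fun c h => ?_
  have hD : ∀ i, a + b + ∑ j, (c j - if j = i then 1 else 0) = a + b + ∑ i, c i - 1 := fun i =>
    sum_sub_ite_eq _ _ _
  -- the operation with the differential of `Hom(C₁, A₁)` inserted in the slot `i`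
  have hs : ∀ i, ((convMul φ g).1 fun j => (HomDG C₁ A₁).slot ((HomDG C₁ A₁).eps 1)
      (HomDG C₁ A₁).diff i j (homι C₁ A₁ (c j) (h j))) =
      homι C₂ A₂ (a + b + ∑ i, c i - 1) (ksign R (∑ j ∈ Finset.Iio i, c j) •
        degCast (Y := fun d => homSub C₂ A₂ d) (hD i) (convApply φ g
          (slotFam (Y := fun _ d => homSub C₁ A₁ d) h i (homDiff C₁ A₁ _ (h i))))) := fun i => by
    have h1 : ∀ j, (HomDG C₁ A₁).slot ((HomDG C₁ A₁).eps 1)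
        (HomDG C₁ A₁).diff i j (homι C₁ A₁ (c j) (h j)) =
        (if j ∈ Finset.Iio i then ksign R (c j) else 1) •
          homι C₁ A₁ (c j - if j = i then 1 else 0)
            (slotFam (Y := fun _ d => homSub C₁ A₁ d) h i (homDiff C₁ A₁ _ (h i)) j) := fun j => by
      rw [DGMod.slot]
      rcases lt_trichotomy j i with hj | hj | hj
      · rw [if_pos hj, if_pos (Finset.mem_Iio.2 hj), eps_homι, one_mul, slotFam_of_ne _ hj.ne]
        congr 1
        exact homι_degCast _ _
      · subst hj
        rw [if_neg (lt_irrefl _), if_pos rfl, if_neg (by simp), one_smul, diff_homι, slotFam_self]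
        exact homι_degCast _ _
      · rw [if_neg hj.not_gt, if_neg hj.ne', if_neg (by simpa using hj.le), one_smul,
          slotFam_of_ne _ hj.ne']
        exact homι_degCast _ _
    simp only [h1]
    rw [MultilinearMap.map_smul_univ, Finset.prod_ite_mem, Finset.univ_inter, ← ksign_sum,
      convMul_homι, map_smul]
    congr 1
    exact homι_degCast _ _
  rw [mulDiff_apply, convMul_homι, diff_homι, Finset.sum_congr rfl fun i _ => hs i,
    Submodule.coe_add, _root_.add_apply, Submodule.coe_smul, _root_.smul_apply, mulSub_degCast,
    mulSub_degCast, convMul_homι, convMul_homι,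
    homι_degCast (show a - 1 + b + ∑ i, c i = a + b + ∑ i, c i - 1 by ring),
    homι_degCast (show a + (b - 1) + ∑ i, c i = a + b + ∑ i, c i - 1 by ring)]
  simp only [← map_smul, ← map_sum, ← map_add]
  refine congrArg _ (Subtype.ext ?_)
  -- `[∂, h₁ ⊗ ⋯ ⊗ h_n]` is the sum of the tensor products with `[∂, h_i]` in the slot `i`
  have hL := koszulMap_leibniz (fun _ : Fin n => C₁.eps) (fun _ => C₁.eps_add)
    (fun _ => C₁.eps_add_self) (fun _ => A₁.eps) (fun _ => C₁.diff)
    (fun _ => C₁.diff_comp_eps) (fun _ => A₁.diff) c (fun j => (h j).1)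
    (fun j => homSub_parity (h j))
    (fun i j => (slotFam (Y := fun _ d => homSub C₁ A₁ d) h i (homDiff C₁ A₁ _ (h i)) j).1)
    (fun i j hj => by rw [slotFam_of_ne _ hj, homSub_degCast])
    (fun i => by rw [slotFam_self, homSub_degCast, homDiff_val])
  -- lowering the degree of one `h i` changes the sign in `Θ` by `(-1)^a`
  have hR : (∑ i, ksign R (∑ j ∈ Finset.Iio i, c j) •
      ksign R (a * (b + ∑ j, (c j - if j = i then 1 else 0))) • (PiTensorProduct.lift g.1 ∘ₗ
        koszulMap (fun _ => C₁.eps) (fun j => c j - if j = i then 1 else 0) (fun j =>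
          (slotFam (Y := fun _ d => homSub C₁ A₁ d) h i (homDiff C₁ A₁ _ (h i)) j).1) ∘ₗ φ.1)) =
      (ksign R (a * (b + ∑ i, c i)) * ksign R a) • (PiTensorProduct.lift g.1 ∘ₗ
        (∑ i, ksign R (∑ j ∈ Finset.Iio i, c j) •
          koszulMap (fun _ => C₁.eps) (fun j => c j - if j = i then 1 else 0) (fun j =>
            (slotFam (Y := fun _ d => homSub C₁ A₁ d) h i (homDiff C₁ A₁ _ (h i)) j).1)) ∘ₗ
          φ.1) := by
    rw [linearMap_sum_comp, linearMap_comp_sum, Finset.smul_sum]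
    refine Finset.sum_congr rfl fun i _ => ?_
    rw [LinearMap.smul_comp, LinearMap.comp_smul, smul_smul, smul_smul, sum_sub_ite_eq]
    congr 1
    rw [mul_comm]
    congr 1
    rw [← ksign_add]
    exact ksign_congr R (-a) (by ring)
  simp only [Submodule.coe_add, Submodule.coe_smul, Submodule.coe_sum, homSub_degCast, homDiff_val,
    convApply_val]
  rw [hR, ← hL, ← DGMod.tDiff_eq, ← DGMod.tDiff_eq, comulDiff_val, lift_mulDiff]
  refine LinearMap.ext fun x => ?_
  simp only [LinearMap.comp_apply, LinearMap.add_apply, LinearMap.smul_apply, map_add, map_smul,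
    smul_add, smul_smul]
  -- both sides consist of the same four terms, with the differential after `g`, between `g` and
  -- `h`, between `h` and `φ`, and before `φ`; it remains to compare their signs
  have e1 : ksign R ((a - 1) * (b + ∑ i, c i)) =
      ksign R (a * (b + ∑ i, c i)) * (ksign R b * ksign R (∑ i, c i)) := by
    rw [← ksign_add, ← ksign_add]
    exact ksign_congr R (-(b + ∑ i, c i)) (by ring)
  have e2 : ksign R (a * (b - 1 + ∑ i, c i)) = ksign R (a * (b + ∑ i, c i)) * ksign R a := by
    rw [← ksign_add]
    exact ksign_congr R (-a) (by ring)
  have e3 := ksign_mul_self R a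
  rw [e1, e2, ksign_add R (a + b), ksign_add R a b]
  match_scalars
  · linear_combination (-ksign R (a * (b + ∑ j, c j))) * e3
  · ring
  · ring
  · linear_combination ksign R (a * (b + ∑ j, c j)) * ksign R b * ksign R (∑ j, c j) * e3

end Convolution

/-! ### Lawful operads and bimodules -/

section Casts

variable {R : Type u} [CommRing R] {X : ℕ → ℤ → Type v}

theorem famCast_rfl {n : ℕ} {d : ℤ} (hn : n = n) (hd : d = d) (x : X n d) :
    famCast hn hd x = x := rfl

theorem famCast_famCast {n n' n'' : ℕ} {d d' d'' : ℤ} (hn : n = n') (hd : d = d')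
    (hn' : n' = n'') (hd' : d' = d'') (x : X n d) :
    famCast hn' hd' (famCast hn hd x) = famCast (hn.trans hn') (hd.trans hd') x := by
  subst hn hd hn' hd'; rfl

theorem degCast_eq_famCast {n : ℕ} {d d' : ℤ} (hd : d = d') (x : X n d) :
    degCast (Y := X n) hd x = famCast rfl hd x := rfl

variable [∀ n d, AddCommGroup (X n d)] [∀ n d, Module R (X n d)]

/-- Transport along equalities of arities and degrees, as a linear map. -/
def famCastₗ (R : Type u) [CommRing R] [∀ n d, Module R (X n d)] {n n' : ℕ} {d d' : ℤ}
    (hn : n = n') (hd : d = d') : X n d →ₗ[R] X n' d' where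
  toFun := famCast hn hd
  map_add' _ _ := by subst hn hd; rfl
  map_smul' _ _ := by subst hn hd; rfl

theorem famCast_eq_famCastₗ (R : Type u) [CommRing R] [∀ n d, Module R (X n d)] {n n' : ℕ}
    {d d' : ℤ} (hn : n = n') (hd : d = d') (x : X n d) :
    famCast hn hd x = famCastₗ R hn hd x := rfl

theorem famCast_smul {n n' : ℕ} {d d' : ℤ} (hn : n = n') (hd : d = d') (r : R) (x : X n d) :
    famCast hn hd (r • x) = r • famCast hn hd x := by
  subst hn hd; rfl

end Casts

section TotalCompLemmas

variable {R : Type u} [CommRing R] {X : ℕ → ℤ → Type v₁} {Y : ℕ → ℤ → Type v₂}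
  {Z : ℕ → ℤ → Type v₃}

/-- Total compositions commute with transports of their right entries. -/
theorem totalComp_congr (c : TotalComp X Y Z) {k : ℕ} {a : ℤ} {n n' : Fin k → ℕ}
    {e e' : Fin k → ℤ} (hn : ∀ j, n j = n' j) (he : ∀ j, e j = e' j) (f : X k a)
    (g : ∀ j, Y (n j) (e j)) (g' : ∀ j, Y (n' j) (e' j))
    (h : ∀ j, g' j = famCast (X := Y) (hn j) (he j) (g j)) :
    c f g' = famCast (X := Z) (Finset.sum_congr rfl fun j _ => hn j)
      (congrArg _ (Finset.sum_congr rfl fun j _ => he j)) (c f g) := by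
  obtain rfl : n = n' := funext hn
  obtain rfl : e = e' := funext he
  obtain rfl : g' = g := funext h
  rfl

variable [∀ n d, AddCommGroup (X n d)] [∀ n d, Module R (X n d)] [∀ n d, AddCommGroup (Y n d)]
    [∀ n d, Module R (Y n d)] [∀ n d, AddCommGroup (Z n d)] [∀ n d, Module R (Z n d)]

namespace IsMultilinearComp

variable {c : TotalComp X Y Z} (hc : IsMultilinearComp R c)
include hc

/-- A total composition as a linear map of its first argument with values in multilinear maps. -/
def toMultilinear (k : ℕ) (a : ℤ) (n : Fin k → ℕ) (e : Fin k → ℤ) :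
    X k a →ₗ[R] MultilinearMap R (fun j => Y (n j) (e j)) (Z (∑ j, n j) (a + ∑ j, e j)) where
  toFun f :=
    { toFun := fun g => c f g
      map_update_add' := fun {inst} g j x y => by
        rw [Subsingleton.elim inst (instDecidableEqFin k)]
        exact hc.update_add f g j x y
      map_update_smul' := fun {inst} g j r x => by
        rw [Subsingleton.elim inst (instDecidableEqFin k)]
        exact hc.update_smul f g j r x }
  map_add' f f' := MultilinearMap.ext fun g => hc.add_left f f' g
  map_smul' r f := MultilinearMap.ext fun g => hc.smul_left r f g

theorem smul_univ {k : ℕ} {a : ℤ} {n : Fin k → ℕ} {e : Fin k → ℤ} (f : X k a)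
    (g : ∀ j, Y (n j) (e j)) (r : Fin k → R) :
    c f (fun j => r j • g j) = (∏ j, r j) • c f g :=
  (hc.toMultilinear k a n e f).map_smul_univ r g

/-- The composition as a linear function of the entry replaced in a slot. -/
def slot {k : ℕ} {a : ℤ} {n : Fin k → ℕ} {e : Fin k → ℤ} (f : X k a)
    (g : ∀ j, Y (n j) (e j)) (j : Fin k) :
    Y (n j) (e j - 1) →ₗ[R] Z (∑ j, n j) (a + ∑ i, (e i - if i = j then 1 else 0)) :=
  (hc.toMultilinear k a n _ f).toLinearMap (slotFam (Y := fun j => Y (n j)) g j 0) j ∘ₗ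
    famCastₗ R (X := Y) rfl (by rw [if_pos rfl])

theorem slot_apply {k : ℕ} {a : ℤ} {n : Fin k → ℕ} {e : Fin k → ℤ} (f : X k a)
    (g : ∀ j, Y (n j) (e j)) (j : Fin k) (z : Y (n j) (e j - 1)) :
    hc.slot f g j z = c f (slotFam (Y := fun j => Y (n j)) g j z) := by
  change c f _ = _
  congr 1
  funext i
  by_cases h : i = j
  · subst h
    rw [Function.update_self, slotFam_self]
    rfl
  · rw [Function.update_of_ne h, slotFam_of_ne _ h, slotFam_of_ne _ h]

end IsMultilinearComp

end TotalCompLemmas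

/-- The inductive step for evaluations compatible with grafting: if each `v j` is, up to sign, the
composite `c₃ (g j) h`, then `c₄ f v` is, up to sign, the composite `c₂ (c₁ f g) h`. -/
theorem IsAssocComp.step {R : Type u} [CommRing R] {X : ℕ → ℤ → Type v₁} {Y : ℕ → ℤ → Type v₂}
    {Z : ℕ → ℤ → Type v₃} {U : ℕ → ℤ → Type w₁} {V : ℕ → ℤ → Type w₂} {W : ℕ → ℤ → Type w₃}
    [∀ n d, AddCommGroup (X n d)] [∀ n d, Module R (X n d)]
    [∀ n d, AddCommGroup (V n d)] [∀ n d, Module R (V n d)]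
    [∀ n d, AddCommGroup (W n d)] [∀ n d, Module R (W n d)]
    {c₁ : TotalComp X Y U} {c₂ : TotalComp U Z W} {c₃ : TotalComp Y Z V}
    {c₄ : TotalComp X V W} (hA : IsAssocComp R c₁ c₂ c₃ c₄) (hm : IsMultilinearComp R c₄)
    {k : ℕ} {a : ℤ} {n : Fin k → ℕ} {e : Fin k → ℤ} {N : Fin (∑ j, n j) → ℕ}
    {e' : Fin (∑ j, n j) → ℤ} (f : X k a) (g : ∀ j, Y (n j) (e j)) (h : ∀ p, Z (N p) (e' p))
    {n' : Fin k → ℕ} {E : Fin k → ℤ} (r : Fin k → ℤ) (v : ∀ j, V (n' j) (E j))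
    (hn : ∀ j, ∑ i, N (finSigmaFinEquiv ⟨j, i⟩) = n' j)
    (he : ∀ j, e j + ∑ i, e' (finSigmaFinEquiv ⟨j, i⟩) = E j)
    (hv : ∀ j, v j = ksign R (r j) • famCast (X := V) (hn j) (he j)
      (c₃ (g j) fun i => h (finSigmaFinEquiv ⟨j, i⟩))) :
    c₄ f v = ksign R (shuffleExp e (fun j => ∑ i, e' (finSigmaFinEquiv ⟨j, i⟩)) + ∑ j, r j) •
      famCast (X := W) (by rw [sum_finSigmaFinEquiv N]; exact Finset.sum_congr rfl fun j _ => hn j)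
        (by
          rw [sum_finSigmaFinEquiv e', add_assoc, ← Finset.sum_add_distrib]
          exact congrArg _ (Finset.sum_congr rfl fun j _ => he j)) (c₂ (c₁ f g) h) := by
  have h1 : c₂ (c₁ f g) h = _ := hA f g h
  -- pull the signs of the `v j` out of `c₄`, then absorb the transports
  have h2 : c₄ f v = _ := (congrArg (fun v => c₄ f v) (funext hv)).trans (hm.smul_univ f _ _)
  rw [h1, h2, famCast_smul, smul_smul, ksign_add, mul_right_comm, ksign_mul_self, one_mul,
    famCast_famCast, ← ksign_sum]
  congr 1
  exact totalComp_congr c₄ hn he f _ _ fun j => rfl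

/-- The axioms of a nonsymmetric dg operad. -/
structure LawfulOperad {R : Type u} [CommRing R] (P : OperadOps.{u, v} R) : Prop where
  multilinear : IsMultilinearComp R (X := P.X) (Y := P.X) (Z := P.X) P.comp
  assoc : IsAssocComp R (X := P.X) (Y := P.X) (Z := P.X) (U := P.X) (V := P.X) (W := P.X)
    P.comp P.comp P.comp P.comp
  leibniz : IsLeibnizComp R (X := P.X) (Y := P.X) (Z := P.X) P.comp P.d P.d P.d
  one_comp : ∀ {n : Fin 1 → ℕ} {e : Fin 1 → ℤ} (g : ∀ j, P.X (n j) (e j)),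
    P.comp P.one g = famCast (X := P.X)
      (by rw [Fin.sum_univ_one]) (by rw [Fin.sum_univ_one, zero_add]) (g 0)
  comp_one : ∀ {k : ℕ} {a : ℤ} (f : P.X k a),
    P.comp f (n := fun _ => 1) (e := fun _ => 0) (fun _ => P.one) =
      famCast (X := P.X) (by simp) (by simp) f
  d_one : P.d P.one = 0

/-- The axioms of a dg operadic bimodule. -/
structure LawfulBimodule {R : Type u} [CommRing R] {P : OperadOps.{u, v₁} R}
    {Q : OperadOps.{u, v₂} R} (M : BimoduleOps.{u, v} P Q) : Prop where
  lact_multilinear : IsMultilinearComp R (X := P.X) (Y := M.X) (Z := M.X) M.lact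
  ract_multilinear : IsMultilinearComp R (X := M.X) (Y := Q.X) (Z := M.X) M.ract
  lact_assoc : IsAssocComp R (X := P.X) (Y := P.X) (Z := M.X) (U := P.X) (V := M.X) (W := M.X)
    P.comp M.lact M.lact M.lact
  lact_ract : IsAssocComp R (X := P.X) (Y := M.X) (Z := Q.X) (U := M.X) (V := M.X) (W := M.X)
    M.lact M.ract M.ract M.lact
  ract_assoc : IsAssocComp R (X := M.X) (Y := Q.X) (Z := Q.X) (U := M.X) (V := Q.X) (W := M.X)
    M.ract M.ract Q.comp M.ract
  lact_leibniz : IsLeibnizComp R (X := P.X) (Y := M.X) (Z := M.X) M.lact P.d M.d M.d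
  ract_leibniz : IsLeibnizComp R (X := M.X) (Y := Q.X) (Z := M.X) M.ract M.d Q.d M.d
  one_lact : ∀ {n : Fin 1 → ℕ} {e : Fin 1 → ℤ} (g : ∀ j, M.X (n j) (e j)),
    M.lact P.one g = famCast (X := M.X)
      (by rw [Fin.sum_univ_one]) (by rw [Fin.sum_univ_one, zero_add]) (g 0)
  ract_one : ∀ {k : ℕ} {a : ℤ} (f : M.X k a),
    M.ract f (n := fun _ => 1) (e := fun _ => 0) (fun _ => Q.one) =
      famCast (X := M.X) (by simp) (by simp) f

section Instances

variable {R : Type u} [CommRing R]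

/-- The operad `End_A` satisfies the axioms of a dg operad. -/
theorem endOp_lawful (A : DGMod.{u, v} R) : LawfulOperad (EndOp A) where
  multilinear := mulComp_multilinear A A A
  assoc := mulComp_assoc A A A A
  leibniz := mulComp_leibniz A A A
  one_comp g := mulComp_one_left g
  comp_one f := mulComp_one_right f
  d_one := mulDiff_one A

/-- The operad `coEnd_C` satisfies the axioms of a dg operad. -/
theorem coEndOp_lawful (C : DGMod.{u, v} R) : LawfulOperad (CoEndOp C) where
  multilinear := comulComp_multilinear C C C
  assoc := comulComp_assoc C C C C
  leibniz := comulComp_leibniz C C C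
  one_comp g := comulComp_one_left g
  comp_one f := comulComp_one_right f
  d_one := comulDiff_one C

theorem homBi_lawful (A : DGMod.{u, v₁} R) (B : DGMod.{u, v₂} R) : LawfulBimodule (HomBi A B) where
  lact_multilinear := mulComp_multilinear A B B
  ract_multilinear := mulComp_multilinear A A B
  lact_assoc := mulComp_assoc A B B B
  lact_ract := mulComp_assoc A A B B
  ract_assoc := mulComp_assoc A A A B
  lact_leibniz := mulComp_leibniz A B B
  ract_leibniz := mulComp_leibniz A A B
  one_lact g := mulComp_one_left g
  ract_one f := mulComp_one_right f

theorem coHomBi_lawful (C : DGMod.{u, v₁} R) (D : DGMod.{u, v₂} R) :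
    LawfulBimodule (CoHomBi C D) where
  lact_multilinear := comulComp_multilinear C C D
  ract_multilinear := comulComp_multilinear C D D
  lact_assoc := comulComp_assoc C C C D
  lact_ract := comulComp_assoc C C D D
  ract_assoc := comulComp_assoc C D D D
  lact_leibniz := comulComp_leibniz C C D
  ract_leibniz := comulComp_leibniz C D D
  one_lact g := comulComp_one_left g
  ract_one f := comulComp_one_right f

end Instances

/-! ### Evaluation of trees is compatible with grafting -/

section Grafting

variable {R : Type u} [CommRing R]

theorem OperadOps.evalTree_congr (P : OperadOps.{u, v} R)
    (op : ∀ n : ℕ, 2 ≤ n → P.X n ((n : ℤ) - 2)) {t t' : Tree} (h : t = t') :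
    P.evalTree op t' = famCast (X := P.X) (by rw [h]) (by rw [h]) (P.evalTree op t) := by
  subst h; rfl

theorem BimoduleOps.evalTree_congr {P : OperadOps.{u, v₁} R} {Q : OperadOps.{u, v₂} R}
    (M : BimoduleOps.{u, v} P Q)
    (opP : ∀ n : ℕ, 2 ≤ n → P.X n ((n : ℤ) - 2)) (opQ : ∀ n : ℕ, 2 ≤ n → Q.X n ((n : ℤ) - 2))
    (op : ∀ n : ℕ, 1 ≤ n → M.X n ((n : ℤ) - 1)) {t t' : MTree} (h : t = t') :
    M.evalTree opP opQ op t' =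
      famCast (X := M.X) (by rw [h]) (by rw [h]) (M.evalTree opP opQ op t) := by
  subst h; rfl

theorem OperadOps.evalTreeN_eq (P : OperadOps.{u, v} R)
    (op : ∀ n : ℕ, 2 ≤ n → P.X n ((n : ℤ) - 2)) {n : ℕ} {d : ℤ} (t : TreeN n d) :
    P.evalTreeN op t = famCast (X := P.X) t.2.1 t.2.2 (P.evalTree op t.1) := rfl

theorem BimoduleOps.evalTreeN_eq {P : OperadOps.{u, v₁} R} {Q : OperadOps.{u, v₂} R}
    (M : BimoduleOps.{u, v} P Q)
    (opP : ∀ n : ℕ, 2 ≤ n → P.X n ((n : ℤ) - 2)) (opQ : ∀ n : ℕ, 2 ≤ n → Q.X n ((n : ℤ) - 2))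
    (op : ∀ n : ℕ, 1 ≤ n → M.X n ((n : ℤ) - 1)) {n : ℕ} {d : ℤ} (t : MTreeN n d) :
    M.evalTreeN opP opQ op t = famCast (X := M.X) t.2.1 t.2.2 (M.evalTree opP opQ op t.1) := rfl

theorem LawfulOperad.evalTree_one_comp {P : OperadOps.{u, v} R} (hP : LawfulOperad P)
    (op : ∀ n : ℕ, 2 ≤ n → P.X n ((n : ℤ) - 2)) {n : Fin 1 → ℕ} {e : Fin 1 → ℤ}
    (s : ∀ j, TreeN (n j) (e j)) (hn : ∑ j, n j = (s 0).1.leaves)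
    (he : 0 + ∑ j, e j = (s 0).1.deg) :
    P.evalTree op (s 0).1 =
      famCast (X := P.X) hn he (P.comp P.one fun j => P.evalTreeN op (s j)) := by
  rw [hP.one_comp, P.evalTreeN_eq, famCast_famCast, famCast_famCast, famCast_rfl]

theorem LawfulBimodule.evalTree_one_lact {P : OperadOps.{u, v₁} R} {Q : OperadOps.{u, v₂} R}
    {M : BimoduleOps.{u, v} P Q} (hM : LawfulBimodule M)
    (opP : ∀ n : ℕ, 2 ≤ n → P.X n ((n : ℤ) - 2)) (opQ : ∀ n : ℕ, 2 ≤ n → Q.X n ((n : ℤ) - 2))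
    (op : ∀ n : ℕ, 1 ≤ n → M.X n ((n : ℤ) - 1)) {n : Fin 1 → ℕ} {e : Fin 1 → ℤ}
    (s : ∀ j, MTreeN (n j) (e j)) (hn : ∑ j, n j = (s 0).1.leaves)
    (he : 0 + ∑ j, e j = (s 0).1.deg) :
    M.evalTree opP opQ op (s 0).1 =
      famCast (X := M.X) hn he (M.lact P.one fun j => M.evalTreeN opP opQ op (s j)) := by
  rw [hM.one_lact, M.evalTreeN_eq, famCast_famCast, famCast_famCast, famCast_rfl]

/-- Evaluating a grafted tree is composing the evaluations. The induction is on the lower tree, with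
the associativity law at its root; `graftExp` collects the signs. -/
theorem OperadOps.evalTree_graft {P : OperadOps.{u, v} R} (hP : LawfulOperad P)
    (op : ∀ n : ℕ, 2 ≤ n → P.X n ((n : ℤ) - 2)) : ∀ (t : Tree) {n : Fin t.leaves → ℕ}
    {e : Fin t.leaves → ℤ} (s : ∀ j, TreeN (n j) (e j)),
    P.evalTree op (t.graft fun i => (s i).1) = ksign R (t.graftExp e) •
      famCast (X := P.X) (TreeN.graft (⟨t, rfl, rfl⟩ : TreeN t.leaves t.deg) s).2.1.symm
        (TreeN.graft (⟨t, rfl, rfl⟩ : TreeN t.leaves t.deg) s).2.2.symm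
        (P.comp (P.evalTree op t) fun j => P.evalTreeN op (s j))
  | Tree.leaf, n, e, s => by
    have h2 : ksign R (Tree.leaf.graftExp e) = 1 := ksign_zero R
    rw [h2, one_smul]
    exact hP.evalTree_one_comp op s _ _
  | Tree.node m hm c, n, e, s => by
    have ih := fun j => evalTree_graft hP op (c j) fun i => s (finSigmaFinEquiv ⟨j, i⟩)
    exact IsAssocComp.step hP.assoc hP.multilinear (op m hm) (fun j => P.evalTree op (c j))
      (fun p => P.evalTreeN op (s p)) _ _ _ _ ih

theorem OperadOps.evalTreeN_graft {P : OperadOps.{u, v} R} (hP : LawfulOperad P)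
    (op : ∀ n : ℕ, 2 ≤ n → P.X n ((n : ℤ) - 2)) {k : ℕ} {a : ℤ} {n : Fin k → ℕ} {e : Fin k → ℤ}
    (t : TreeN k a) (s : ∀ j, TreeN (n j) (e j)) :
    P.evalTreeN op (t.graft s) = ksign R (t.graftExp e) •
      P.comp (P.evalTreeN op t) fun j => P.evalTreeN op (s j) := by
  obtain ⟨t, rfl, rfl⟩ := t
  have h : P.evalTree op (TreeN.graft (⟨t, rfl, rfl⟩ : TreeN t.leaves t.deg) s).1 = _ :=
    evalTree_graft hP op t s
  rw [P.evalTreeN_eq, h, famCast_smul, famCast_famCast]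
  rfl

/-- Grafting two-coloured trees on a tree of operations evaluates to the left action. -/
theorem BimoduleOps.evalTree_lgraft {P : OperadOps.{u, v₁} R} {Q : OperadOps.{u, v₂} R}
    {M : BimoduleOps.{u, v} P Q} (hM : LawfulBimodule M)
    (opP : ∀ n : ℕ, 2 ≤ n → P.X n ((n : ℤ) - 2)) (opQ : ∀ n : ℕ, 2 ≤ n → Q.X n ((n : ℤ) - 2))
    (op : ∀ n : ℕ, 1 ≤ n → M.X n ((n : ℤ) - 1)) : ∀ (t : Tree) {n : Fin t.leaves → ℕ}
    {e : Fin t.leaves → ℤ} (s : ∀ j, MTreeN (n j) (e j)),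
    M.evalTree opP opQ op (MTree.lgraft t fun i => (s i).1) = ksign R (t.graftExp e) •
      famCast (X := M.X) (MTreeN.lgraft (⟨t, rfl, rfl⟩ : TreeN t.leaves t.deg) s).2.1.symm
        (MTreeN.lgraft (⟨t, rfl, rfl⟩ : TreeN t.leaves t.deg) s).2.2.symm
        (M.lact (P.evalTree opP t) fun j => M.evalTreeN opP opQ op (s j))
  | Tree.leaf, n, e, s => by
    have h2 : ksign R (Tree.leaf.graftExp e) = 1 := ksign_zero R
    rw [h2, one_smul]
    exact hM.evalTree_one_lact opP opQ op s _ _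
  | Tree.node m hm c, n, e, s => by
    have ih := fun j => evalTree_lgraft hM opP opQ op (c j) fun i => s (finSigmaFinEquiv ⟨j, i⟩)
    exact IsAssocComp.step hM.lact_assoc hM.lact_multilinear (opP m hm)
      (fun j => P.evalTree opP (c j))
      (fun p => M.evalTreeN opP opQ op (s p)) _ _ _ _ ih

theorem BimoduleOps.evalTreeN_lgraft {P : OperadOps.{u, v₁} R} {Q : OperadOps.{u, v₂} R}
    {M : BimoduleOps.{u, v} P Q} (hM : LawfulBimodule M)
    (opP : ∀ n : ℕ, 2 ≤ n → P.X n ((n : ℤ) - 2)) (opQ : ∀ n : ℕ, 2 ≤ n → Q.X n ((n : ℤ) - 2))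
    (op : ∀ n : ℕ, 1 ≤ n → M.X n ((n : ℤ) - 1)) {k : ℕ} {a : ℤ} {n : Fin k → ℕ} {e : Fin k → ℤ}
    (t : TreeN k a) (s : ∀ j, MTreeN (n j) (e j)) :
    M.evalTreeN opP opQ op (MTreeN.lgraft t s) = ksign R (t.graftExp e) •
      M.lact (P.evalTreeN opP t) fun j => M.evalTreeN opP opQ op (s j) := by
  obtain ⟨t, rfl, rfl⟩ := t
  have h : M.evalTree opP opQ op (MTreeN.lgraft (⟨t, rfl, rfl⟩ : TreeN t.leaves t.deg) s).1 = _ :=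
    evalTree_lgraft hM opP opQ op t s
  rw [M.evalTreeN_eq, h, famCast_smul, famCast_famCast]
  rfl

/-- Grafting trees of operations on a two-coloured tree evaluates to the right action. At a vertex
of morphism type this is the associativity of the right action, at the other vertices the
compatibility of the left action with the right one. -/
theorem BimoduleOps.evalTree_rgraft {P : OperadOps.{u, v₁} R} {Q : OperadOps.{u, v₂} R}
    {M : BimoduleOps.{u, v} P Q} (hM : LawfulBimodule M) (hQ : LawfulOperad Q)
    (opP : ∀ n : ℕ, 2 ≤ n → P.X n ((n : ℤ) - 2)) (opQ : ∀ n : ℕ, 2 ≤ n → Q.X n ((n : ℤ) - 2))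
    (op : ∀ n : ℕ, 1 ≤ n → M.X n ((n : ℤ) - 1)) : ∀ (t : MTree) {n : Fin t.leaves → ℕ}
    {e : Fin t.leaves → ℤ} (s : ∀ j, TreeN (n j) (e j)),
    M.evalTree opP opQ op (t.rgraft fun i => (s i).1) = ksign R (t.rgraftExp e) •
      famCast (X := M.X) (MTreeN.rgraft (⟨t, rfl, rfl⟩ : MTreeN t.leaves t.deg) s).2.1.symm
        (MTreeN.rgraft (⟨t, rfl, rfl⟩ : MTreeN t.leaves t.deg) s).2.2.symm
        (M.ract (M.evalTree opP opQ op t) fun j => Q.evalTreeN opQ (s j))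
  | MTree.mor m hm c, n, e, s => by
    have ih := fun j =>
      OperadOps.evalTree_graft hQ opQ (c j) fun i => s (finSigmaFinEquiv ⟨j, i⟩)
    exact IsAssocComp.step hM.ract_assoc hM.ract_multilinear (op m hm)
      (fun j => Q.evalTree opQ (c j))
      (fun p => Q.evalTreeN opQ (s p)) _ _ _ _ ih
  | MTree.node m hm c, n, e, s => by
    have ih := fun j =>
      evalTree_rgraft hM hQ opP opQ op (c j) fun i => s (finSigmaFinEquiv ⟨j, i⟩)
    exact IsAssocComp.step hM.lact_ract hM.lact_multilinear (opP m hm)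
      (fun j => M.evalTree opP opQ op (c j)) (fun p => Q.evalTreeN opQ (s p)) _ _ _ _ ih

theorem BimoduleOps.evalTreeN_rgraft {P : OperadOps.{u, v₁} R} {Q : OperadOps.{u, v₂} R}
    {M : BimoduleOps.{u, v} P Q} (hM : LawfulBimodule M) (hQ : LawfulOperad Q)
    (opP : ∀ n : ℕ, 2 ≤ n → P.X n ((n : ℤ) - 2)) (opQ : ∀ n : ℕ, 2 ≤ n → Q.X n ((n : ℤ) - 2))
    (op : ∀ n : ℕ, 1 ≤ n → M.X n ((n : ℤ) - 1)) {k : ℕ} {a : ℤ} {n : Fin k → ℕ} {e : Fin k → ℤ}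
    (t : MTreeN k a) (s : ∀ j, TreeN (n j) (e j)) :
    M.evalTreeN opP opQ op (t.rgraft s) = ksign R (t.rgraftExp e) •
      M.ract (M.evalTreeN opP opQ op t) fun j => Q.evalTreeN opQ (s j) := by
  obtain ⟨t, rfl, rfl⟩ := t
  have h : M.evalTree opP opQ op (MTreeN.rgraft (⟨t, rfl, rfl⟩ : MTreeN t.leaves t.deg) s).1 = _ :=
    evalTree_rgraft hM hQ opP opQ op t s
  rw [M.evalTreeN_eq, h, famCast_smul, famCast_famCast]
  rfl

end Grafting

/-! ### Evaluation of trees is compatible with the differentials -/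

section Differential

variable {R : Type u} [CommRing R]

/-- The inductive step for evaluations compatible with the differential: the Leibniz rule, where the
differentials of `f` and of the `g j` are given as linear combinations of evaluations. -/
theorem IsLeibnizComp.step {X : ℕ → ℤ → Type v₁} {Y : ℕ → ℤ → Type v₂} {Z : ℕ → ℤ → Type v₃}
    [∀ n d, AddCommGroup (X n d)] [∀ n d, Module R (X n d)] [∀ n d, AddCommGroup (Y n d)]
    [∀ n d, Module R (Y n d)] [∀ n d, AddCommGroup (Z n d)] [∀ n d, Module R (Z n d)]
    {c : TotalComp X Y Z} {dX : ∀ {n : ℕ} {a : ℤ}, X n a →ₗ[R] X n (a - 1)}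
    {dY : ∀ {n : ℕ} {a : ℤ}, Y n a →ₗ[R] Y n (a - 1)}
    {dZ : ∀ {n : ℕ} {a : ℤ}, Z n a →ₗ[R] Z n (a - 1)} (hm : IsMultilinearComp R c)
    (hL : IsLeibnizComp R c dX dY dZ) {k : ℕ} {a : ℤ} {n : Fin k → ℕ} {e : Fin k → ℤ}
    (f : X k a) (g : ∀ j, Y (n j) (e j)) {B : Fin k → Type w} (b : ∀ j, B j →₀ R)
    (v : ∀ j, B j → Y (n j) (e j - 1))
    (hb : ∀ j, dY (g j) = Finsupp.linearCombination R (v j) (b j))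
    {n' : ℕ} {d' : ℤ} (hn' : ∑ j, n j = n') (hd' : a + ∑ j, e j - 1 = d' )
    (v' : ∀ j, B j → Z n' d')
    (hv' : ∀ j s, famCast (X := Z) hn' ((sum_sub_ite_eq a e j).trans hd')
      (c f (slotFam (Y := fun j => Y (n j)) g j (v j s))) = v' j s) :
    famCast (X := Z) hn' hd' (dZ (c f g)) =
      famCast (X := Z) hn' ((sub_add_eq_add_sub _ _ _).trans hd') (c (dX f) g) +
      ∑ j, ksign R (a + ∑ i ∈ Finset.Iio j, e i) • Finsupp.linearCombination R (v' j) (b j) := by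
  subst hn' hd'
  have h0 : dZ (c f g) = _ := hL f g
  rw [famCast_rfl, h0]
  congr 1
  refine Finset.sum_congr rfl fun j _ => ?_
  congr 1
  rw [hb j, degCast_eq_famCast]
  beta_reduce
  have h1 : c f (slotFam (Y := fun j => Y (n j)) g j
      (Finsupp.linearCombination R (v j) (b j))) = _ :=
    (hm.slot_apply f g j _).symm
  rw [h1, famCast_eq_famCastₗ R, ← LinearMap.comp_apply, Finsupp.apply_linearCombination]
  congr 2
  funext s
  rw [← hv' j s]
  exact congrArg (fun z => famCast (X := Z) rfl (sum_sub_ite_eq a e j) z)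
    (hm.slot_apply f g j (v j s))

/-- A total composition with fixed right entries, followed by a transport, as a linear map. -/
def IsMultilinearComp.left {X : ℕ → ℤ → Type v₁} {Y : ℕ → ℤ → Type v₂} {Z : ℕ → ℤ → Type v₃}
    [∀ n d, AddCommGroup (X n d)] [∀ n d, Module R (X n d)] [∀ n d, AddCommGroup (Y n d)]
    [∀ n d, Module R (Y n d)] [∀ n d, AddCommGroup (Z n d)] [∀ n d, Module R (Z n d)]
    {c : TotalComp X Y Z} (hc : IsMultilinearComp R c) {k : ℕ} {a : ℤ} {n : Fin k → ℕ}
    {e : Fin k → ℤ} (g : ∀ j, Y (n j) (e j)) {n' : ℕ} {d' : ℤ} (hn : ∑ j, n j = n')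
    (hd : a + ∑ j, e j = d') : X k a →ₗ[R] Z n' d' where
  toFun f := famCast (X := Z) hn hd (c f g)
  map_add' f f' := by
    have h : c (f + f') g = _ := hc.add_left f f' g
    rw [h]
    exact (famCastₗ R (X := Z) hn hd).map_add _ _
  map_smul' r f := by
    have h : c (r • f) g = _ := hc.smul_left r f g
    rw [h]
    exact (famCastₗ R (X := Z) hn hd).map_smul _ _

theorem IsMultilinearComp.left_apply {X : ℕ → ℤ → Type v₁} {Y : ℕ → ℤ → Type v₂}
    {Z : ℕ → ℤ → Type v₃}
    [∀ n d, AddCommGroup (X n d)] [∀ n d, Module R (X n d)] [∀ n d, AddCommGroup (Y n d)]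
    [∀ n d, Module R (Y n d)] [∀ n d, AddCommGroup (Z n d)] [∀ n d, Module R (Z n d)]
    {c : TotalComp X Y Z} (hc : IsMultilinearComp R c) {k : ℕ} {a : ℤ} {n : Fin k → ℕ}
    {e : Fin k → ℤ} (g : ∀ j, Y (n j) (e j)) {n' : ℕ} {d' : ℤ} (hn : ∑ j, n j = n')
    (hd : a + ∑ j, e j = d') (f : X k a) : hc.left g hn hd f = famCast (X := Z) hn hd (c f g) :=
  rfl

theorem OperadOps.evalTreeN_cast (P : OperadOps.{u, v} R)
    (op : ∀ n : ℕ, 2 ≤ n → P.X n ((n : ℤ) - 2)) {n n' : ℕ} {d d' : ℤ} (hn : n = n') (hd : d = d')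
    (t : TreeN n d) : P.evalTreeN op (TreeN.cast hn hd t) =
      famCast (X := P.X) hn hd (P.evalTreeN op t) := by
  subst hn hd; rfl

theorem BimoduleOps.evalTreeN_cast {P : OperadOps.{u, v₁} R} {Q : OperadOps.{u, v₂} R}
    (M : BimoduleOps.{u, v} P Q)
    (opP : ∀ n : ℕ, 2 ≤ n → P.X n ((n : ℤ) - 2)) (opQ : ∀ n : ℕ, 2 ≤ n → Q.X n ((n : ℤ) - 2))
    (op : ∀ n : ℕ, 1 ≤ n → M.X n ((n : ℤ) - 1)) {n n' : ℕ} {d d' : ℤ} (hn : n = n') (hd : d = d')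
    (t : MTreeN n d) : M.evalTreeN opP opQ op (MTreeN.cast hn hd t) =
      famCast (X := M.X) hn hd (M.evalTreeN opP opQ op t) := by
  subst hn hd; rfl

theorem Tree.leaves_update {k : ℕ} (c : Fin k → Tree) (j : Fin k) {d : ℤ}
    (s : TreeN (c j).leaves d) (i : Fin k) :
    (c i).leaves = (Function.update c j s.1 i).leaves := by
  by_cases h : i = j
  · subst h
    rw [Function.update_self, s.2.1]
  · rw [Function.update_of_ne h]

theorem Tree.deg_update {k : ℕ} (c : Fin k → Tree) (j : Fin k)
    (s : TreeN (c j).leaves ((c j).deg - 1)) (i : Fin k) :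
    (c i).deg - (if i = j then 1 else 0) = (Function.update c j s.1 i).deg := by
  by_cases h : i = j
  · subst h
    rw [Function.update_self, s.2.2, if_pos rfl]
  · rw [Function.update_of_ne h, if_neg h, sub_zero]

theorem Tree.sum_deg_update {k : ℕ} (a : ℤ) (c : Fin k → Tree) (j : Fin k)
    (s : TreeN (c j).leaves ((c j).deg - 1)) :
    a + ∑ i, (Function.update c j s.1 i).deg = a + ∑ i, (c i).deg - 1 := by
  rw [← sum_sub_ite_eq a _ j]
  exact congrArg _ (Finset.sum_congr rfl fun i _ => (Tree.deg_update c j s i).symm)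

/-- The tree `γ(m_k; c₁, …, c_k)` with its `j`-th branch replaced by `s`, of degree one less. -/
def Tree.nodeUpdate (k : ℕ) (h : 2 ≤ k) (c : Fin k → Tree) (j : Fin k)
    (s : TreeN (c j).leaves ((c j).deg - 1)) :
    TreeN (∑ j, (c j).leaves) (((k : ℤ) - 2) + ∑ j, (c j).deg - 1) :=
  ⟨Tree.node k h (Function.update c j s.1),
    (Finset.sum_congr rfl fun i _ => Tree.leaves_update c j s i).symm, Tree.sum_deg_update _ c j s⟩

/-- The differential of a tree by the Leibniz rule at its root: a sum over the differential of the
corolla at the root and a sum over the differentials of the branches. -/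
theorem Tree.bd_node (k : ℕ) (h : 2 ≤ k) (c : Fin k → Tree) :
    Tree.bd R (Tree.node k h c) = -(∑ x : ProperSplit k, Finsupp.single
        (TreeN.cast (n' := ∑ j, (c j).leaves) (d' := ((k : ℤ) - 2) + ∑ j, (c j).deg - 1) rfl
          (sub_add_eq_add_sub _ _ _)
          (TreeN.graft (x.1.facet x.2) fun j => (⟨c j, rfl, rfl⟩ : TreeN _ _)))
        (ksign R (x.1.exp + (x.1.facet x.2).graftExp fun j => (c j).deg))) +
    ∑ j, ksign R (((k : ℤ) - 2) + ∑ i ∈ Finset.Iio j, (c i).deg) •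
      (Tree.bd R (c j)).mapDomain (Tree.nodeUpdate k h c j) := by
  rw [Tree.bd]
  rfl

/-- Evaluating the branches after replacing the `j`-th one is replacing the evaluation of the `j`-th
branch. -/
theorem OperadOps.evalTree_update (P : OperadOps.{u, v} R)
    (op : ∀ n : ℕ, 2 ≤ n → P.X n ((n : ℤ) - 2)) {k : ℕ} (c : Fin k → Tree) (j : Fin k)
    (s : TreeN (c j).leaves ((c j).deg - 1)) (i : Fin k) :
    P.evalTree op (Function.update c j s.1 i) = famCast (X := P.X) (Tree.leaves_update c j s i)
      (Tree.deg_update c j s i) (slotFam (Y := fun j => P.X (c j).leaves)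
        (fun j => P.evalTree op (c j)) j (P.evalTreeN op s) i) := by
  by_cases h : i = j
  · subst h
    rw [slotFam_self, degCast_eq_famCast, famCast_famCast, P.evalTreeN_eq, famCast_famCast]
    exact P.evalTree_congr op (Function.update_self i s.1 c).symm
  · rw [slotFam_of_ne _ h, degCast_eq_famCast, famCast_famCast]
    exact P.evalTree_congr op (Function.update_of_ne h s.1 c).symm

theorem OperadOps.evalTreeN_nodeUpdate (P : OperadOps.{u, v} R)
    (op : ∀ n : ℕ, 2 ≤ n → P.X n ((n : ℤ) - 2)) {k : ℕ} (h : 2 ≤ k) (c : Fin k → Tree) (j : Fin k)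
    (s : TreeN (c j).leaves ((c j).deg - 1)) :
    famCast (X := P.X) rfl (sum_sub_ite_eq _ _ j) (P.comp (op k h)
      (slotFam (Y := fun j => P.X (c j).leaves) (fun j => P.evalTree op (c j)) j
        (P.evalTreeN op s))) = P.evalTreeN op (Tree.nodeUpdate k h c j s) := by
  have h1 : P.comp (op k h) (fun i => P.evalTree op (Function.update c j s.1 i)) = _ :=
    totalComp_congr P.comp _ _ (op k h) _ _ (P.evalTree_update op c j s)
  change _ = famCast (X := P.X)
    (Finset.sum_congr rfl fun i _ => Tree.leaves_update c j s i).symm (Tree.sum_deg_update _ c j s)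
    (P.comp (op k h) fun i => P.evalTree op (Function.update c j s.1 i))
  rw [h1, famCast_famCast]

/-- Evaluation of trees commutes with the differentials. By induction on the tree this follows from
the Leibniz rule at the root, where the defining relations of an `A_∞`-structure express the
differential of the operation at the root. -/
theorem OperadOps.d_evalTree {P : OperadOps.{u, v} R} (hP : LawfulOperad P) (μ : AInfStr P) :
    ∀ t : Tree, P.d (P.evalTree μ.op t) =
      Finsupp.linearCombination R (fun s : TreeN t.leaves (t.deg - 1) => P.evalTreeN μ.op s)
        (t.bd R)
  | Tree.leaf => by
    rw [Tree.bd, map_zero]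
    exact hP.d_one
  | Tree.node m hm c => by
    have ih := fun j => d_evalTree hP μ (c j)
    have h := IsLeibnizComp.step hP.multilinear hP.leibniz (μ.op m hm)
      (fun j => P.evalTree μ.op (c j)) (fun j => (c j).bd R)
      (fun j (s : TreeN (c j).leaves ((c j).deg - 1)) => P.evalTreeN μ.op s) ih rfl rfl
      (fun j s => P.evalTreeN μ.op (Tree.nodeUpdate m hm c j s))
      (P.evalTreeN_nodeUpdate μ.op hm c)
    rw [← IsMultilinearComp.left_apply hP.multilinear, μ.rel] at h
    refine h.trans (Eq.trans ?_ (congrArg (Finsupp.linearCombination R fun s : TreeN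
      (∑ j, (c j).leaves) (((m : ℤ) - 2) + ∑ j, (c j).deg - 1) => P.evalTreeN μ.op s)
      (Tree.bd_node m hm c)).symm)
    simp only [map_add, map_neg, map_sum, map_smul, Finsupp.linearCombination_single,
      Finsupp.linearCombination_mapDomain]
    refine congrArg₂ (· + ·) (congrArg Neg.neg (Finset.sum_congr rfl fun x _ => ?_)) rfl
    rw [P.evalTreeN_cast, P.evalTreeN_graft hP, IsMultilinearComp.left_apply, famCast_smul,
      smul_smul, ksign_add, mul_assoc, ksign_mul_self, mul_one]
    rfl

end Differential

section DifferentialBimodule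

variable {R : Type u} [CommRing R]

theorem OperadOps.d_evalTreeN {P : OperadOps.{u, v} R} (hP : LawfulOperad P) (μ : AInfStr P)
    {n : ℕ} {d : ℤ} (t : TreeN n d) : P.d (P.evalTreeN μ.op t) =
      Finsupp.linearCombination R
        (fun s : TreeN t.1.leaves (t.1.deg - 1) =>
          P.evalTreeN μ.op (TreeN.cast t.2.1 (congrArg (· - 1) t.2.2) s)) (t.1.bd R) := by
  obtain ⟨t, rfl, rfl⟩ := t
  exact d_evalTree hP μ t

/-- The two-coloured tree `ρ(f_k; c₁, …, c_k)` with its `j`-th branch replaced by `s`, of degree one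
less. -/
def MTree.morUpdate (k : ℕ) (h : 1 ≤ k) (c : Fin k → Tree) (j : Fin k)
    (s : TreeN (c j).leaves ((c j).deg - 1)) :
    MTreeN (∑ j, (c j).leaves) (((k : ℤ) - 1) + ∑ j, (c j).deg - 1) :=
  ⟨MTree.mor k h (Function.update c j s.1),
    (Finset.sum_congr rfl fun i _ => Tree.leaves_update c j s i).symm, Tree.sum_deg_update _ c j s⟩

/-- The differential of a two-coloured tree with a vertex of morphism type at its root, by the
Leibniz rule at that vertex. -/
theorem MTree.bd_mor (k : ℕ) (h : 1 ≤ k) (c : Fin k → Tree) :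
    MTree.bd R (MTree.mor k h c) = (∑ x : Split k, Finsupp.single
        (MTreeN.cast (n' := ∑ j, (c j).leaves) (d' := ((k : ℤ) - 1) + ∑ j, (c j).deg - 1) rfl
          (sub_add_eq_add_sub _ _ _)
          (MTreeN.rgraft x.upperFacet fun j => (⟨c j, rfl, rfl⟩ : TreeN _ _)))
        (ksign R (x.exp + x.upperFacet.rgraftExp fun j => (c j).deg))) -
    (∑ x : ProperComposition k, Finsupp.single
        (MTreeN.cast (n' := ∑ j, (c j).leaves) (d' := ((k : ℤ) - 1) + ∑ j, (c j).deg - 1) rfl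
          (sub_add_eq_add_sub _ _ _)
          (MTreeN.rgraft x.lowerFacet fun j => (⟨c j, rfl, rfl⟩ : TreeN _ _)))
        (ksign R (x.exp + x.lowerFacet.rgraftExp fun j => (c j).deg))) +
    ∑ j, ksign R (((k : ℤ) - 1) + ∑ i ∈ Finset.Iio j, (c i).deg) •
      (Tree.bd R (c j)).mapDomain (MTree.morUpdate k h c j) := by
  rw [MTree.bd]
  rfl

theorem MTree.leaves_update {k : ℕ} (c : Fin k → MTree) (j : Fin k) {d : ℤ}
    (s : MTreeN (c j).leaves d) (i : Fin k) :
    (c i).leaves = (Function.update c j s.1 i).leaves := by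
  by_cases h : i = j
  · subst h
    rw [Function.update_self, s.2.1]
  · rw [Function.update_of_ne h]

theorem MTree.deg_update {k : ℕ} (c : Fin k → MTree) (j : Fin k)
    (s : MTreeN (c j).leaves ((c j).deg - 1)) (i : Fin k) :
    (c i).deg - (if i = j then 1 else 0) = (Function.update c j s.1 i).deg := by
  by_cases h : i = j
  · subst h
    rw [Function.update_self, s.2.2, if_pos rfl]
  · rw [Function.update_of_ne h, if_neg h, sub_zero]

theorem MTree.sum_deg_update {k : ℕ} (a : ℤ) (c : Fin k → MTree) (j : Fin k)
    (s : MTreeN (c j).leaves ((c j).deg - 1)) :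
    a + ∑ i, (Function.update c j s.1 i).deg = a + ∑ i, (c i).deg - 1 := by
  rw [← sum_sub_ite_eq a _ j]
  exact congrArg _ (Finset.sum_congr rfl fun i _ => (MTree.deg_update c j s i).symm)

/-- The two-coloured tree `λ(m_k; c₁, …, c_k)` with its `j`-th branch replaced by `s`, of degree one
less. -/
def MTree.nodeUpdate (k : ℕ) (h : 2 ≤ k) (c : Fin k → MTree) (j : Fin k)
    (s : MTreeN (c j).leaves ((c j).deg - 1)) :
    MTreeN (∑ j, (c j).leaves) (((k : ℤ) - 2) + ∑ j, (c j).deg - 1) :=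
  ⟨MTree.node k h (Function.update c j s.1),
    (Finset.sum_congr rfl fun i _ => MTree.leaves_update c j s i).symm,
    MTree.sum_deg_update _ c j s⟩

/-- The differential of a two-coloured tree with an operation at its root, by the Leibniz rule at
the root. -/
theorem MTree.bd_node (k : ℕ) (h : 2 ≤ k) (c : Fin k → MTree) :
    MTree.bd R (MTree.node k h c) = -(∑ x : ProperSplit k, Finsupp.single
        (MTreeN.cast (n' := ∑ j, (c j).leaves) (d' := ((k : ℤ) - 2) + ∑ j, (c j).deg - 1) rfl
          (sub_add_eq_add_sub _ _ _)
          (MTreeN.lgraft (x.1.facet x.2) fun j => (⟨c j, rfl, rfl⟩ : MTreeN _ _)))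
        (ksign R (x.1.exp + (x.1.facet x.2).graftExp fun j => (c j).deg))) +
    ∑ j, ksign R (((k : ℤ) - 2) + ∑ i ∈ Finset.Iio j, (c i).deg) •
      (MTree.bd R (c j)).mapDomain (MTree.nodeUpdate k h c j) := by
  rw [MTree.bd]
  rfl

variable {P : OperadOps.{u, v₁} R} {Q : OperadOps.{u, v₂} R}

theorem BimoduleOps.evalTreeN_morUpdate (M : BimoduleOps.{u, v} P Q)
    (opP : ∀ n : ℕ, 2 ≤ n → P.X n ((n : ℤ) - 2)) (opQ : ∀ n : ℕ, 2 ≤ n → Q.X n ((n : ℤ) - 2))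
    (op : ∀ n : ℕ, 1 ≤ n → M.X n ((n : ℤ) - 1)) {k : ℕ} (h : 1 ≤ k) (c : Fin k → Tree) (j : Fin k)
    (s : TreeN (c j).leaves ((c j).deg - 1)) :
    famCast (X := M.X) rfl (sum_sub_ite_eq _ _ j) (M.ract (op k h)
      (slotFam (Y := fun j => Q.X (c j).leaves) (fun j => Q.evalTree opQ (c j)) j
        (Q.evalTreeN opQ s))) = M.evalTreeN opP opQ op (MTree.morUpdate k h c j s) := by
  have h1 : M.ract (op k h) (fun i => Q.evalTree opQ (Function.update c j s.1 i)) = _ :=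
    totalComp_congr M.ract _ _ (op k h) _ _ (Q.evalTree_update opQ c j s)
  change _ = famCast (X := M.X)
    (Finset.sum_congr rfl fun i _ => Tree.leaves_update c j s i).symm (Tree.sum_deg_update _ c j s)
    (M.ract (op k h) fun i => Q.evalTree opQ (Function.update c j s.1 i))
  rw [h1, famCast_famCast]

theorem BimoduleOps.evalTree_update (M : BimoduleOps.{u, v} P Q)
    (opP : ∀ n : ℕ, 2 ≤ n → P.X n ((n : ℤ) - 2)) (opQ : ∀ n : ℕ, 2 ≤ n → Q.X n ((n : ℤ) - 2))
    (op : ∀ n : ℕ, 1 ≤ n → M.X n ((n : ℤ) - 1)) {k : ℕ} (c : Fin k → MTree) (j : Fin k)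
    (s : MTreeN (c j).leaves ((c j).deg - 1)) (i : Fin k) :
    M.evalTree opP opQ op (Function.update c j s.1 i) = famCast (X := M.X)
      (MTree.leaves_update c j s i) (MTree.deg_update c j s i)
      (slotFam (Y := fun j => M.X (c j).leaves)
        (fun j => M.evalTree opP opQ op (c j)) j (M.evalTreeN opP opQ op s) i) := by
  by_cases h : i = j
  · subst h
    rw [slotFam_self, degCast_eq_famCast, famCast_famCast, M.evalTreeN_eq, famCast_famCast]
    exact M.evalTree_congr opP opQ op (Function.update_self i s.1 c).symm
  · rw [slotFam_of_ne _ h, degCast_eq_famCast, famCast_famCast]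
    exact M.evalTree_congr opP opQ op (Function.update_of_ne h s.1 c).symm

theorem BimoduleOps.evalTreeN_nodeUpdate (M : BimoduleOps.{u, v} P Q)
    (opP : ∀ n : ℕ, 2 ≤ n → P.X n ((n : ℤ) - 2)) (opQ : ∀ n : ℕ, 2 ≤ n → Q.X n ((n : ℤ) - 2))
    (op : ∀ n : ℕ, 1 ≤ n → M.X n ((n : ℤ) - 1)) {k : ℕ} (h : 2 ≤ k) (c : Fin k → MTree) (j : Fin k)
    (s : MTreeN (c j).leaves ((c j).deg - 1)) :
    famCast (X := M.X) rfl (sum_sub_ite_eq _ _ j) (M.lact (opP k h)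
      (slotFam (Y := fun j => M.X (c j).leaves) (fun j => M.evalTree opP opQ op (c j)) j
        (M.evalTreeN opP opQ op s))) = M.evalTreeN opP opQ op (MTree.nodeUpdate k h c j s) := by
  have h1 : M.lact (opP k h) (fun i => M.evalTree opP opQ op (Function.update c j s.1 i)) = _ :=
    totalComp_congr M.lact _ _ (opP k h) _ _ (M.evalTree_update opP opQ op c j s)
  change _ = famCast (X := M.X)
    (Finset.sum_congr rfl fun i _ => MTree.leaves_update c j s i).symm
    (MTree.sum_deg_update _ c j s)
    (M.lact (opP k h) fun i => M.evalTree opP opQ op (Function.update c j s.1 i))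
  rw [h1, famCast_famCast]

/-- Evaluation of two-coloured trees commutes with the differentials. At a vertex of morphism type
the relations of the `A_∞`-morphism are used, at other vertices those of the target structure. -/
theorem BimoduleOps.d_evalTree {M : BimoduleOps.{u, v} P Q} (hM : LawfulBimodule M)
    (hQ : LawfulOperad Q) {μP : AInfStr P} {μQ : AInfStr Q} (F : MInfStr M μP μQ) :
    ∀ t : MTree, M.d (M.evalTree μP.op μQ.op F.op t) =
      Finsupp.linearCombination R (fun s : MTreeN t.leaves (t.deg - 1) =>
        M.evalTreeN μP.op μQ.op F.op s) (t.bd R)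
  | MTree.mor m hm c => by
    have h := IsLeibnizComp.step hM.ract_multilinear hM.ract_leibniz (F.op m hm)
      (fun j => Q.evalTree μQ.op (c j)) (fun j => (c j).bd R)
      (fun j (s : TreeN (c j).leaves ((c j).deg - 1)) => Q.evalTreeN μQ.op s)
      (fun j => OperadOps.d_evalTree hQ μQ (c j)) rfl rfl
      (fun j s => M.evalTreeN μP.op μQ.op F.op (MTree.morUpdate m hm c j s))
      (M.evalTreeN_morUpdate μP.op μQ.op F.op hm c)
    rw [← IsMultilinearComp.left_apply hM.ract_multilinear, F.rel] at h
    refine h.trans (Eq.trans ?_ (congrArg (Finsupp.linearCombination R fun s : MTreeN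
      (∑ j, (c j).leaves) (((m : ℤ) - 1) + ∑ j, (c j).deg - 1) =>
        M.evalTreeN μP.op μQ.op F.op s) (MTree.bd_mor m hm c)).symm)
    simp only [map_add, map_sub, map_sum, map_smul, Finsupp.linearCombination_single,
      Finsupp.linearCombination_mapDomain]
    refine congrArg₂ (· + ·) (congrArg₂ (· - ·) (Finset.sum_congr rfl fun x _ => ?_)
      (Finset.sum_congr rfl fun x _ => ?_)) rfl
    all_goals
      rw [M.evalTreeN_cast, M.evalTreeN_rgraft hM hQ, IsMultilinearComp.left_apply, famCast_smul,
        smul_smul, ksign_add, mul_assoc, ksign_mul_self, mul_one]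
      rfl
  | MTree.node m hm c => by
    have ih := fun j => d_evalTree hM hQ F (c j)
    have h := IsLeibnizComp.step hM.lact_multilinear hM.lact_leibniz (μP.op m hm)
      (fun j => M.evalTree μP.op μQ.op F.op (c j)) (fun j => (c j).bd R)
      (fun j (s : MTreeN (c j).leaves ((c j).deg - 1)) => M.evalTreeN μP.op μQ.op F.op s) ih rfl rfl
      (fun j s => M.evalTreeN μP.op μQ.op F.op (MTree.nodeUpdate m hm c j s))
      (M.evalTreeN_nodeUpdate μP.op μQ.op F.op hm c)
    rw [← IsMultilinearComp.left_apply hM.lact_multilinear, μP.rel] at h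
    refine h.trans (Eq.trans ?_ (congrArg (Finsupp.linearCombination R fun s : MTreeN
      (∑ j, (c j).leaves) (((m : ℤ) - 2) + ∑ j, (c j).deg - 1) =>
        M.evalTreeN μP.op μQ.op F.op s) (MTree.bd_node m hm c)).symm)
    simp only [map_add, map_neg, map_sum, map_smul, Finsupp.linearCombination_single,
      Finsupp.linearCombination_mapDomain]
    refine congrArg₂ (· + ·) (congrArg Neg.neg (Finset.sum_congr rfl fun x _ => ?_)) rfl
    rw [M.evalTreeN_cast, M.evalTreeN_lgraft hM, IsMultilinearComp.left_apply, famCast_smul,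
      smul_smul, ksign_add, mul_assoc, ksign_mul_self, mul_one]
    rfl

theorem BimoduleOps.d_evalTreeN {M : BimoduleOps.{u, v} P Q} (hM : LawfulBimodule M)
    (hQ : LawfulOperad Q) {μP : AInfStr P} {μQ : AInfStr Q} (F : MInfStr M μP μQ)
    {n : ℕ} {d : ℤ} (t : MTreeN n d) : M.d (M.evalTreeN μP.op μQ.op F.op t) =
      Finsupp.linearCombination R
        (fun s : MTreeN t.1.leaves (t.1.deg - 1) =>
          M.evalTreeN μP.op μQ.op F.op (MTreeN.cast t.2.1 (congrArg (· - 1) t.2.2) s))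
        (t.1.bd R) := by
  obtain ⟨t, rfl, rfl⟩ := t
  exact d_evalTree hM hQ F t

end DifferentialBimodule

/-! ### The universal properties of `A_∞` and `M_∞` -/

section Universal

theorem finSigmaFinEquiv_of_eq_one {k : ℕ} {n : Fin k → ℕ} (hn : ∀ j, n j = 1) (j : Fin k)
    (i : Fin (n j)) : (finSigmaFinEquiv ⟨j, i⟩ : ℕ) = j := by
  have hi : (i : ℕ) = 0 := by have := hn j; omega
  rw [finSigmaFinEquiv_val, hi, add_zero]
  simp [hn]

theorem shuffleExp_zero_left {k : ℕ} {b : Fin k → ℤ} (hb : ∀ j, b j = 0) (a : Fin k → ℤ) :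
    shuffleExp b a = 0 := by
  simp [shuffleExp, hb]

theorem shuffleExp_zero_right {k : ℕ} {a : Fin k → ℤ} (ha : ∀ j, a j = 0) (b : Fin k → ℤ) :
    shuffleExp b a = 0 := by
  simp [shuffleExp, ha]

/-- Grafting trivial trees does nothing. -/
theorem Tree.graft_leaf : ∀ t : Tree, (t.graft fun _ => Tree.leaf) = t
  | Tree.leaf => rfl
  | Tree.node n h c => congrArg (Tree.node n h) (funext fun j => graft_leaf (c j))

theorem Tree.graftExp_zero : ∀ t : Tree, (t.graftExp fun _ => 0) = 0
  | Tree.leaf => rfl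
  | Tree.node n h c => by
    rw [Tree.graftExp, shuffleExp_zero_right (fun j => Finset.sum_const_zero), zero_add]
    exact Finset.sum_eq_zero fun j _ => graftExp_zero (c j)

theorem MTree.rgraft_leaf : ∀ t : MTree, (t.rgraft fun _ => Tree.leaf) = t
  | MTree.mor n h c => congrArg (MTree.mor n h) (funext fun j => (c j).graft_leaf)
  | MTree.node n h c => congrArg (MTree.node n h) (funext fun j => rgraft_leaf (c j))

theorem MTree.rgraftExp_zero : ∀ t : MTree, (t.rgraftExp fun _ => 0) = 0
  | MTree.mor n h c => by
    rw [MTree.rgraftExp, shuffleExp_zero_right (fun j => Finset.sum_const_zero), zero_add]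
    exact Finset.sum_eq_zero fun j _ => (c j).graftExp_zero
  | MTree.node n h c => by
    rw [MTree.rgraftExp, shuffleExp_zero_right (fun j => Finset.sum_const_zero), zero_add]
    exact Finset.sum_eq_zero fun j _ => rgraftExp_zero (c j)

section Corolla

variable {k : ℕ} (h : 2 ≤ k) (h' : 1 ≤ k) {n : Fin k → ℕ} {e : Fin k → ℤ}

theorem TreeN.graft_corolla (s : ∀ j, TreeN (n j) (e j)) :
    ((TreeN.corolla k h).graft s).1 = Tree.node k h fun j => (s j).1 :=
  congrArg (Tree.node k h) (funext fun j => congrArg (fun j => (s j).1)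
    (Fin.ext (finSigmaFinEquiv_of_eq_one (n := fun _ => 1) (fun _ => rfl) j 0)))

theorem TreeN.graftExp_corolla (e : Fin k → ℤ) : (TreeN.corolla k h).graftExp e = 0 := by
  exact (congrArg₂ (· + ·) (shuffleExp_zero_left (fun _ => rfl) _)
    (Finset.sum_eq_zero fun j _ => rfl)).trans (add_zero 0)

theorem MTreeN.lgraft_corolla (s : ∀ j, MTreeN (n j) (e j)) :
    (MTreeN.lgraft (TreeN.corolla k h) s).1 = MTree.node k h fun j => (s j).1 :=
  congrArg (MTree.node k h) (funext fun j => congrArg (fun j => (s j).1)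
    (Fin.ext (finSigmaFinEquiv_of_eq_one (n := fun _ => 1) (fun _ => rfl) j 0)))

theorem MTreeN.rgraft_corolla (s : ∀ j, TreeN (n j) (e j)) :
    ((MTreeN.corolla k h').rgraft s).1 = MTree.mor k h' fun j => (s j).1 :=
  congrArg (MTree.mor k h') (funext fun j => congrArg (fun j => (s j).1)
    (Fin.ext (finSigmaFinEquiv_of_eq_one (n := fun _ => 1) (fun _ => rfl) j 0)))

theorem MTreeN.rgraftExp_corolla (e : Fin k → ℤ) : (MTreeN.corolla k h').rgraftExp e = 0 := by
  exact (congrArg₂ (· + ·) (shuffleExp_zero_left (fun _ => rfl) _)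
    (Finset.sum_eq_zero fun j _ => rfl)).trans (add_zero 0)

end Corolla

variable {R : Type u} [CommRing R]

/-- The multilinear extension of an operation on basis elements takes the expected values on them.
-/
theorem multiExt_single {k : ℕ} {B : Type v} {B' : Fin k → Type w} {Y : Type v₁}
    [AddCommGroup Y] [Module R Y] (op : B → (∀ j, B' j) → Y) (b : B) (s : ∀ j, B' j) :
    multiExt op (Finsupp.single b (1 : R)) (fun j => Finsupp.single (s j) (1 : R)) = op b s := by
  cases subsingleton_or_nontrivial R with
  -- over the zero ring the supports of the basis elements are empty, but the target is trivial
  | inl _ =>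
    have := Module.subsingleton R Y
    exact Subsingleton.elim _ _
  | inr _ =>
    have hs : (Fintype.piFinset fun j => (Finsupp.single (s j) (1 : R)).support) = {s} := by
      ext x
      simp [funext_iff]
    rw [multiExt, Finsupp.sum_single_index (by simp), hs, Finset.sum_singleton]
    simp

/-- A tree with root of arity `k` is the composite of the generator `m_k` with its branches, without
sign. -/
theorem AInf.comp_gen {k : ℕ} (h : 2 ≤ k) (c : Fin k → Tree) :
    (AInf R).comp (AInf.gen R k h)
      (fun j => Finsupp.single (⟨c j, rfl, rfl⟩ : TreeN (c j).leaves (c j).deg) (1 : R)) =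
    Finsupp.single (⟨Tree.node k h c, rfl, rfl⟩ : TreeN (∑ j, (c j).leaves) _) (1 : R) := by
  refine (multiExt_single _ _ _).trans ?_
  rw [TreeN.graftExp_corolla, ksign_zero, one_smul]
  exact congrArg (fun t => Finsupp.single t (1 : R)) (Subtype.ext (TreeN.graft_corolla h _))

/-- A two-coloured tree with an operation at its root is the left action of `m_k` on its branches.
-/
theorem MInf.lact_gen {k : ℕ} (h : 2 ≤ k) (c : Fin k → MTree) :
    (MInf R).lact (AInf.gen R k h)
      (fun j => Finsupp.single (⟨c j, rfl, rfl⟩ : MTreeN (c j).leaves (c j).deg) (1 : R)) =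
    Finsupp.single (⟨MTree.node k h c, rfl, rfl⟩ : MTreeN (∑ j, (c j).leaves) _) (1 : R) := by
  refine (multiExt_single _ _ _).trans ?_
  rw [TreeN.graftExp_corolla, ksign_zero, one_smul]
  exact congrArg (fun t => Finsupp.single t (1 : R)) (Subtype.ext (MTreeN.lgraft_corolla h _))

/-- A two-coloured tree with a vertex of morphism type at its root is the right action of its
branches on `f_k`. -/
theorem MInf.ract_gen {k : ℕ} (h : 1 ≤ k) (c : Fin k → Tree) :
    (MInf R).ract (MInf.gen R k h)
      (fun j => Finsupp.single (⟨c j, rfl, rfl⟩ : TreeN (c j).leaves (c j).deg) (1 : R)) =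
    Finsupp.single (⟨MTree.mor k h c, rfl, rfl⟩ : MTreeN (∑ j, (c j).leaves) _) (1 : R) := by
  refine (multiExt_single _ _ _).trans ?_
  rw [MTreeN.rgraftExp_corolla, ksign_zero, one_smul]
  exact congrArg (fun t => Finsupp.single t (1 : R)) (Subtype.ext (MTreeN.rgraft_corolla h _))

theorem AInf.d_single {n : ℕ} {d : ℤ} (t : TreeN n d) :
    (AInf R).d (Finsupp.single t (1 : R)) =
      (t.1.bd R).mapDomain (TreeN.cast t.2.1 (congrArg (· - 1) t.2.2)) := by
  change Finsupp.linearCombination R (fun t : TreeN n d => (t.1.bd R).mapDomain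
    (TreeN.cast t.2.1 (congrArg (· - 1) t.2.2))) (Finsupp.single t (1 : R)) = _
  exact (Finsupp.linearCombination_single R _ _).trans (one_smul _ _)

theorem MInf.d_single {n : ℕ} {d : ℤ} (t : MTreeN n d) :
    (MInf R).d (Finsupp.single t (1 : R)) =
      (t.1.bd R).mapDomain (MTreeN.cast t.2.1 (congrArg (· - 1) t.2.2)) := by
  change Finsupp.linearCombination R (fun t : MTreeN n d => (t.1.bd R).mapDomain
    (MTreeN.cast t.2.1 (congrArg (· - 1) t.2.2))) (Finsupp.single t (1 : R)) = _
  exact (Finsupp.linearCombination_single R _ _).trans (one_smul _ _)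

/-- The differential of `m_k` is the sum over the facets prescribed by the definition of `A_∞`. -/
theorem AInf.d_gen {k : ℕ} (h : 2 ≤ k) : (AInf R).d (AInf.gen R k h) =
    -∑ x : ProperSplit k, (ksign R x.1.exp • Finsupp.single (x.1.facet x.2) (1 : R) :
      TreeN k _ →₀ R) := by
  refine (AInf.d_single (TreeN.corolla k h)).trans ((congrArg (Finsupp.lmapDomain R R
    (TreeN.cast (n := ∑ _j : Fin k, Tree.leaf.leaves)
      (d := ((k : ℤ) - 2) + ∑ _j : Fin k, Tree.leaf.deg - 1) (TreeN.corolla k h).2.1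
      (congrArg (· - 1) (TreeN.corolla k h).2.2)))
    (Tree.bd_node k h fun _ => Tree.leaf)).trans ?_)
  have h0 : ∀ j : Fin k, ksign R (((k : ℤ) - 2) + ∑ i ∈ Finset.Iio j, (Tree.leaf).deg) •
      (Tree.bd R Tree.leaf).mapDomain (Tree.nodeUpdate k h (fun _ => Tree.leaf) j) = 0 :=
      fun j => by
    rw [Tree.bd, Finsupp.mapDomain_zero, smul_zero]
  rw [Finset.sum_eq_zero fun j _ => h0 j, add_zero, map_neg, map_sum]
  refine congrArg Neg.neg (Finset.sum_congr rfl fun x _ => ?_)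
  rw [Finsupp.lmapDomain_apply, Finsupp.mapDomain_single, Finsupp.smul_single, smul_eq_mul, mul_one]
  refine congrArg₂ Finsupp.single (Subtype.ext ?_) ?_
  · exact Tree.graft_leaf _
  · have : (x.1.facet x.2).graftExp (fun _ => 0) = 0 := Tree.graftExp_zero _
    exact congrArg (ksign R) ((congrArg _ this).trans (add_zero _))

/-- The differential of `f_k` is the sum over the facets prescribed by the definition of `M_∞`. -/
theorem MInf.d_gen {k : ℕ} (h : 1 ≤ k) : (MInf R).d (MInf.gen R k h) =
    (∑ x : Split k, (ksign R x.exp • Finsupp.single x.upperFacet (1 : R) : MTreeN k _ →₀ R)) -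
    ∑ x : ProperComposition k, (ksign R x.exp • Finsupp.single x.lowerFacet (1 : R) :
      MTreeN k _ →₀ R) := by
  refine (MInf.d_single (MTreeN.corolla k h)).trans ((congrArg (Finsupp.lmapDomain R R
    (MTreeN.cast (n := ∑ _j : Fin k, Tree.leaf.leaves)
      (d := ((k : ℤ) - 1) + ∑ _j : Fin k, Tree.leaf.deg - 1) (MTreeN.corolla k h).2.1
      (congrArg (· - 1) (MTreeN.corolla k h).2.2)))
    (MTree.bd_mor k h fun _ => Tree.leaf)).trans ?_)
  have h0 : ∀ j : Fin k, ksign R (((k : ℤ) - 1) + ∑ i ∈ Finset.Iio j, (Tree.leaf).deg) •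
      (Tree.bd R Tree.leaf).mapDomain (MTree.morUpdate k h (fun _ => Tree.leaf) j) = 0 :=
      fun j => by
    rw [Tree.bd, Finsupp.mapDomain_zero, smul_zero]
  rw [Finset.sum_eq_zero fun j _ => h0 j, add_zero, map_sub, map_sum, map_sum]
  refine congrArg₂ (· - ·) (Finset.sum_congr rfl fun x _ => ?_)
    (Finset.sum_congr rfl fun x _ => ?_)
  all_goals
    rw [Finsupp.lmapDomain_apply, Finsupp.mapDomain_single, Finsupp.smul_single, smul_eq_mul,
      mul_one]
    refine congrArg₂ Finsupp.single (Subtype.ext (MTree.rgraft_leaf _)) ?_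
    exact congrArg (ksign R) ((congrArg _ (MTree.rgraftExp_zero _)).trans (add_zero _))

end Universal

section Classification

variable {R : Type u} [CommRing R]

theorem AInfStr.eval_single {P : OperadOps.{u, v} R} (μ : AInfStr P) {n : ℕ} {d : ℤ}
    (t : TreeN n d) : μ.eval (Finsupp.single t (1 : R) : TreeN n d →₀ R) = P.evalTreeN μ.op t :=
  (Finsupp.linearCombination_single R _ _).trans (one_smul _ _)

theorem AInfStr.eval_gen {P : OperadOps.{u, v} R} (hP : LawfulOperad P) (μ : AInfStr P) {n : ℕ}
    (h : 2 ≤ n) : μ.eval (AInf.gen R n h) = μ.op n h := by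
  refine (μ.eval_single _).trans ?_
  change famCast (X := P.X) _ _ (P.comp (μ.op n h) (n := fun _ => 1) (e := fun _ => 0)
    fun _ => P.one) = _
  rw [hP.comp_one]
  exact famCast_famCast (X := P.X) _ _ _ _ (μ.op n h)

theorem MInfStr.eval_single {P : OperadOps.{u, v₁} R} {Q : OperadOps.{u, v₂} R}
    {M : BimoduleOps.{u, v} P Q} {μP : AInfStr P} {μQ : AInfStr Q} (F : MInfStr M μP μQ) {n : ℕ}
    {d : ℤ} (t : MTreeN n d) : F.eval (Finsupp.single t (1 : R) : MTreeN n d →₀ R) =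
      M.evalTreeN μP.op μQ.op F.op t :=
  (Finsupp.linearCombination_single R _ _).trans (one_smul _ _)

theorem MInfStr.eval_gen {P : OperadOps.{u, v₁} R} {Q : OperadOps.{u, v₂} R}
    {M : BimoduleOps.{u, v} P Q} (hM : LawfulBimodule M) {μP : AInfStr P} {μQ : AInfStr Q}
    (F : MInfStr M μP μQ) {n : ℕ} (h : 1 ≤ n) : F.eval (MInf.gen R n h) = F.op n h := by
  refine (F.eval_single _).trans ?_
  change famCast (X := M.X) _ _ (M.ract (F.op n h) (n := fun _ => 1) (e := fun _ => 0)
    fun _ => Q.one) = _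
  rw [hM.ract_one]
  exact famCast_famCast (X := M.X) _ _ _ _ (F.op n h)

/-- A morphism from `A_∞` is determined by its values on generators: on trees it is the evaluation
of these values. -/
theorem OperadHom.evalTree_map_gen {P : OperadOps.{u, v} R} (φ : OperadHom (AInf R) P) :
    ∀ t : Tree, P.evalTree (fun n h => φ.map (AInf.gen R n h)) t =
      φ.map (Finsupp.single ⟨t, rfl, rfl⟩ (1 : R) : TreeN t.leaves t.deg →₀ R)
  | Tree.leaf => φ.map_one.symm
  | Tree.node n h c => by
    have ih := fun j => evalTree_map_gen φ (c j)
    have h1 := (congrArg φ.map (AInf.comp_gen (R := R) h c)).symm.trans (φ.map_comp _ _)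
    refine Eq.trans ?_ h1.symm
    exact congrArg (fun g : ∀ j, P.X (c j).leaves (c j).deg => P.comp (φ.map (AInf.gen R n h)) g)
      (funext ih)

theorem OperadHom.evalTreeN_map_gen {P : OperadOps.{u, v} R} (φ : OperadHom (AInf R) P) {n : ℕ}
    {d : ℤ} (t : TreeN n d) : P.evalTreeN (fun n h => φ.map (AInf.gen R n h)) t =
      φ.map (Finsupp.single t (1 : R) : TreeN n d →₀ R) := by
  obtain ⟨t, rfl, rfl⟩ := t
  exact φ.evalTree_map_gen t

/-- The operad `A_∞` classifies `A_∞`-structures: it is free as a graded operad, and the value of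
its differential on a generator is the right hand side of the relation for that generator. -/
theorem OperadHom.existsUnique_eval {P : OperadOps.{u, v} R} (hP : LawfulOperad P)
    (φ : OperadHom (AInf R) P) :
    ∃! μ : AInfStr P, ∀ (n : ℕ) (d : ℤ) (x : (AInf R).X n d), μ.eval x = φ.map x := by
  refine ⟨⟨fun n h => φ.map (AInf.gen R n h), fun n h => ?_⟩, fun n d x => ?_, fun μ hμ => ?_⟩
  · rw [← φ.map_d]
    refine (congrArg φ.map (AInf.d_gen h)).trans ?_
    have h1 := map_neg (φ.map (n := n) (a := (n : ℤ) - 2 - 1))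
      (∑ x : ProperSplit n, (ksign R x.1.exp • Finsupp.single (x.1.facet x.2) (1 : R) :
        TreeN n _ →₀ R))
    refine h1.trans (congrArg Neg.neg ?_)
    refine (map_sum (φ.map (n := n) (a := (n : ℤ) - 2 - 1)) _ _).trans
      (Finset.sum_congr rfl fun x _ => ?_)
    refine (map_smul (φ.map (n := n) (a := (n : ℤ) - 2 - 1)) _ _).trans ?_
    rw [φ.evalTreeN_map_gen]
  · refine LinearMap.congr_fun (f := AInfStr.eval _) (g := φ.map)
      (Finsupp.lhom_ext' fun t => LinearMap.ext_ring ?_) x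
    exact (AInfStr.eval_single _ t).trans (φ.evalTreeN_map_gen t)
  · refine AInfStr.ext (funext fun n => funext fun h => ?_)
    exact (μ.eval_gen hP h).symm.trans (hμ _ _ _)

section Bimodule

variable {P : OperadOps.{u, v₁} R} {Q : OperadOps.{u, v₂} R} {M : BimoduleOps.{u, v} P Q}
  (μP : AInfStr P) (μQ : AInfStr Q) (ψ : ∀ {n : ℕ} {d : ℤ}, (MInf R).X n d →ₗ[R] M.X n d)
  (hl : ∀ {k : ℕ} {a : ℤ} {n : Fin k → ℕ} {e : Fin k → ℤ} (x : (AInf R).X k a)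
    (y : ∀ j, (MInf R).X (n j) (e j)),
    ψ ((MInf R).lact x y) = M.lact (μP.eval x) fun j => ψ (y j))
  (hr : ∀ {k : ℕ} {a : ℤ} {n : Fin k → ℕ} {e : Fin k → ℤ} (y : (MInf R).X k a)
    (x : ∀ j, (AInf R).X (n j) (e j)),
    ψ ((MInf R).ract y x) = M.ract (ψ y) fun j => μQ.eval (x j))
  (hd : ∀ {n : ℕ} {d : ℤ} (y : (MInf R).X n d), ψ ((MInf R).d y) = M.d (ψ y))

include hl hr in
/-- A map from `M_∞` that respects both actions is determined by its values on generators: on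
two-coloured trees it is the evaluation of these values. -/
theorem BimoduleOps.evalTree_map_gen (hP : LawfulOperad P) :
    ∀ t : MTree, M.evalTree μP.op μQ.op (fun n h => ψ (MInf.gen R n h)) t =
      ψ (Finsupp.single ⟨t, rfl, rfl⟩ (1 : R) : MTreeN t.leaves t.deg →₀ R)
  | MTree.mor n h c => by
    have h1 := (congrArg ψ (MInf.ract_gen (R := R) h c)).symm.trans (hr _ _)
    refine Eq.trans ?_ h1.symm
    exact congrArg (fun g : ∀ j, Q.X (c j).leaves (c j).deg => M.ract (ψ (MInf.gen R n h)) g)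
      (funext fun j => (μQ.eval_single ⟨c j, rfl, rfl⟩).symm)
  | MTree.node n h c => by
    have ih := fun j => evalTree_map_gen hP (c j)
    have h1 := (congrArg ψ (MInf.lact_gen (R := R) h c)).symm.trans (hl _ _)
    refine Eq.trans ?_ h1.symm
    rw [μP.eval_gen hP]
    exact congrArg (fun g : ∀ j, M.X (c j).leaves (c j).deg => M.lact (μP.op n h) g) (funext ih)

include hl hr in
theorem BimoduleOps.evalTreeN_map_gen (hP : LawfulOperad P) {n : ℕ} {d : ℤ} (t : MTreeN n d) :
    M.evalTreeN μP.op μQ.op (fun n h => ψ (MInf.gen R n h)) t =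
      ψ (Finsupp.single t (1 : R) : MTreeN n d →₀ R) := by
  obtain ⟨t, rfl, rfl⟩ := t
  exact evalTree_map_gen μP μQ ψ hl hr hP t

include hl hr hd in
/-- The bimodule `M_∞` classifies `A_∞`-morphisms: it is free as a graded bimodule, and the value of
its differential on a generator is the right hand side of the relation for that generator. -/
theorem BimoduleOps.existsUnique_eval (hP : LawfulOperad P) (hM : LawfulBimodule M) :
    ∃! F : MInfStr M μP μQ, ∀ (n : ℕ) (d : ℤ) (x : (MInf R).X n d), F.eval x = ψ x := by
  refine ⟨⟨fun n h => ψ (MInf.gen R n h), fun n h => ?_⟩, fun n d x => ?_, fun F hF => ?_⟩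
  · rw [← hd]
    refine (congrArg ψ (MInf.d_gen h)).trans ?_
    have h1 := map_sub (ψ (n := n) (d := (n : ℤ) - 1 - 1))
      (∑ x : Split n, (ksign R x.exp • Finsupp.single x.upperFacet (1 : R) : MTreeN n _ →₀ R))
      (∑ x : ProperComposition n,
        (ksign R x.exp • Finsupp.single x.lowerFacet (1 : R) : MTreeN n _ →₀ R))
    refine h1.trans (congrArg₂ (· - ·) ?_ ?_)
    all_goals
      refine (map_sum (ψ (n := n) (d := (n : ℤ) - 1 - 1)) _ _).trans
        (Finset.sum_congr rfl fun x _ => ?_)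
      refine (map_smul (ψ (n := n) (d := (n : ℤ) - 1 - 1)) _ _).trans ?_
      rw [evalTreeN_map_gen μP μQ ψ hl hr hP]
  · refine LinearMap.congr_fun (f := MInfStr.eval _) (g := ψ)
      (Finsupp.lhom_ext' fun t => LinearMap.ext_ring ?_) x
    exact (MInfStr.eval_single _ t).trans (evalTreeN_map_gen μP μQ ψ hl hr hP t)
  · refine MInfStr.ext (funext fun n => funext fun h => ?_)
    exact (F.eval_gen hM h).symm.trans (hF _ _ _)

end Bimodule

end Classification

/-! ### Pairings of operads and of bimodules -/

section Pairing

variable {R : Type u} [CommRing R]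

/-- If a linear map on the target of a multilinear extension agrees with a total composition on
basis elements, then it does so on all elements. -/
theorem IsMultilinearComp.map_multiExt {X : ℕ → ℤ → Type v₁} {Y : ℕ → ℤ → Type v₂}
    {Z : ℕ → ℤ → Type v₃}
    [∀ n d, AddCommGroup (X n d)] [∀ n d, Module R (X n d)] [∀ n d, AddCommGroup (Y n d)]
    [∀ n d, Module R (Y n d)] [∀ n d, AddCommGroup (Z n d)] [∀ n d, Module R (Z n d)]
    {c : TotalComp X Y Z} (hc : IsMultilinearComp R c) {k : ℕ} {a : ℤ} {n : Fin k → ℕ}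
    {e : Fin k → ℤ} {B : Type w} {B' : Fin k → Type w₁} {V : Type w₂} [AddCommGroup V] [Module R V]
    (L : V →ₗ[R] Z (∑ j, n j) (a + ∑ j, e j)) (op : B → (∀ j, B' j) → V) (v : B → X k a)
    (v' : ∀ j, B' j → Y (n j) (e j)) (h : ∀ b s, L (op b s) = c (v b) fun j => v' j (s j))
    (x : B →₀ R) (y : ∀ j, B' j →₀ R) :
    L (multiExt op x y) = c (Finsupp.linearCombination R v x)
      fun j => Finsupp.linearCombination R (v' j) (y j) := by
  change _ = hc.toMultilinear k a n e (Finsupp.linearCombination R v x)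
    fun j => Finsupp.linearCombination R (v' j) (y j)
  simp only [multiExt, Finsupp.linearCombination_apply, Finsupp.sum, map_sum, map_smul,
    _root_.sum_apply, _root_.smul_apply, MultilinearMap.map_sum_finset,
    MultilinearMap.map_smul_univ, h, Finset.smul_sum, smul_smul]
  rfl

section Families

variable {X₁ : ℕ → ℤ → Type*} {X₂ : ℕ → ℤ → Type*} {X : ℕ → ℤ → Type*}
  {Y₁ : ℕ → ℤ → Type*} {Y₂ : ℕ → ℤ → Type*} {Y : ℕ → ℤ → Type*}
  {Z₁ : ℕ → ℤ → Type*} {Z₂ : ℕ → ℤ → Type*} {Z : ℕ → ℤ → Type*}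
  [∀ n d, AddCommGroup (X₁ n d)] [∀ n d, Module R (X₁ n d)]
  [∀ n d, AddCommGroup (X₂ n d)] [∀ n d, Module R (X₂ n d)]
  [∀ n d, AddCommGroup (X n d)] [∀ n d, Module R (X n d)]
  [∀ n d, AddCommGroup (Y₁ n d)] [∀ n d, Module R (Y₁ n d)]
  [∀ n d, AddCommGroup (Y₂ n d)] [∀ n d, Module R (Y₂ n d)]
  [∀ n d, AddCommGroup (Y n d)] [∀ n d, Module R (Y n d)]
  [∀ n d, AddCommGroup (Z₁ n d)] [∀ n d, Module R (Z₁ n d)]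
  [∀ n d, AddCommGroup (Z₂ n d)] [∀ n d, Module R (Z₂ n d)]
  [∀ n d, AddCommGroup (Z n d)] [∀ n d, Module R (Z n d)]

/-- The pairings `X₁ ⊗ X₂ → X`, `Y₁ ⊗ Y₂ → Y` and `Z₁ ⊗ Z₂ → Z`, given arity by arity, are
compatible with the total compositions `c₁`, `c₂` and `c`. -/
def IsPairingComp (c₁ : TotalComp X₁ Y₁ Z₁) (c₂ : TotalComp X₂ Y₂ Z₂) (c : TotalComp X Y Z)
    (θX : ∀ {n : ℕ} {a b : ℤ}, X₁ n a →ₗ[R] X₂ n b →ₗ[R] X n (a + b))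
    (θY : ∀ {n : ℕ} {a b : ℤ}, Y₁ n a →ₗ[R] Y₂ n b →ₗ[R] Y n (a + b))
    (θZ : ∀ {n : ℕ} {a b : ℤ}, Z₁ n a →ₗ[R] Z₂ n b →ₗ[R] Z n (a + b)) : Prop :=
  ∀ {k : ℕ} {a b : ℤ} {n : Fin k → ℕ} {e e' : Fin k → ℤ} (f : X₁ k a) (f' : X₂ k b)
    (g : ∀ j, Y₁ (n j) (e j)) (g' : ∀ j, Y₂ (n j) (e' j)),
    c (θX f f') (fun j => θY (g j) (g' j)) = ksign R (tensorExp b e e') •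
      famCast (X := Z) rfl (by rw [Finset.sum_add_distrib]; ring) (θZ (c₁ f g) (c₂ f' g'))

/-- The pairing `X₁ ⊗ X₂ → X` is compatible with the differentials. -/
def IsPairingDiff (d₁ : ∀ {n : ℕ} {a : ℤ}, X₁ n a →ₗ[R] X₁ n (a - 1))
    (d₂ : ∀ {n : ℕ} {a : ℤ}, X₂ n a →ₗ[R] X₂ n (a - 1))
    (d : ∀ {n : ℕ} {a : ℤ}, X n a →ₗ[R] X n (a - 1))
    (θ : ∀ {n : ℕ} {a b : ℤ}, X₁ n a →ₗ[R] X₂ n b →ₗ[R] X n (a + b)) : Prop :=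
  ∀ {n : ℕ} {a b : ℤ} (f : X₁ n a) (f' : X₂ n b), d (θ f f') =
    famCast (X := X) rfl (sub_add_eq_add_sub _ _ _) (θ (d₁ f) f') +
      ksign R a • famCast (X := X) rfl (add_sub_assoc _ _ _).symm (θ f (d₂ f'))

/-- The pairing of two evaluations of grafted trees. The signs `r` and `r'` produced by grafting in
either factor occur twice and cancel, so that only the sign `tensorExp` of the tensor product
remains. -/
theorem IsPairingComp.step {c₁ : TotalComp X₁ Y₁ Z₁} {c₂ : TotalComp X₂ Y₂ Z₂}
    {c : TotalComp X Y Z} {θX : ∀ {n : ℕ} {a b : ℤ}, X₁ n a →ₗ[R] X₂ n b →ₗ[R] X n (a + b)}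
    {θY : ∀ {n : ℕ} {a b : ℤ}, Y₁ n a →ₗ[R] Y₂ n b →ₗ[R] Y n (a + b)}
    {θZ : ∀ {n : ℕ} {a b : ℤ}, Z₁ n a →ₗ[R] Z₂ n b →ₗ[R] Z n (a + b)}
    (hθ : IsPairingComp c₁ c₂ c θX θY θZ)
    {k : ℕ} {a b : ℤ} {n : Fin k → ℕ} {e e' : Fin k → ℤ} (f : X₁ k a) (f' : X₂ k b)
    (g : ∀ j, Y₁ (n j) (e j)) (g' : ∀ j, Y₂ (n j) (e' j)) {A : ℤ} {E : Fin k → ℤ} (hA : a + b = A)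
    (hE : ∀ j, e j + e' j = E j) {r r' : ℤ} {F : Z₁ (∑ j, n j) (a + ∑ j, e j)}
    {F' : Z₂ (∑ j, n j) (b + ∑ j, e' j)} (hF : F = ksign R r • c₁ f g)
    (hF' : F' = ksign R r' • c₂ f' g')
    (h : a + ∑ j, e j + (b + ∑ j, e' j) = A + ∑ j, E j) :
    ksign R (tensorExp b e e' + r + r') • famCast (X := Z) rfl h (θZ F F') =
      c (famCast (X := X) rfl hA (θX f f'))
        fun j => famCast (X := Y) rfl (hE j) (θY (g j) (g' j)) := by
  obtain rfl := hA
  obtain rfl : (fun j => e j + e' j) = E := funext hE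
  have h1 : c (θX f f') (fun j => θY (g j) (g' j)) = _ := hθ f f' g g'
  refine Eq.trans ?_ h1.symm
  rw [hF, hF', map_smul, map_smul, LinearMap.smul_apply, smul_smul, famCast_smul, smul_smul,
    ksign_add, ksign_add]
  congr 1
  linear_combination (ksign R (tensorExp b e e') * ksign R r * ksign R r) * ksign_mul_self R r' +
    ksign R (tensorExp b e e') * ksign_mul_self R r

/-- The differential of a pairing of two elements whose differentials are given as linear
combinations of evaluations. -/
theorem IsPairingDiff.step {d₁ : ∀ {n : ℕ} {a : ℤ}, X₁ n a →ₗ[R] X₁ n (a - 1)}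
    {d₂ : ∀ {n : ℕ} {a : ℤ}, X₂ n a →ₗ[R] X₂ n (a - 1)}
    {d : ∀ {n : ℕ} {a : ℤ}, X n a →ₗ[R] X n (a - 1)}
    {θ : ∀ {n : ℕ} {a b : ℤ}, X₁ n a →ₗ[R] X₂ n b →ₗ[R] X n (a + b)}
    (hθ : IsPairingDiff (X₁ := X₁) (X₂ := X₂) (X := X) d₁ d₂ d θ) {n : ℕ} {a b : ℤ}
    (f : X₁ n a) (f' : X₂ n b) {A : ℤ} (hA : a + b = A)
    {B : Type w} {B' : Type w₁} {v : B → X₁ n (a - 1)} {v' : B' → X₂ n (b - 1)}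
    {x : B →₀ R} {x' : B' →₀ R} (hf : d₁ f = Finsupp.linearCombination R v x)
    (hf' : d₂ f' = Finsupp.linearCombination R v' x') (h : a - 1 + b = A - 1)
    (h' : a + (b - 1) = A - 1) :
    Finsupp.linearCombination R (fun s => famCast (X := X) rfl h (θ (v s) f')) x +
      ksign R a • Finsupp.linearCombination R (fun s => famCast (X := X) rfl h' (θ f (v' s))) x' =
    d (famCast (X := X) rfl hA (θ f f')) := by
  subst hA
  have h1 : d (θ f f') = _ := hθ f f'
  refine Eq.trans ?_ h1.symm
  rw [hf, hf']
  refine congrArg₂ (· + ·) ?_ (congrArg _ ?_)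
  · exact (Finsupp.apply_linearCombination R (famCastₗ R (X := X) rfl h ∘ₗ θ.flip f') v x).symm
  · exact (Finsupp.apply_linearCombination R (famCastₗ R (X := X) rfl h' ∘ₗ θ f) v' x').symm

end Families

end Pairing

section PairEval

variable {R : Type u} [CommRing R]

section Operad

variable {P : OperadOps.{u, v₁} R} {Q : OperadOps.{u, v₂} R} {S : OperadOps.{u, v₃} R}
  (θ : ∀ {n : ℕ} {a b : ℤ}, P.X n a →ₗ[R] Q.X n b →ₗ[R] S.X n (a + b))
  (opP : ∀ n : ℕ, 2 ≤ n → P.X n ((n : ℤ) - 2)) (opQ : ∀ n : ℕ, 2 ≤ n → Q.X n ((n : ℤ) - 2))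

/-- The value on the basis element `t ⊗ t'` of the composite `A_∞ ⊗ A_∞ → P ⊗ Q → S`, where
`θ : P ⊗ Q → S`. -/
def pairEvalTree {n : ℕ} {d : ℤ} (t : TreePairN n d) : S.X n d :=
  famCast (X := S.X) rfl t.2.2.2 (θ (P.evalTreeN opP t.fst) (Q.evalTreeN opQ t.snd))

/-- The composite `A_∞ ⊗ A_∞ → P ⊗ Q → S`, where `θ : P ⊗ Q → S`. -/
def pairEval {n : ℕ} {d : ℤ} : (AInfTensor R).X n d →ₗ[R] S.X n d :=
  Finsupp.linearCombination R fun t : TreePairN n d => pairEvalTree θ opP opQ t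

theorem pairEvalTree_mk {n : ℕ} {a b d : ℤ} (t : TreeN n a) (t' : TreeN n b) (h : a + b = d) :
    pairEvalTree θ opP opQ (TreePairN.mk t t' h) =
      famCast (X := S.X) rfl h (θ (P.evalTreeN opP t) (Q.evalTreeN opQ t')) := by
  obtain ⟨t, rfl, rfl⟩ := t
  obtain ⟨t', ht', rfl⟩ := t'
  rfl

theorem pairEval_single {n : ℕ} {d : ℤ} (t : TreePairN n d) (r : R) :
    pairEval θ opP opQ (Finsupp.single t r : TreePairN n d →₀ R) =
      r • pairEvalTree θ opP opQ t :=
  Finsupp.linearCombination_single R _ _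

/-- The composite `A_∞ ⊗ A_∞ → P ⊗ Q → S` respects compositions. By multilinearity this is a
statement about pairs of trees, where both evaluations respect grafting. -/
theorem pairEval_comp (hP : LawfulOperad P) (hQ : LawfulOperad Q) (hS : LawfulOperad S)
    (hθ : IsPairingComp (X₁ := P.X) (X₂ := Q.X) (X := S.X) (Y₁ := P.X) (Y₂ := Q.X) (Y := S.X)
      (Z₁ := P.X) (Z₂ := Q.X) (Z := S.X) P.comp Q.comp S.comp θ θ θ) {k : ℕ} {a : ℤ}
    {n : Fin k → ℕ} {e : Fin k → ℤ} (x : (AInfTensor R).X k a)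
    (y : ∀ j, (AInfTensor R).X (n j) (e j)) :
    pairEval θ opP opQ ((AInfTensor R).comp x y) =
      S.comp (pairEval θ opP opQ x) fun j => pairEval θ opP opQ (y j) := by
  refine IsMultilinearComp.map_multiExt hS.multilinear (pairEval θ opP opQ) _
    (fun t : TreePairN k a => pairEvalTree θ opP opQ t)
    (fun j (t : TreePairN (n j) (e j)) => pairEvalTree θ opP opQ t) (fun t s => ?_) x y
  refine ((pairEval θ opP opQ).map_smul _ _).trans ?_
  rw [pairEval_single, one_smul, pairEvalTree_mk]
  exact hθ.step _ _ _ _ t.2.2.2 (fun j => (s j).2.2.2) (OperadOps.evalTreeN_graft hP opP _ _)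
    (OperadOps.evalTreeN_graft hQ opQ _ _) _

/-- The composite `A_∞ ⊗ A_∞ → P ⊗ Q → S` respects differentials: the tree differential on
`A_∞ ⊗ A_∞` is the Leibniz sum and both evaluations respect it. -/
theorem pairEval_d (hP : LawfulOperad P) (hQ : LawfulOperad Q) (μP : AInfStr P) (μQ : AInfStr Q)
    (hθ : IsPairingDiff (X₁ := P.X) (X₂ := Q.X) (X := S.X) P.d Q.d S.d θ) {n : ℕ} {d : ℤ}
    (x : (AInfTensor R).X n d) :
    pairEval θ μP.op μQ.op ((AInfTensor R).d x) = S.d (pairEval θ μP.op μQ.op x) := by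
  have h : (pairEval θ μP.op μQ.op ∘ₗ (AInfTensor R).d : (AInfTensor R).X n d →ₗ[R] _) =
      S.d ∘ₗ pairEval θ μP.op μQ.op := by
    refine Finsupp.lhom_ext' fun t => LinearMap.ext_ring ?_
    change Finsupp.linearCombination R (fun t : TreePairN n (d - 1) =>
        pairEvalTree θ μP.op μQ.op t) (Finsupp.linearCombination R _ (Finsupp.single t (1 : R))) =
      S.d (pairEval θ μP.op μQ.op (Finsupp.single t (1 : R) : TreePairN n d →₀ R))
    rw [pairEval_single, one_smul, Finsupp.linearCombination_single, one_smul, map_add, map_smul,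
      Finsupp.linearCombination_mapDomain, Finsupp.linearCombination_mapDomain]
    refine Eq.trans ?_ (IsPairingDiff.step (X₁ := P.X) (X₂ := Q.X) (X := S.X) hθ _ _ t.2.2.2
      (OperadOps.d_evalTreeN hP μP t.fst) (OperadOps.d_evalTreeN hQ μQ t.snd)
      (by have := t.2.2.2; omega) (by have := t.2.2.2; omega))
    refine congrArg₂ (· + ·) ?_ (congrArg _ ?_)
    · exact congrArg (fun v => Finsupp.linearCombination R v (t.1.1.bd R))
        (funext fun s => pairEvalTree_mk θ μP.op μQ.op _ _ _)
    · exact congrArg (fun v => Finsupp.linearCombination R v (t.1.2.bd R))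
        (funext fun s => pairEvalTree_mk θ μP.op μQ.op _ _ _)
  exact LinearMap.congr_fun h x

theorem pairEval_one (h1 : famCast (X := S.X) rfl (zero_add 0) (θ P.one Q.one) = S.one) :
    pairEval θ opP opQ (AInfTensor R).one = S.one := by
  refine (pairEval_single θ opP opQ _ _).trans ?_
  rw [one_smul, pairEvalTree_mk]
  exact h1

end Operad

section Bimodule

variable {P : OperadOps.{u, v₁} R} {Q : OperadOps.{u, v₂} R} {S : OperadOps.{u, v₃} R}
  {P' : OperadOps.{u, w₁} R} {Q' : OperadOps.{u, w₂} R} {S' : OperadOps.{u, w₃} R}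
  {M : BimoduleOps.{u, v} P P'} {N : BimoduleOps.{u, v₄} Q Q'} {L : BimoduleOps.{u, w} S S'}
  (θM : ∀ {n : ℕ} {a b : ℤ}, M.X n a →ₗ[R] N.X n b →ₗ[R] L.X n (a + b))
  (θ : ∀ {n : ℕ} {a b : ℤ}, P.X n a →ₗ[R] Q.X n b →ₗ[R] S.X n (a + b))
  (θ' : ∀ {n : ℕ} {a b : ℤ}, P'.X n a →ₗ[R] Q'.X n b →ₗ[R] S'.X n (a + b))
  {μP : AInfStr P} {μQ : AInfStr Q} {μP' : AInfStr P'} {μQ' : AInfStr Q'}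
  (F : MInfStr M μP μP') (G : MInfStr N μQ μQ')

/-- The value on the basis element `t ⊗ t'` of the composite `M_∞ ⊗ M_∞ → M ⊗ N → L`, where
`θM : M ⊗ N → L`. -/
def pairMorEvalTree {n : ℕ} {d : ℤ} (t : MTreePairN n d) : L.X n d :=
  famCast (X := L.X) rfl t.2.2.2 (θM (M.evalTreeN μP.op μP'.op F.op t.fst)
    (N.evalTreeN μQ.op μQ'.op G.op t.snd))

/-- The composite `M_∞ ⊗ M_∞ → M ⊗ N → L`, where `θM : M ⊗ N → L`. -/
def pairMorEval {n : ℕ} {d : ℤ} : (MInfTensor R).X n d →ₗ[R] L.X n d :=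
  Finsupp.linearCombination R fun t : MTreePairN n d => pairMorEvalTree θM F G t

theorem pairMorEvalTree_mk {n : ℕ} {a b d : ℤ} (t : MTreeN n a) (t' : MTreeN n b)
    (h : a + b = d) : pairMorEvalTree θM F G (MTreePairN.mk t t' h) =
      famCast (X := L.X) rfl h (θM (M.evalTreeN μP.op μP'.op F.op t)
        (N.evalTreeN μQ.op μQ'.op G.op t')) := by
  obtain ⟨t, rfl, rfl⟩ := t
  obtain ⟨t', ht', rfl⟩ := t'
  rfl

theorem pairMorEval_single {n : ℕ} {d : ℤ} (t : MTreePairN n d) (r : R) :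
    pairMorEval θM F G (Finsupp.single t r : MTreePairN n d →₀ R) =
      r • pairMorEvalTree θM F G t :=
  Finsupp.linearCombination_single R _ _

/-- The composite `M_∞ ⊗ M_∞ → M ⊗ N → L` respects the left actions. -/
theorem pairMorEval_lact (hM : LawfulBimodule M) (hN : LawfulBimodule N) (hL : LawfulBimodule L)
    (hθ : IsPairingComp (X₁ := P.X) (X₂ := Q.X) (X := S.X) (Y₁ := M.X) (Y₂ := N.X) (Y := L.X)
      (Z₁ := M.X) (Z₂ := N.X) (Z := L.X) M.lact N.lact L.lact θ θM θM) {k : ℕ} {a : ℤ}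
    {n : Fin k → ℕ} {e : Fin k → ℤ} (x : (AInfTensor R).X k a)
    (y : ∀ j, (MInfTensor R).X (n j) (e j)) :
    pairMorEval θM F G ((MInfTensor R).lact x y) =
      L.lact (pairEval θ μP.op μQ.op x) fun j => pairMorEval θM F G (y j) := by
  refine IsMultilinearComp.map_multiExt hL.lact_multilinear (pairMorEval θM F G) _
    (fun t : TreePairN k a => pairEvalTree θ μP.op μQ.op t)
    (fun j (t : MTreePairN (n j) (e j)) => pairMorEvalTree θM F G t) (fun t s => ?_) x y
  refine ((pairMorEval θM F G).map_smul _ _).trans ?_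
  rw [pairMorEval_single, one_smul, pairMorEvalTree_mk]
  exact hθ.step _ _ _ _ t.2.2.2 (fun j => (s j).2.2.2)
    (BimoduleOps.evalTreeN_lgraft hM _ _ _ _ _) (BimoduleOps.evalTreeN_lgraft hN _ _ _ _ _) _

/-- The composite `M_∞ ⊗ M_∞ → M ⊗ N → L` respects the right actions. -/
theorem pairMorEval_ract (hM : LawfulBimodule M) (hN : LawfulBimodule N) (hL : LawfulBimodule L)
    (hP' : LawfulOperad P') (hQ' : LawfulOperad Q')
    (hθ : IsPairingComp (X₁ := M.X) (X₂ := N.X) (X := L.X) (Y₁ := P'.X) (Y₂ := Q'.X) (Y := S'.X)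
      (Z₁ := M.X) (Z₂ := N.X) (Z := L.X) M.ract N.ract L.ract θM θ' θM) {k : ℕ} {a : ℤ}
    {n : Fin k → ℕ} {e : Fin k → ℤ} (y : (MInfTensor R).X k a)
    (x : ∀ j, (AInfTensor R).X (n j) (e j)) :
    pairMorEval θM F G ((MInfTensor R).ract y x) =
      L.ract (pairMorEval θM F G y) fun j => pairEval θ' μP'.op μQ'.op (x j) := by
  refine IsMultilinearComp.map_multiExt hL.ract_multilinear (pairMorEval θM F G) _
    (fun t : MTreePairN k a => pairMorEvalTree θM F G t)
    (fun j (t : TreePairN (n j) (e j)) => pairEvalTree θ' μP'.op μQ'.op t) (fun t s => ?_) y x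
  refine ((pairMorEval θM F G).map_smul _ _).trans ?_
  rw [pairMorEval_single, one_smul, pairMorEvalTree_mk]
  exact hθ.step _ _ _ _ t.2.2.2 (fun j => (s j).2.2.2)
    (BimoduleOps.evalTreeN_rgraft hM hP' _ _ _ _ _)
    (BimoduleOps.evalTreeN_rgraft hN hQ' _ _ _ _ _) _

/-- The composite `M_∞ ⊗ M_∞ → M ⊗ N → L` respects the differentials. -/
theorem pairMorEval_d (hM : LawfulBimodule M) (hN : LawfulBimodule N)
    (hP' : LawfulOperad P') (hQ' : LawfulOperad Q')
    (hθ : IsPairingDiff (X₁ := M.X) (X₂ := N.X) (X := L.X) M.d N.d L.d θM) {n : ℕ} {d : ℤ}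
    (x : (MInfTensor R).X n d) :
    pairMorEval θM F G ((MInfTensor R).d x) = L.d (pairMorEval θM F G x) := by
  have h : (pairMorEval θM F G ∘ₗ (MInfTensor R).d : (MInfTensor R).X n d →ₗ[R] _) =
      L.d ∘ₗ pairMorEval θM F G := by
    refine Finsupp.lhom_ext' fun t => LinearMap.ext_ring ?_
    change Finsupp.linearCombination R (fun t : MTreePairN n (d - 1) =>
        pairMorEvalTree θM F G t) (Finsupp.linearCombination R _ (Finsupp.single t (1 : R))) =
      L.d (pairMorEval θM F G (Finsupp.single t (1 : R) : MTreePairN n d →₀ R))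
    rw [pairMorEval_single, one_smul, Finsupp.linearCombination_single, one_smul, map_add,
      map_smul, Finsupp.linearCombination_mapDomain, Finsupp.linearCombination_mapDomain]
    refine Eq.trans ?_ (IsPairingDiff.step (X₁ := M.X) (X₂ := N.X) (X := L.X) hθ _ _ t.2.2.2
      (BimoduleOps.d_evalTreeN hM hP' F t.fst) (BimoduleOps.d_evalTreeN hN hQ' G t.snd)
      (by have := t.2.2.2; omega) (by have := t.2.2.2; omega))
    refine congrArg₂ (· + ·) ?_ (congrArg _ ?_)
    · exact congrArg (fun v => Finsupp.linearCombination R v (t.1.1.bd R))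
        (funext fun s => pairMorEvalTree_mk θM F G _ _ _)
    · exact congrArg (fun v => Finsupp.linearCombination R v (t.1.2.bd R))
        (funext fun s => pairMorEvalTree_mk θM F G _ _ _)
  exact LinearMap.congr_fun h x

end Bimodule

end PairEval

/-! ### The convolution operad morphism and the convolution bimodule morphism -/

section Convolution

variable {R : Type u} [CommRing R]

theorem convMul_isPairingComp (C₁ : DGMod.{u, v₁} R) (C₂ : DGMod.{u, v₂} R) (C₃ : DGMod.{u, v₃} R)
    (A₁ : DGMod.{u, w₁} R) (A₂ : DGMod.{u, w₂} R) (A₃ : DGMod.{u, w₃} R) :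
    IsPairingComp (R := R) (X₁ := fun n d => comulSub C₃ C₂ n d)
      (X₂ := fun n d => mulSub A₂ A₃ n d)
      (X := fun n d => mulSub (HomDG C₂ A₂) (HomDG C₃ A₃) n d)
      (Y₁ := fun n d => comulSub C₂ C₁ n d) (Y₂ := fun n d => mulSub A₁ A₂ n d)
      (Y := fun n d => mulSub (HomDG C₁ A₁) (HomDG C₂ A₂) n d)
      (Z₁ := fun n d => comulSub C₃ C₁ n d) (Z₂ := fun n d => mulSub A₁ A₃ n d)
      (Z := fun n d => mulSub (HomDG C₁ A₁) (HomDG C₃ A₃) n d)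
      (fun f g => comulComp f g) (fun f g => mulComp f g) (fun f g => mulComp f g)
      convMulₗ convMulₗ convMulₗ :=
  fun f f' g g' => convMul_comp f f' g g'

theorem convMul_isPairingDiff (C₁ : DGMod.{u, v₁} R) (C₂ : DGMod.{u, v₂} R)
    (A₁ : DGMod.{u, v₃} R) (A₂ : DGMod.{u, v₄} R) :
    IsPairingDiff (R := R) (X₁ := fun n d => comulSub C₂ C₁ n d)
      (X₂ := fun n d => mulSub A₁ A₂ n d)
      (X := fun n d => mulSub (HomDG C₁ A₁) (HomDG C₂ A₂) n d)
      comulDiff mulDiff mulDiff convMulₗ :=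
  fun f f' => convMul_leibniz f f'

/-- The composite `A_∞ → A_∞ ⊗ A_∞ → coEnd_C ⊗ End_A → End_{Hom(C, A)}`. -/
def convHom (Δ : AInfDiagonal R) {C : DGMod.{u, v₁} R} {A : DGMod.{u, v₂} R} (c : AInfCoalgStr C)
    (m : AInfAlgStr A) : OperadHom (AInf R) (EndOp (HomDG C A)) where
  map := convEval c m ∘ₗ Δ.map
  map_one := (congrArg (convEval c m) Δ.map_one).trans
    (pairEval_one (P := CoEndOp C) (Q := EndOp A) (S := EndOp (HomDG C A)) convMulₗ c.op m.op
      (convMul_one C A))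
  map_comp x y := (congrArg (convEval c m) (Δ.map_comp x y)).trans
    (pairEval_comp (P := CoEndOp C) (Q := EndOp A) (S := EndOp (HomDG C A)) convMulₗ c.op m.op
      (coEndOp_lawful C) (endOp_lawful A) (endOp_lawful _) (convMul_isPairingComp C C C A A A) _ _)
  map_d x := (congrArg (convEval c m) (Δ.map_d x)).trans
    (pairEval_d (P := CoEndOp C) (Q := EndOp A) (S := EndOp (HomDG C A)) convMulₗ
      (coEndOp_lawful C) (endOp_lawful A) c m (convMul_isPairingDiff C C A A) _)

variable {C₁ : DGMod.{u, v₁} R} {C₂ : DGMod.{u, v₂} R} {A₁ : DGMod.{u, v₃} R}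
  {A₂ : DGMod.{u, v₄} R} {c₁ : AInfCoalgStr C₁} {c₂ : AInfCoalgStr C₂} {m₁ : AInfAlgStr A₁}
  {m₂ : AInfAlgStr A₂} (G : AInfCoalgMor c₂ c₁) (F : AInfAlgMor m₁ m₂)

theorem convMorEval_lact {k : ℕ} {a : ℤ} {n : Fin k → ℕ} {e : Fin k → ℤ}
    (x : (AInfTensor R).X k a) (y : ∀ j, (MInfTensor R).X (n j) (e j)) :
    convMorEval G F ((MInfTensor R).lact x y) =
      (HomBi (HomDG C₁ A₁) (HomDG C₂ A₂)).lact (convEval c₂ m₂ x)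
        fun j => convMorEval G F (y j) :=
  pairMorEval_lact (P := CoEndOp C₂) (Q := EndOp A₂) (S := EndOp (HomDG C₂ A₂))
    (P' := CoEndOp C₁) (Q' := EndOp A₁) (S' := EndOp (HomDG C₁ A₁)) (M := CoHomBi C₂ C₁)
    (N := HomBi A₁ A₂) (L := HomBi (HomDG C₁ A₁) (HomDG C₂ A₂)) convMulₗ convMulₗ G F
    (coHomBi_lawful C₂ C₁) (homBi_lawful A₁ A₂) (homBi_lawful _ _)
    (convMul_isPairingComp C₁ C₂ C₂ A₁ A₂ A₂) x y

theorem convMorEval_ract {k : ℕ} {a : ℤ} {n : Fin k → ℕ} {e : Fin k → ℤ}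
    (y : (MInfTensor R).X k a) (x : ∀ j, (AInfTensor R).X (n j) (e j)) :
    convMorEval G F ((MInfTensor R).ract y x) =
      (HomBi (HomDG C₁ A₁) (HomDG C₂ A₂)).ract (convMorEval G F y)
        fun j => convEval c₁ m₁ (x j) :=
  pairMorEval_ract (P := CoEndOp C₂) (Q := EndOp A₂) (S := EndOp (HomDG C₂ A₂))
    (P' := CoEndOp C₁) (Q' := EndOp A₁) (S' := EndOp (HomDG C₁ A₁)) (M := CoHomBi C₂ C₁)
    (N := HomBi A₁ A₂) (L := HomBi (HomDG C₁ A₁) (HomDG C₂ A₂)) convMulₗ convMulₗ G F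
    (coHomBi_lawful C₂ C₁) (homBi_lawful A₁ A₂) (homBi_lawful _ _) (coEndOp_lawful C₁)
    (endOp_lawful A₁) (convMul_isPairingComp C₁ C₁ C₂ A₁ A₁ A₂) y x

theorem convMorEval_d {n : ℕ} {d : ℤ} (x : (MInfTensor R).X n d) :
    convMorEval G F ((MInfTensor R).d x) =
      (HomBi (HomDG C₁ A₁) (HomDG C₂ A₂)).d (convMorEval G F x) :=
  pairMorEval_d (P := CoEndOp C₂) (Q := EndOp A₂) (S := EndOp (HomDG C₂ A₂))
    (P' := CoEndOp C₁) (Q' := EndOp A₁) (S' := EndOp (HomDG C₁ A₁)) (M := CoHomBi C₂ C₁)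
    (N := HomBi A₁ A₂) (L := HomBi (HomDG C₁ A₁) (HomDG C₂ A₂)) convMulₗ G F
    (coHomBi_lawful C₂ C₁) (homBi_lawful A₁ A₂) (coEndOp_lawful C₁)
    (endOp_lawful A₁) (convMul_isPairingDiff C₁ C₂ A₁ A₂) x

/-- The composite `M_∞ → M_∞ ⊗ M_∞ → coHom ⊗ Hom → Hom` respects both actions and the differential,
so the universal property of `M_∞` yields the `A_∞`-morphism. The characterizations of `μ₁` and `μ₂`
identify the actions of `A_∞` through `Δ` with those through the two convolution structures. -/
theorem existsUnique_isConvolutionMor {Δ : AInfDiagonal R} (ΔM : MInfDiagonal Δ)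
    {μ₁ : AInfAlgStr (HomDG C₁ A₁)} {μ₂ : AInfAlgStr (HomDG C₂ A₂)}
    (h₁ : IsConvolution Δ c₁ m₁ μ₁) (h₂ : IsConvolution Δ c₂ m₂ μ₂) :
    ∃! H : AInfAlgMor μ₁ μ₂, IsConvolutionMor ΔM G F H := by
  refine BimoduleOps.existsUnique_eval (M := HomBi (HomDG C₁ A₁) (HomDG C₂ A₂)) μ₂ μ₁
    (convMorEval G F ∘ₗ ΔM.map) (fun x y => ?_) (fun y x => ?_) (fun y => ?_) (endOp_lawful _)
    (homBi_lawful _ _)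
  · refine (congrArg (convMorEval G F) (ΔM.map_lact x y)).trans ?_
    rw [h₂ _ _ x]
    exact convMorEval_lact G F _ _
  · refine (congrArg (convMorEval G F) (ΔM.map_ract y x)).trans ?_
    refine (convMorEval_ract G F _ _).trans ?_
    exact congrArg (fun g : ∀ j, (EndOp (HomDG C₁ A₁)).X _ _ =>
      (HomBi (HomDG C₁ A₁) (HomDG C₂ A₂)).ract _ g) (funext fun j => (h₁ _ _ (x j)).symm)
  · exact (congrArg (convMorEval G F) (ΔM.map_d y)).trans (convMorEval_d G F _)

end Convolution

end ConvAInf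

end

/-- Let `Δ` be a diagonal on the operad `A_∞`.
(1) For an `A_∞`-coalgebra `C` and an `A_∞`-algebra `A`, the diagonal `Δ` induces an `A_∞`-algebra
structure on the dg module `(Hom(C, A), [∂, ·])`.
(2) For a diagonal `ΔM` on the operadic bimodule `M_∞` and `A_∞`-morphisms `G : C₂ ⇝ C₁` of
`A_∞`-coalgebras and `F : A₁ ⇝ A₂` of `A_∞`-algebras, `ΔM` induces an `A_∞`-morphism
`Hom(C₁, A₁) ⇝ Hom(C₂, A₂)` between the convolution `A_∞`-algebras. -/
theorem mainTheorem10 {R : Type u} [CommRing R] (Δ : AInfDiagonal R) :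
    (∀ (C : DGMod.{u, v₁} R) (A : DGMod.{u, v₂} R) (c : AInfCoalgStr C) (m : AInfAlgStr A),
      ∃! μ : AInfAlgStr (HomDG C A), IsConvolution Δ c m μ) ∧
    (∀ (ΔM : MInfDiagonal Δ)
      (C₁ : DGMod.{u, v₁} R) (C₂ : DGMod.{u, v₂} R) (A₁ : DGMod.{u, v₃} R) (A₂ : DGMod.{u, v₄} R)
      (c₁ : AInfCoalgStr C₁) (c₂ : AInfCoalgStr C₂) (m₁ : AInfAlgStr A₁) (m₂ : AInfAlgStr A₂)
      (F : AInfAlgMor m₁ m₂) (G : AInfCoalgMor c₂ c₁)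
      (μ₁ : AInfAlgStr (HomDG C₁ A₁)) (μ₂ : AInfAlgStr (HomDG C₂ A₂)),
      IsConvolution Δ c₁ m₁ μ₁ → IsConvolution Δ c₂ m₂ μ₂ →
      ∃! H : AInfAlgMor μ₁ μ₂, IsConvolutionMor ΔM G F H) :=
  ⟨fun C A c m => (convHom Δ c m).existsUnique_eval (endOp_lawful (HomDG C A)),
    fun ΔM _ _ _ _ _ _ _ _ F G _ _ h₁ h₂ => existsUnique_isConvolutionMor G F ΔM h₁ h₂⟩
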